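/- Let $N\ge 1$, let $\mu_N\subset\mathbb C^\times$ be the group of $N$-th roots of unity, and let $A=\mathbb C\langle\!\langle X,Y,t_\zeta\mid\zeta\in\mu_N\rangle\!\rangle/(\sum_\zeta t_\zeta=[X,Y])$, with $\mathfrak p_N\subset A$ the closed Lie subalgebra topologically generated by $X$, $Y$ and the $t_\zeta$. For $x\in A$ and $y\in\mathfrak p_N$ write $x\cdot y$ for the adjoint action. Let $D^1\mathfrak p_N$ be the kernel of $\mathfrak p_N\to\mathbb CX\oplus\mathbb CY$, $t_\zeta\mapsto0$, let $D^2\mathfrak p_N$ be the closure of $[D^1,D^1]$, and put $H=\mathfrak p_N/D^1$. The limit mixed Hodge structure (MHS) on $\mathfrak p_N$ at the tangent vector $\partial/\partial q+\partial/\partial w$ of the universal elliptic curve minus $\mu_N$, at the identity of the nodal fibre $q=0$, is the following. * Its filtrations $M_\bullet$ and $F^\bullet$ are: $M_k$ (resp. $F^k$) consists of the series in words with $-2(\deg_Y+\sum_\zeta\deg_{t_\zeta})\le k$ (resp. $-(\deg_Y+\sum_\zeta\deg_{t_\zeta})\ge k$). * Its $\mathbb Q$-structure is induced from that of $A$, which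 is the completed rational group algebra of $\pi_1(E_{\partial/\partial q}-\mu_N,\partial/\partial w)$, embedded by inverse monodromy. Explicitly, let $\Phi\in\mathbb C\langle\!\langle e_0,e_\zeta\rangle\!\rangle$ be the regularized inverse transport $1+\int\Omega+\int\Omega\Omega+\cdots$ of $\Omega=e_0\frac{dw}{w}+\sum_\zeta e_\zeta\frac{dw}{w-\zeta}$ along $[0,1]$, from $\partial/\partial w$ at $0$ to $-\partial/\partial w$ at $1$. Put $E_0=\frac{X}{e^X-1}\cdot Y$ and $E_\infty=\frac{X}{e^{-X}-1}\cdot Y$. Let $\Phi_{0\eta}\in A$ be the image of $\Phi$ under $e_0\mapsto E_0$, $e_\zeta\mapsto t_{\zeta\eta}$, and let $\Phi_{\infty1}$ be its image under $e_0\mapsto E_\infty$, $e_\zeta\mapsto t_{\zeta^{-1}}$. Then the $\mathbb Q$-structure of $A$ is the closed $\mathbb Q$-subalgebra generated by the following elements and their inverses: $\Theta(\alpha)=\Phi_{\infty1}^{-1}e^{-2\pi iE_\infty}\Phi_{\infty1}$, $\Theta(\beta)=e^{-\pi it_1}\Phi_{01}^{-1}e^{-X}\Phi_{\infty1}$ and,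 for each $\zeta=e^{i\theta}\in\mu_N$ with $0\le\theta<2\pi$, $\Theta(\gamma_\zeta)=P_\zeta e^{2\pi it_\zeta}P_\zeta^{-1}$, where $P_\zeta=e^{-\pi it_1}\Phi_{01}^{-1}e^{i\theta E_0}\Phi_{0\zeta}$. For $m\ge2$ and $\zeta\in\mu_N$ let $V_{m,\zeta}$, an extension of $H$ by $S^mH\cdot t_\zeta$, be the quotient of $\mathfrak p_N$ by the closed subspace spanned by $D^2\mathfrak p_N$ and all $X^aY^b\cdot t_\eta$ with $(a+b,\eta)\ne(m,\zeta)$. It carries the induced MHS, as does $H$. Let $\mathrm{Li}_m(\zeta)=\sum_{k\ge1}\zeta^k/k^m$. For an extension $V\to H$ of MHS, a *de Rham splitting* is a $\mathbb C$-linear section $H\to V$ that maps the $\mathbb Q$-structure of $H$ into that of $V$ and respects $M_\bullet$ (the extension being described by its difference from a section that respects $F^\bullet$ and $M_\bullet$). Let $P_{m,\zeta}$ be the pull-back of $V_{m,\zeta}\oplus V_{m,\bar\zeta}$ along the diagonal $H\to H\oplus H$. Let $\varepsilon_{m+1,\zeta}$ be a derivation of $\mathfrak p_N$ with $\varepsilon_{m+1,\zeta}\equiv\mathrm{ad}\bigl(X^{m-1}\cdot(t_\zeta+(-1)^{m+1}t_{\bar\zeta})\bigr)$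 modulo derivations with values in $D^2\mathfrak p_N$, let $Y\partial/\partial X$ be the continuous derivation with $X\mapsto Y$, $Y\mapsto0$, $t_\zeta\mapsto0$, and let $\varepsilon^{\mathrm{op}}_{m+1,\zeta}=\frac1{(m-1)!}\bigl(\mathrm{ad}\,Y\tfrac{\partial}{\partial X}\bigr)^{m-1}(\varepsilon_{m+1,\zeta})$. Then for all $N\ge1$, $m\ge2$ and $\zeta\in\mu_N$ the following hold. 1. $X\mapsto X$, $Y\mapsto Y$ is a section of $V_{m,\zeta}\to H$ that respects $F^\bullet$ and $M_\bullet$, and $$X\mapsto X-\mathrm{Li}_m(\zeta)\,XY^{m-1}\cdot t_\zeta,\qquad Y\mapsto Y-\mathrm{Li}_m(\zeta)\,Y^m\cdot t_\zeta$$ is a de Rham splitting of $V_{m,\zeta}$. 2. $X\mapsto X$, $Y\mapsto Y$ is a section of $P_{m,\zeta}\to H$ that respects $F^\bullet$ and $M_\bullet$. Moreover, $P_{m,\zeta}$ has the de Rham splitting whose component in $V_{m,\zeta}$ is that of (1) and whose component in $V_{m,\bar\zeta}$ is $X\mapsto X-(-1)^{m+1}\mathrm{Li}_m(\zeta)\,XY^{m-1}\cdot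 t_{\bar\zeta}$, $Y\mapsto Y-(-1)^{m+1}\mathrm{Li}_m(\zeta)\,Y^m\cdot t_{\bar\zeta}$. 3. If $\zeta\ne\bar\zeta$, then $P_{m,\zeta}$, to which $\mathfrak p_N/D^2$ maps, has the de Rham splitting $$X\mapsto X-\mathrm{Li}_m(\zeta)\,XY^{m-1}\cdot(t_\zeta+(-1)^{m+1}t_{\bar\zeta}),\qquad Y\mapsto Y-\mathrm{Li}_m(\zeta)\,Y^m\cdot(t_\zeta+(-1)^{m+1}t_{\bar\zeta}),$$ and this equals $1+\mathrm{Li}_m(\zeta)\,\varepsilon^{\mathrm{op}}_{m+1,\zeta}$ modulo $D^2$, whatever the choice of $\varepsilon_{m+1,\zeta}$. 4. If $\zeta=\bar\zeta$, then $V_{m,\zeta}$ itself has the de Rham splitting $1+\tfrac12\mathrm{Li}_m(\zeta)\,\varepsilon^{\mathrm{op}}_{m+1,\zeta}$ modulo $D^2$. -/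

import Mathlib

noncomputable section

namespace EllPolylog

/-! ### Non-commutative formal power series -/

/-- `NCSeries σ` is `ℂ⟪σ⟫`: a series is given by the coefficients of all words. -/
structure NCSeries (σ : Type) : Type where
  coeff : List σ → ℂ

namespace NCSeries

variable {σ τ : Type}

instance : CoeFun (NCSeries σ) fun _ => List σ → ℂ := ⟨coeff⟩

@[ext] theorem ext {f g : NCSeries σ} (h : ∀ w, f w = g w) : f = g := by
  cases f; cases g; congr; exact funext h

/-- A series as a function. -/
def equivFun : NCSeries σ ≃ (List σ → ℂ) := ⟨coeff, mk, fun _ => rfl, fun _ => rfl⟩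

instance : AddCommGroup (NCSeries σ) := equivFun.addCommGroup

instance {R : Type} [Semiring R] [Module R ℂ] : Module R (NCSeries σ) := equivFun.module R

instance {R S : Type} [Semiring R] [Semiring S] [Module R ℂ] [Module S ℂ] [SMul R S]
    [IsScalarTower R S ℂ] : IsScalarTower R S (NCSeries σ) :=
  ⟨fun a b f => ext fun w => smul_assoc a b (f w)⟩

@[simp] theorem zero_apply (w : List σ) : (0 : NCSeries σ) w = 0 := rfl
@[simp] theorem add_apply (f g : NCSeries σ) (w : List σ) : (f + g) w = f w + g w := rfl
@[simp] theorem sub_apply (f g : NCSeries σ) (w : List σ) : (f - g) w = f w - g w := rfl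
@[simp] theorem neg_apply (f : NCSeries σ) (w : List σ) : (-f) w = -f w := rfl
@[simp] theorem smul_apply {R : Type} [Semiring R] [Module R ℂ] (c : R) (f : NCSeries σ)
    (w : List σ) : (c • f) w = c • f w := rfl

instance : One (NCSeries σ) := ⟨⟨fun w => if w.length = 0 then 1 else 0⟩⟩

/-- The concatenation (Cauchy) product. -/
instance : Mul (NCSeries σ) :=
  ⟨fun f g => ⟨fun w => ∑ i ∈ Finset.range (w.length + 1), f (w.take i) * g (w.drop i)⟩⟩

theorem one_apply (w : List σ) : (1 : NCSeries σ) w = if w.length = 0 then 1 else 0 := rfl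

theorem mul_apply (f g : NCSeries σ) (w : List σ) :
    (f * g) w = ∑ i ∈ Finset.range (w.length + 1), f (w.take i) * g (w.drop i) := rfl

/-- The series `u ↦ f (a u)`. -/
def tail (a : σ) (f : NCSeries σ) : NCSeries σ := ⟨fun u => f (a :: u)⟩

@[simp] theorem tail_apply (a : σ) (f : NCSeries σ) (u : List σ) : tail a f u = f (a :: u) := rfl

@[simp] theorem mul_nil (f g : NCSeries σ) : (f * g) [] = f [] * g [] := by
  simp [mul_apply]

theorem mul_cons (f g : NCSeries σ) (a : σ) (w : List σ) :
    (f * g) (a :: w) = f [] * g (a :: w) + (tail a f * g) w := by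
  simp only [mul_apply, List.length_cons]
  rw [Finset.sum_range_succ']
  simp [add_comm]

theorem tail_mul (f g : NCSeries σ) (a : σ) :
    tail a (f * g) = f [] • tail a g + tail a f * g := by
  ext w; simp [mul_cons]

protected theorem add_mul' (f g h : NCSeries σ) : (f + g) * h = f * h + g * h := by
  ext w; simp [mul_apply, add_mul, Finset.sum_add_distrib]

protected theorem mul_add' (f g h : NCSeries σ) : f * (g + h) = f * g + f * h := by
  ext w; simp [mul_apply, mul_add, Finset.sum_add_distrib]

protected theorem smul_mul' {R : Type} [CommSemiring R] [Algebra R ℂ] (c : R)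
    (f g : NCSeries σ) : (c • f) * g = c • (f * g) := by
  ext w; simp [mul_apply, Finset.smul_sum]

protected theorem mul_smul' {R : Type} [CommSemiring R] [Algebra R ℂ] (c : R)
    (f g : NCSeries σ) : f * (c • g) = c • (f * g) := by
  ext w; simp [mul_apply, Finset.smul_sum]

protected theorem mul_assoc' (f g h : NCSeries σ) : f * g * h = f * (g * h) := by
  ext w
  induction w generalizing f with
  | nil => simp [mul_assoc]
  | cons a w ih =>
    rw [mul_cons, mul_cons, tail_mul, NCSeries.add_mul', NCSeries.smul_mul', mul_cons g h]
    simp only [add_apply, smul_apply, smul_eq_mul, ih, mul_nil]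
    ring

protected theorem one_mul' (f : NCSeries σ) : 1 * f = f := by
  ext w
  cases w with
  | nil => simp [one_apply]
  | cons a w =>
    have : tail a (1 : NCSeries σ) = 0 := by ext u; simp [one_apply]
    rw [mul_cons, this]
    simp [one_apply, mul_apply]

protected theorem mul_one' (f : NCSeries σ) : f * 1 = f := by
  ext w
  induction w generalizing f with
  | nil => simp [one_apply]
  | cons a w ih => rw [mul_cons, ih]; simp [one_apply]

instance : Ring (NCSeries σ) :=
  { (inferInstance : AddCommGroup (NCSeries σ)) with
    mul := (· * ·)
    one := 1
    mul_assoc := NCSeries.mul_assoc'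
    one_mul := NCSeries.one_mul'
    mul_one := NCSeries.mul_one'
    left_distrib := NCSeries.mul_add'
    right_distrib := NCSeries.add_mul'
    zero_mul := fun f => by ext w; simp [mul_apply]
    mul_zero := fun f => by ext w; simp [mul_apply] }

instance {R : Type} [CommSemiring R] [Algebra R ℂ] : Algebra R (NCSeries σ) :=
  Algebra.ofModule NCSeries.smul_mul' NCSeries.mul_smul'

/-- The commutator bracket. -/
instance : LieRing (NCSeries σ) := LieRing.ofAssociativeRing

instance : LieAlgebra ℂ (NCSeries σ) := LieAlgebra.ofAssociativeAlgebra

theorem lie_eq (f g : NCSeries σ) : ⁅f, g⁆ = f * g - g * f := LieRing.of_associative_ring_bracket f g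

/-- The series consisting of a single letter. -/
def letter (a : σ) : NCSeries σ := by
  classical exact ⟨fun w => if w = [a] then 1 else 0⟩

/-- `∑ c_k f ^ k`, for a series `f` without constant term. -/
def psEval (c : ℕ → ℂ) (f : NCSeries σ) : NCSeries σ :=
  ⟨fun w => ∑ k ∈ Finset.range (w.length + 1), c k * (f ^ k) w⟩

/-- The exponential of a series without constant term. -/
def exp (f : NCSeries σ) : NCSeries σ := psEval (fun k => (1 : ℂ) / (k.factorial : ℂ)) f

/-- The inverse `∑ (1 - f) ^ k` of a series with constant term `1`. -/
def inv (f : NCSeries σ) : NCSeries σ := psEval (fun _ => 1) (1 - f)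

/-- `(∑ c_k x ^ k) · y = ∑ c_k ad_x ^ k (y)`, for series `x` and `y` without constant term. -/
def adEval (c : ℕ → ℂ) (x y : NCSeries σ) : NCSeries σ :=
  ⟨fun w => ∑ k ∈ Finset.range (w.length + 1), c k * ((fun z => ⁅x, z⁆)^[k] y) w⟩

/-- The continuous algebra map `ℂ⟪σ⟫ → ℂ⟪τ⟫` that sends the letter `a` to `u a`, where the
series `u a` have no constant term. -/
def subst [Fintype σ] (u : σ → NCSeries τ) (f : NCSeries σ) : NCSeries τ :=
  ⟨fun w => ∑ k ∈ Finset.range (w.length + 1), ∑ v : Fin k → σ,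
    f (List.ofFn v) * (List.ofFn fun i => u (v i)).prod w⟩

/-- `f` and `g` agree modulo the `n`-th power of the augmentation ideal. -/
def AgreeBelow (n : ℕ) (f g : NCSeries σ) : Prop := ∀ w : List σ, w.length < n → f w = g w

/-- The closure of a subspace in the topology defined by the powers of the augmentation ideal. -/
def closure {R : Type} [CommSemiring R] [Algebra R ℂ] (S : Submodule R (NCSeries σ)) :
    Submodule R (NCSeries σ) where
  carrier := {f | ∀ n, ∃ g ∈ S, AgreeBelow n f g}
  zero_mem' := fun _ => ⟨0, S.zero_mem, fun _ _ => rfl⟩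
  add_mem' := by
    intro f g hf hg n
    obtain ⟨f', hf', h1⟩ := hf n
    obtain ⟨g', hg', h2⟩ := hg n
    exact ⟨f' + g', S.add_mem hf' hg', fun w hw => by simp [h1 w hw, h2 w hw]⟩
  smul_mem' := by
    intro c f hf n
    obtain ⟨f', hf', h1⟩ := hf n
    exact ⟨c • f', S.smul_mem c hf', fun w hw => by simp [h1 w hw]⟩

theorem le_closure {R : Type} [CommSemiring R] [Algebra R ℂ] (S : Submodule R (NCSeries σ)) :
    S ≤ closure S := fun f hf _ => ⟨f, hf, fun _ _ => rfl⟩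

theorem AgreeBelow.mul {n : ℕ} {f f' g g' : NCSeries σ} (hf : AgreeBelow n f f')
    (hg : AgreeBelow n g g') : AgreeBelow n (f * g) (f' * g') := by
  intro w hw
  simp only [mul_apply]
  refine Finset.sum_congr rfl fun i _ => ?_
  rw [hf _ (lt_of_le_of_lt (by simp) hw), hg _ (lt_of_le_of_lt (by simp) hw)]

theorem AgreeBelow.lie {n : ℕ} {f f' g g' : NCSeries σ} (hf : AgreeBelow n f f')
    (hg : AgreeBelow n g g') : AgreeBelow n ⁅f, g⁆ ⁅f', g'⁆ := by
  intro w hw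
  simp only [lie_eq, sub_apply]
  rw [hf.mul hg w hw, hg.mul hf w hw]

theorem lie_letter {σ : Type} (f g : NCSeries σ) (a : σ) : ⁅f, g⁆ [a] = 0 := by
  simp [lie_eq, mul_cons, mul_comm]
  ring

end NCSeries

open NCSeries

/-! ### The completed enveloping algebra and the Lie algebra `𝔭_N` -/

variable (N : ℕ) [NeZero N]

/-- The group `μ_N` of complex `N`-th roots of unity. -/
abbrev Mu : Type := rootsOfUnity N ℂ

instance : Fintype (Mu N) := Fintype.ofFinite _

/-- A root of unity as a complex number. -/
def Mu.val {N : ℕ} [NeZero N] (ζ : Mu N) : ℂ := ((ζ : ℂˣ) : ℂ)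

/-- Free generators of `ℂ⟪X, Y, t_ζ⟫ / (∑ t_ζ = [X, Y])`: the letter `t_1` is eliminated by
means of the relation. -/
inductive Letter : Type
  | X : Letter
  | Y : Letter
  | t (ζ : Mu N) (h : ζ ≠ 1) : Letter

/-- The completed algebra `ℂ⟪X, Y, t_ζ : ζ ∈ μ_N⟫ / (∑ t_ζ = [X, Y])`. -/
abbrev A : Type := NCSeries (Letter N)

/-- The generator `X`. -/
def aX : A N := letter Letter.X

/-- The generator `Y`. -/
def aY : A N := letter Letter.Y

open Classical in
/-- The generator `t_ζ`; for `ζ = 1` it is `[X, Y] - ∑_{η ≠ 1} t_η`. -/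
def aT {N : ℕ} [NeZero N] (ζ : Mu N) : A N :=
  if h : ζ = 1 then ⁅aX N, aY N⁆ - ∑ η : {η : Mu N // η ≠ 1}, letter (Letter.t η.1 η.2)
  else letter (Letter.t ζ h)

/-- The defining relation of `A N`. -/
theorem sum_aT : ∑ ζ : Mu N, aT ζ = ⁅aX N, aY N⁆ := by
  classical
  rw [← Finset.add_sum_erase Finset.univ (aT : Mu N → A N) (Finset.mem_univ 1)]
  have h : ∑ ζ ∈ Finset.univ.erase (1 : Mu N), aT ζ
      = ∑ η : {η : Mu N // η ≠ 1}, letter (Letter.t η.1 η.2) := by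
    rw [← Finset.sum_subtype (Finset.univ.erase (1 : Mu N)) (p := fun η => η ≠ 1) (by simp)
      (fun η => aT η) |>.symm]
    refine Finset.sum_congr rfl fun η _ => ?_
    simp [aT, η.2]
  rw [h]
  simp [aT]

/-- The generators `X`, `Y`, `t_ζ`. -/
def gens : Set (A N) := {aX N, aY N} ∪ Set.range (aT : Mu N → A N)

/-- `𝔭_N ⊗ ℂ = 𝕃(X, Y, t_ζ)^ / (∑ t_ζ = [X, Y])`: the closed Lie subalgebra of `A N` that is
topologically generated by `X`, `Y` and the `t_ζ`. -/
def p : LieSubalgebra ℂ (A N) :=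
  { NCSeries.closure (LieSubalgebra.lieSpan ℂ (A N) (gens N)).toSubmodule with
    lie_mem' := by
      intro f g hf hg n
      obtain ⟨f', hf', h1⟩ := hf n
      obtain ⟨g', hg', h2⟩ := hg n
      exact ⟨⁅f', g'⁆, (LieSubalgebra.lieSpan ℂ (A N) (gens N)).lie_mem hf' hg', h1.lie h2⟩ }

theorem mem_p {f : A N} : f ∈ p N ↔
    ∀ n, ∃ g ∈ LieSubalgebra.lieSpan ℂ (A N) (gens N), AgreeBelow n f g := Iff.rfl

theorem gens_mem {f : A N} (hf : f ∈ gens N) : f ∈ p N :=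
  fun _ => ⟨f, LieSubalgebra.subset_lieSpan hf, fun _ _ => rfl⟩

/-- `X` as an element of `𝔭_N`. -/
def pX : p N := ⟨aX N, gens_mem N (by simp [gens])⟩

/-- `Y` as an element of `𝔭_N`. -/
def pY : p N := ⟨aY N, gens_mem N (by simp [gens])⟩

/-- `t_ζ` as an element of `𝔭_N`. -/
def pT {N : ℕ} [NeZero N] (ζ : Mu N) : p N := ⟨aT ζ, gens_mem N (by simp [gens])⟩

/-- The element `X^a Y^b · t_ζ = ad_X^a ad_Y^b (t_ζ)` of `𝔭_N`. -/
def XYt {N : ℕ} [NeZero N] (a b : ℕ) (ζ : Mu N) : p N :=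
  (fun z => ⁅pX N, z⁆)^[a] ((fun z => ⁅pY N, z⁆)^[b] (pT ζ))

/-- The inclusion of `𝔭_N` in `A N`. -/
def incl : p N →ₗ[ℂ] A N := ((p N).incl : p N →ₗ[ℂ] A N)

/-! ### Depth, relative weight and Hodge filtrations -/

/-- `D^1 𝔭_N`: the kernel of `𝔭_N → ℂX ⊕ ℂY`, `t_ζ ↦ 0`. -/
def D1 : Submodule ℂ (A N) where
  carrier := {x | x ∈ p N ∧ x [Letter.X] = 0 ∧ x [Letter.Y] = 0}
  zero_mem' := ⟨(p N).zero_mem, rfl, rfl⟩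
  add_mem' := fun {x y} hx hy => ⟨(p N).add_mem hx.1 hy.1,
    by simp [hx.2.1, hy.2.1], by simp [hx.2.2, hy.2.2]⟩
  smul_mem' := fun c x hx => ⟨(p N).smul_mem c hx.1, by simp [hx.2.1], by simp [hx.2.2]⟩

theorem mem_D1 {x : A N} : x ∈ D1 N ↔ x ∈ p N ∧ x [Letter.X] = 0 ∧ x [Letter.Y] = 0 := Iff.rfl

/-- `D^2 𝔭_N`: the closure of `[D^1, D^1]`. -/
def D2 : Submodule ℂ (A N) :=
  NCSeries.closure (Submodule.span ℂ {z | ∃ x ∈ D1 N, ∃ y ∈ D1 N, z = ⁅x, y⁆})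

/-- `D^1 A`: the closed two-sided ideal generated by the `t_ζ`. -/
def D1A : Submodule ℂ (A N) :=
  NCSeries.closure (Submodule.span ℂ {z | ∃ (x : A N) (ζ : Mu N) (y : A N), z = x * aT ζ * y})

/-- `D^2 A`: the closure of the square of `D^1 A`. -/
def D2A : Submodule ℂ (A N) :=
  NCSeries.closure (Submodule.span ℂ {z | ∃ x ∈ D1A N, ∃ y ∈ D1A N, z = x * y})

/-- The degree of a word in `Y` and the `t_ζ` together. -/
def degYt {N : ℕ} [NeZero N] (w : List (Letter N)) : ℕ := by
  classical exact (w.filter fun l => l ≠ Letter.X).length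

/-- The relative weight filtration `M_k`: words with `-2 (deg_Y + ∑ deg_{t_ζ}) ≤ k`. -/
def weightA (k : ℤ) : Submodule ℂ (A N) where
  carrier := {x | ∀ w, k < -2 * (degYt w : ℤ) → x w = 0}
  zero_mem' := fun _ _ => rfl
  add_mem' := fun hx hy w hw => by simp [hx w hw, hy w hw]
  smul_mem' := fun c x hx w hw => by simp [hx w hw]

/-- The Hodge filtration `F^k`: words with `-(deg_Y + ∑ deg_{t_ζ}) ≥ k`. -/
def hodgeA (k : ℤ) : Submodule ℂ (A N) where
  carrier := {x | ∀ w, -(degYt w : ℤ) < k → x w = 0}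
  zero_mem' := fun _ _ => rfl
  add_mem' := fun hx hy w hw => by simp [hx w hw, hy w hw]
  smul_mem' := fun c x hx w hw => by simp [hx w hw]

/-! ### Regularized transport of the cyclotomic KZ connection -/

/-- The coefficient of `dw` in `dw / w` (for `none`) and in `dw / (w - ζ)` (for `some ζ`). -/
def kzForm {N : ℕ} [NeZero N] : Option (Mu N) → ℝ → ℂ
  | none, s => 1 / (s : ℂ)
  | some ζ, s => 1 / ((s : ℂ) - ζ.val)

/-- The iterated integral of a word of one-forms over the segment from `a` to `b`; the first
letter of the word is integrated over the earliest time. -/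
def iterInt {N : ℕ} [NeZero N] (b : ℝ) : List (Option (Mu N)) → ℝ → ℂ
  | [], _ => 1
  | l :: ls, a => ∫ s in a..b, kzForm l s * iterInt b ls s

/-- Inverse parallel transport `1 + ∫ Ω + ∫ Ω Ω + ⋯` of the connection
`d + e_0 dw/w + ∑ e_ζ dw/(w - ζ)` over the segment from `a` to `b`. -/
def kzTransport (a b : ℝ) : NCSeries (Option (Mu N)) := ⟨fun w => iterInt b w a⟩

/-- The Drinfeld associator `Φ_{01} ∈ ℂ⟪e_0, e_ζ⟫`: regularized inverse transport over the
straight line from the tangent vector `∂/∂w` at `0` to the tangent vector `-∂/∂w` at `1`. -/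
def drinfeld : NCSeries (Option (Mu N)) where
  coeff w :=
    Filter.limUnder (nhdsWithin (0 : ℝ) (Set.Ioi 0)) fun ε =>
      (NCSeries.exp ((Real.log ε : ℂ) • letter none) * kzTransport N ε (1 - ε) *
        NCSeries.exp (-(Real.log ε : ℂ) • letter (some 1)) : NCSeries (Option (Mu N))) w

/-! ### The Hain map and the monodromy of the first order Tate curve -/

/-- The image `(X / (e^X - 1)) · Y` of `e_0` under the Hain map. -/
def e0 : A N := adEval (fun k => (bernoulli k : ℂ) / (k.factorial : ℂ)) (aX N) (aY N)

/-- The image `(X / (e^{-X} - 1)) · Y` of `e_∞` under the Hain map. -/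
def eInf : A N :=
  adEval (fun k => -((-1) ^ k * (bernoulli k : ℂ) / (k.factorial : ℂ))) (aX N) (aY N)

/-- The image in `A N` of `Φ_{0η}`, the inverse transport over the straight line from `η ∂/∂w`
at `0` to `-η ∂/∂w` at `η`. It results from `Φ_{01}` by `e_0 ↦ e_0`, `e_ζ ↦ e_{ζη}`. -/
def Phi0 {N : ℕ} [NeZero N] (η : Mu N) : A N :=
  subst (fun l => l.elim (e0 N) fun ζ => aT (ζ * η)) (drinfeld N)

/-- The image in `A N` of the inverse transport over the straight line from `∞` to `∂/∂w` at
`1`. It results from `Φ_{01}` by the involution `w ↦ 1/w`: `e_0 ↦ e_∞`, `e_ζ ↦ e_{1/ζ}`. -/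
def PhiInf : A N := subst (fun l => l.elim (eInf N) fun ζ => aT ζ⁻¹) (drinfeld N)

/-- The argument of a root of unity in `[0, 2π)`. -/
def angle {N : ℕ} [NeZero N] (ζ : Mu N) : ℝ :=
  toIcoMod Real.two_pi_pos 0 (Complex.arg ζ.val)

/-- Inverse transport along the clockwise half circle about `1` from `∂/∂w` to `-∂/∂w`. -/
def halfTurn : A N := NCSeries.exp (-(Real.pi * Complex.I : ℂ) • aT (1 : Mu N))

/-- Inverse monodromy of the loop `α` based at `∂/∂w` at `1`: to `∞`, around the circle at `∞`
(counter-clockwise about `0`, hence clockwise about `∞`) and back. -/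
def thetaAlpha : A N :=
  NCSeries.inv (PhiInf N) * NCSeries.exp (-(2 * Real.pi * Complex.I : ℂ) • eInf N) * PhiInf N

/-- Inverse monodromy of the loop `β` based at `∂/∂w` at `1`: half a turn about `1`, to `0`,
through the identification of the circle at `0` with the circle at `∞` (with factor of
automorphy `e^{-X}`), and from `∞` back to `1`. -/
def thetaBeta : A N :=
  halfTurn N * NCSeries.inv (Phi0 (1 : Mu N)) * NCSeries.exp (-aX N) * PhiInf N

/-- Inverse transport from `∂/∂w` at `1` to `-ζ ∂/∂w` at `ζ`: half a turn about `1`, to `0`,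
counter-clockwise along the circle at `0` from the direction of `1` to that of `ζ`, and
straight to `ζ`. -/
def toRoot {N : ℕ} [NeZero N] (ζ : Mu N) : A N :=
  halfTurn N * NCSeries.inv (Phi0 (1 : Mu N)) *
    NCSeries.exp ((angle ζ * Complex.I : ℂ) • e0 N) * Phi0 ζ

/-- Inverse monodromy of the loop `γ_ζ` based at `∂/∂w` at `1`, once counter-clockwise
around `ζ`. -/
def thetaGamma {N : ℕ} [NeZero N] (ζ : Mu N) : A N :=
  toRoot ζ * NCSeries.exp ((2 * Real.pi * Complex.I : ℂ) • aT ζ) * NCSeries.inv (toRoot ζ)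

/-- The Betti rational structure of `A N`: the completed group algebra of
`π_1(E_{∂/∂q} - μ_N, ∂/∂w)` over `ℚ`, embedded by inverse monodromy. The fundamental group is
generated by `α`, `β` and the `γ_ζ`; inverses lie in the closure. -/
def ratA : Submodule ℚ (A N) :=
  NCSeries.closure (Subalgebra.toSubmodule (Algebra.adjoin ℚ
    ({thetaAlpha N, thetaBeta N} ∪ Set.range (thetaGamma : Mu N → A N))))

/-! ### Mixed Hodge structures on subquotients, and extensions -/

/-- The data that underlie a `ℚ`-mixed Hodge structure with complexification `V`: the rational
(Betti) structure, the weight filtration (here always `M`) and the Hodge filtration. -/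
structure MHSData (V : Type) [AddCommGroup V] [Module ℂ V] [Module ℚ V] where
  rat : Submodule ℚ V
  weight : ℤ → Submodule ℂ V
  hodge : ℤ → Submodule ℂ V

/-- The quotient of `𝔭_N` by (its intersection with) a subspace `K`. -/
abbrev Quo (K : Submodule ℂ (A N)) : Type := p N ⧸ K.comap (incl N)

/-- The projection to the quotient. -/
def proj (K : Submodule ℂ (A N)) : p N →ₗ[ℂ] Quo N K := (K.comap (incl N)).mkQ

/-- The projection between quotients. -/
def quoMap {K L : Submodule ℂ (A N)} (h : K ≤ L) : Quo N K →ₗ[ℂ] Quo N L :=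
  Submodule.factor (Submodule.comap_mono h)

/-- The natural map from `𝔭_N / K` to `A / (J + K)`. It is used for `J = D^d A` and closed `K`
with `D^d 𝔭_N ⊆ K ⊆ 𝔭_N`, where `d = 1` or `2`; then it is injective, since
`D^d A ∩ 𝔭_N = D^d 𝔭_N`. -/
def toAQuo (K J : Submodule ℂ (A N)) : Quo N K →ₗ[ℂ] A N ⧸ (J ⊔ K) :=
  Submodule.mapQ _ _ (incl N) (Submodule.comap_mono le_sup_right)

/-- The mixed Hodge structure on the quotient `𝔭_N / K` of `𝔭_N`, as a subspace of `A / (J + K)`,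
induced by the limit mixed Hodge structure on the completed group algebra `A ⊇ 𝔭_N`. -/
def quoMHS (K J : Submodule ℂ (A N)) : MHSData (Quo N K) where
  rat := ((ratA N).map ((J ⊔ K).mkQ.restrictScalars ℚ)).comap
    ((toAQuo N K J).restrictScalars ℚ)
  weight k := ((weightA N k).comap (incl N)).map (proj N K)
  hodge k := ((hodgeA N k).comap (incl N)).map (proj N K)

/-- `s` is a Hodge (de Rham) section of the extension `π : V → H`: a `ℂ`-linear section that
respects the Hodge and weight filtrations. -/
structure IsHodgeSection {H V : Type} [AddCommGroup H] [Module ℂ H] [Module ℚ H]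
    [AddCommGroup V] [Module ℂ V] [Module ℚ V] (DH : MHSData H) (DV : MHSData V)
    (π : V →ₗ[ℂ] H) (s : H →ₗ[ℂ] V) : Prop where
  comp_eq : π ∘ₗ s = LinearMap.id
  hodge_le : ∀ k, (DH.hodge k).map s ≤ DV.hodge k
  weight_le : ∀ k, (DH.weight k).map s ≤ DV.weight k

/-- `s`, written in terms of de Rham generators, splits the Betti rational structure of the
extension `π : V → H`: it is a `ℂ`-linear section that maps the rational structure of `H` into
that of `V` and respects the weight filtrations. The class of the extension is that of `s`
minus any Hodge section. -/
structure IsDeRhamSplitting {H V : Type} [AddCommGroup H] [Module ℂ H] [Module ℚ H]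
    [AddCommGroup V] [Module ℂ V] [Module ℚ V] (DH : MHSData H) (DV : MHSData V)
    (π : V →ₗ[ℂ] H) (s : H →ₗ[ℂ] V) : Prop where
  comp_eq : π ∘ₗ s = LinearMap.id
  rat_mem : ∀ h ∈ DH.rat, s h ∈ DV.rat
  weight_le : ∀ k, (DH.weight k).map s ≤ DV.weight k

section Pullback

variable {H V V' : Type} [AddCommGroup H] [Module ℂ H] [AddCommGroup V] [Module ℂ V]
  [Module ℚ V] [AddCommGroup V'] [Module ℂ V'] [Module ℚ V']

/-- The pull-back of `V ⊕ V'` along the diagonal map `H → H ⊕ H`. -/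
abbrev Pull (π : V →ₗ[ℂ] H) (π' : V' →ₗ[ℂ] H) : Submodule ℂ (V × V') :=
  LinearMap.eqLocus (π ∘ₗ LinearMap.fst ℂ V V') (π' ∘ₗ LinearMap.snd ℂ V V')

/-- The projection of the pull-back to `H`. -/
def pullProj (π : V →ₗ[ℂ] H) (π' : V' →ₗ[ℂ] H) : Pull π π' →ₗ[ℂ] H :=
  π ∘ₗ LinearMap.fst ℂ V V' ∘ₗ (Pull π π').subtype

/-- The mixed Hodge structure induced on the pull-back by that of `V ⊕ V'`. -/
def pullMHS [IsScalarTower ℚ ℂ V] [IsScalarTower ℚ ℂ V'] (π : V →ₗ[ℂ] H) (π' : V' →ₗ[ℂ] H)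
    (DV : MHSData V) (DV' : MHSData V') : MHSData (Pull π π') where
  rat := (DV.rat.prod DV'.rat).comap ((Pull π π').subtype.restrictScalars ℚ)
  weight k := ((DV.weight k).prod (DV'.weight k)).comap (Pull π π').subtype
  hodge k := ((DV.hodge k).prod (DV'.hodge k)).comap (Pull π π').subtype

/-- The map to the pull-back defined by a pair of maps that agree over `H`. -/
def pullLift {W : Type} [AddCommGroup W] [Module ℂ W] (π : V →ₗ[ℂ] H) (π' : V' →ₗ[ℂ] H)
    (f : W →ₗ[ℂ] V) (g : W →ₗ[ℂ] V') (h : π ∘ₗ f = π' ∘ₗ g) : W →ₗ[ℂ] Pull π π' :=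
  (f.prod g).codRestrict (Pull π π') fun w => LinearMap.congr_fun h w

end Pullback

/-! ### The extension `V_{m,ζ}` -/

/-- `H_u = 𝔭_N / D^1`, with basis the classes of `X` and `Y`. -/
abbrev H : Type := Quo N (D1 N)

/-- The limit mixed Hodge structure of `H_u`. -/
def HMHS : MHSData (H N) := quoMHS N (D1 N) (D1A N)

/-- The kernel of `𝔭_N → V_{m,ζ}`: the closed subspace spanned by `D^2` and the
`X^a Y^b · t_η` with `(a + b, η) ≠ (m, ζ)`. -/
def kerV {N : ℕ} [NeZero N] (m : ℕ) (ζ : Mu N) : Submodule ℂ (A N) :=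
  NCSeries.closure (D2 N ⊔
    Submodule.span ℂ {z | ∃ a b : ℕ, ∃ η : Mu N, (a + b, η) ≠ (m, ζ) ∧ z = incl N (XYt a b η)})

theorem D1_closed_mem {f : A N} (hf : f ∈ NCSeries.closure (D1 N)) : f ∈ D1 N := by
  rw [mem_D1]
  refine ⟨fun n => ?_, ?_, ?_⟩
  · obtain ⟨g, hg, h1⟩ := hf n
    obtain ⟨g', hg', h2⟩ := hg.1 n
    exact ⟨g', hg', fun w hw => (h1 w hw).trans (h2 w hw)⟩
  · obtain ⟨g, hg, h1⟩ := hf 2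
    rw [h1 _ (by simp), hg.2.1]
  · obtain ⟨g, hg, h1⟩ := hf 2
    rw [h1 _ (by simp), hg.2.2]

theorem lie_mem_D1 (x y : p N) : incl N ⁅x, y⁆ ∈ D1 N :=
  ⟨⁅x, y⁆.2, lie_letter _ _ _, lie_letter _ _ _⟩

theorem aT_mem_D1 {N : ℕ} [NeZero N] (ζ : Mu N) : incl N (pT ζ) ∈ D1 N := by
  have key : ∀ ζ : Mu N, ζ ≠ 1 → (aT ζ) [Letter.X] = 0 ∧ (aT ζ) [Letter.Y] = 0 := by
    intro ζ h
    simp [aT, h, letter]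
  have h1 : aT (1 : Mu N) = ⁅aX N, aY N⁆ - ∑ ζ ∈ Finset.univ.erase (1 : Mu N), aT ζ := by
    rw [← sum_aT N, ← Finset.add_sum_erase Finset.univ _ (Finset.mem_univ (1 : Mu N))]
    simp
  have hs : ∀ (l : Letter N), (∀ ζ : Mu N, ζ ≠ 1 → (aT ζ) [l] = 0) → (aT (1 : Mu N)) [l] = 0 := by
    intro l hl
    have : ∀ s : Finset (Mu N), (1 : Mu N) ∉ s → (∑ ζ ∈ s, aT ζ : A N) [l] = 0 := by
      intro s
      induction s using Finset.induction_on with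
      | empty => intro _; simp
      | insert a s ha ih =>
        intro h
        simp only [Finset.mem_insert, not_or] at h
        rw [Finset.sum_insert ha, add_apply, ih h.2, hl a (Ne.symm h.1), add_zero]
    rw [h1, sub_apply, lie_letter, this _ (by simp), sub_zero]
  refine ⟨(pT ζ).2, ?_⟩
  change (aT ζ) [Letter.X] = 0 ∧ (aT ζ) [Letter.Y] = 0
  by_cases h : ζ = 1
  · subst h
    exact ⟨hs _ fun η hη => (key η hη).1, hs _ fun η hη => (key η hη).2⟩
  · exact key ζ h

theorem XYt_mem_D1 {N : ℕ} [NeZero N] (a b : ℕ) (ζ : Mu N) :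
    incl N (XYt a b ζ) ∈ D1 N := by
  unfold XYt
  cases a with
  | zero =>
    cases b with
    | zero => exact aT_mem_D1 ζ
    | succ b =>
      rw [Function.iterate_zero, id, Function.iterate_succ_apply']
      exact lie_mem_D1 N _ _
  | succ a =>
    rw [Function.iterate_succ_apply']
    exact lie_mem_D1 N _ _

theorem kerV_le {N : ℕ} [NeZero N] (m : ℕ) (ζ : Mu N) : kerV m ζ ≤ D1 N := by
  have hcl : ∀ S : Submodule ℂ (A N), S ≤ D1 N → NCSeries.closure S ≤ D1 N := by
    intro S hS f hf
    refine D1_closed_mem N fun n => ?_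
    obtain ⟨g, hg, h⟩ := hf n
    exact ⟨g, hS hg, h⟩
  refine hcl _ (sup_le (hcl _ (Submodule.span_le.2 ?_)) (Submodule.span_le.2 ?_))
  · rintro _ ⟨x, hx, y, hy, rfl⟩
    exact lie_mem_D1 N ⟨x, hx.1⟩ ⟨y, hy.1⟩
  · rintro _ ⟨a, b, η, -, rfl⟩
    exact XYt_mem_D1 a b η

/-- The sub-quotient `V_{m,ζ}` of `𝔭_N / D^2` generated by `H_u` and `S^m H_u · t_ζ`. -/
abbrev V {N : ℕ} [NeZero N] (m : ℕ) (ζ : Mu N) : Type := Quo N (kerV m ζ)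

/-- The limit mixed Hodge structure of `V_{m,ζ}`. -/
def VMHS {N : ℕ} [NeZero N] (m : ℕ) (ζ : Mu N) : MHSData (V m ζ) := quoMHS N (kerV m ζ) (D2A N)

/-- The projection `𝔭_N → V_{m,ζ}`. -/
def toV {N : ℕ} [NeZero N] (m : ℕ) (ζ : Mu N) : p N →ₗ[ℂ] V m ζ := proj N (kerV m ζ)

/-- The projection `V_{m,ζ} → H_u`. -/
def VtoH {N : ℕ} [NeZero N] (m : ℕ) (ζ : Mu N) : V m ζ →ₗ[ℂ] H N := quoMap N (kerV_le m ζ)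

theorem VtoH_comp_toV {N : ℕ} [NeZero N] (m : ℕ) (ζ : Mu N) :
    VtoH m ζ ∘ₗ toV m ζ = proj N (D1 N) := by
  ext x
  rfl

/-- The coefficient of a letter, as a linear functional on `A N`. -/
def coeffLetter (l : Letter N) : A N →ₗ[ℂ] ℂ where
  toFun f := f [l]
  map_add' _ _ := rfl
  map_smul' _ _ := rfl

/-- The coordinate of `X` on `H_u`. -/
def coordX : H N →ₗ[ℂ] ℂ :=
  Submodule.liftQ _ (coeffLetter N Letter.X ∘ₗ incl N) fun _ hx => hx.2.1

/-- The coordinate of `Y` on `H_u`. -/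
def coordY : H N →ₗ[ℂ] ℂ :=
  Submodule.liftQ _ (coeffLetter N Letter.Y ∘ₗ incl N) fun _ hx => hx.2.2

/-- The linear map on `H_u = ℂX ⊕ ℂY` with `X ↦ v` and `Y ↦ v'`. -/
def ofXY {W : Type} [AddCommGroup W] [Module ℂ W] (v v' : W) : H N →ₗ[ℂ] W :=
  (coordX N).smulRight v + (coordY N).smulRight v'

/-- The linear map `H_u → V_{m,ζ}` with `X ↦ X - c X Y^{m-1} · t_ζ` and `Y ↦ Y - c Y^m · t_ζ`. -/
def splitV {N : ℕ} [NeZero N] (m : ℕ) (ζ : Mu N) (c : ℂ) : H N →ₗ[ℂ] V m ζ :=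
  ofXY N (toV m ζ (pX N - c • XYt 1 (m - 1) ζ)) (toV m ζ (pY N - c • XYt 0 m ζ))

/-- The polylogarithm `Li_m(ζ) = ∑_{k ≥ 1} ζ^k / k^m`. -/
def Li {N : ℕ} [NeZero N] (m : ℕ) (ζ : Mu N) : ℂ :=
  ∑' k : ℕ, ζ.val ^ (k + 1) / ((k : ℂ) + 1) ^ m

/-- The pull-back of `V_{m,ζ} ⊕ V_{m,ζ'}` along the diagonal map `H_u → H_u ⊕ H_u`. -/
abbrev PV {N : ℕ} [NeZero N] (m : ℕ) (ζ ζ' : Mu N) : Submodule ℂ (V m ζ × V m ζ') :=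
  Pull (VtoH m ζ) (VtoH m ζ')

/-- The limit mixed Hodge structure on the pull-back. -/
def PVMHS {N : ℕ} [NeZero N] (m : ℕ) (ζ ζ' : Mu N) : MHSData (PV m ζ ζ') :=
  pullMHS _ _ (VMHS m ζ) (VMHS m ζ')

/-- The projection of the pull-back to `H_u`. -/
def PVtoH {N : ℕ} [NeZero N] (m : ℕ) (ζ ζ' : Mu N) : PV m ζ ζ' →ₗ[ℂ] H N := pullProj _ _

/-- The map from `𝔭_N` to the pull-back, induced by the projections to `V_{m,ζ}` and
`V_{m,ζ'}`. -/
def toPV {N : ℕ} [NeZero N] (m : ℕ) (ζ ζ' : Mu N) : p N →ₗ[ℂ] PV m ζ ζ' :=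
  pullLift _ _ (toV m ζ) (toV m ζ')
    ((VtoH_comp_toV m ζ).trans (VtoH_comp_toV m ζ').symm)

/-! ### The derivations `Y ∂/∂X` and `ε^op` -/

/-- The coefficient of a word `w` in `(Y ∂/∂X) f`, where `Y ∂/∂X` is the continuous derivation of
`A N` with `X ↦ Y` that kills the other letters: the sum of the coefficients in `f` of the words
that result when one of the letters `Y` of `w` is replaced by `X`. -/
def yDxCoeff {N : ℕ} [NeZero N] : List (Letter N) → A N → ℂ
  | [], _ => 0
  | Letter.X :: w, f => yDxCoeff w (tail Letter.X f)
  | Letter.Y :: w, f => f (Letter.X :: w) + yDxCoeff w (tail Letter.Y f)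
  | Letter.t ζ h :: w, f => yDxCoeff w (tail (Letter.t ζ h) f)

theorem yDxCoeff_add {N : ℕ} [NeZero N] (w : List (Letter N)) (f g : A N) :
    yDxCoeff w (f + g) = yDxCoeff w f + yDxCoeff w g := by
  induction w generalizing f g with
  | nil => simp [yDxCoeff]
  | cons a w ih =>
    cases a <;> simp only [yDxCoeff, add_apply] <;>
      rw [show ∀ a : Letter N, tail a (f + g) = tail a f + tail a g from fun a => rfl,
        ih]
    ring

theorem yDxCoeff_smul {N : ℕ} [NeZero N] (w : List (Letter N)) (c : ℂ) (f : A N) :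
    yDxCoeff w (c • f) = c * yDxCoeff w f := by
  induction w generalizing f with
  | nil => simp [yDxCoeff]
  | cons a w ih =>
    cases a <;> simp only [yDxCoeff, NCSeries.smul_apply, smul_eq_mul] <;>
      rw [show ∀ a : Letter N, tail a (c • f) = c • tail a f from fun a => rfl, ih]
    ring

/-- `Y ∂/∂X` as a linear endomorphism of `A N`. -/
def yDxA : A N →ₗ[ℂ] A N where
  toFun f := ⟨fun w => yDxCoeff w f⟩
  map_add' f g := by ext w; exact yDxCoeff_add w f g
  map_smul' c f := by ext w; exact yDxCoeff_smul w c f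

theorem yDxA_apply (f : A N) (w : List (Letter N)) : yDxA N f w = yDxCoeff w f := rfl

theorem yDxA_mul (f g : A N) : yDxA N (f * g) = yDxA N f * g + f * yDxA N g := by
  ext w
  induction w generalizing f g with
  | nil => simp [yDxA_apply, yDxCoeff]
  | cons a w ih =>
    have hs : ∀ (c : ℂ) (h k : A N), yDxCoeff w (c • h + k) = c * yDxCoeff w h + yDxCoeff w k :=
      fun c h k => by rw [yDxCoeff_add, yDxCoeff_smul]
    have h1 := fun a => ih (tail a f) g
    simp only [yDxA_apply, add_apply] at h1
    rw [add_apply, mul_cons, mul_cons, yDxA_apply]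
    have h0 : yDxA N f [] = 0 := rfl
    cases a with
    | X =>
      have e : tail Letter.X (yDxA N f) = yDxA N (tail Letter.X f) := rfl
      rw [e, h0]
      simp only [yDxCoeff, tail_mul, hs, h1, yDxA_apply]
      ring
    | Y =>
      have e : tail Letter.Y (yDxA N f) = tail Letter.X f + yDxA N (tail Letter.Y f) := rfl
      rw [e, h0, add_mul, add_apply]
      simp only [yDxCoeff, tail_mul, hs, h1, yDxA_apply, mul_cons]
      ring
    | t ζ h =>
      have e : tail (Letter.t ζ h) (yDxA N f) = yDxA N (tail (Letter.t ζ h) f) := rfl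
      rw [e, h0]
      simp only [yDxCoeff, tail_mul, hs, h1, yDxA_apply]
      ring

theorem yDxA_lie (f g : A N) : yDxA N ⁅f, g⁆ = ⁅yDxA N f, g⁆ + ⁅f, yDxA N g⁆ := by
  simp only [lie_eq, map_sub, yDxA_mul]
  abel

theorem yDxA_X : yDxA N (aX N) = aY N := by
  ext w
  rw [yDxA_apply]
  rcases w with _ | ⟨a, _ | ⟨b, w⟩⟩
  · simp [yDxCoeff, aY, letter]
  · cases a <;> simp [yDxCoeff, aX, aY, letter]
  · have h : ∀ (v : List (Letter N)) (f : A N), (∀ u, u.length = v.length → f u = 0) →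
        yDxCoeff v f = 0 := by
      intro v
      induction v with
      | nil => intro f _; rfl
      | cons c v ih =>
        intro f hf
        cases c
        · exact ih _ fun u hu => hf _ (by simp [hu])
        · simp only [yDxCoeff]
          rw [ih (tail Letter.Y f) fun u hu => hf (Letter.Y :: u) (by simp [hu]), hf _ (by simp),
            add_zero]
        · exact ih _ fun u hu => hf _ (by simp [hu])
    rw [h]
    · simp [aY, letter]
    · intro u hu
      have : u ≠ [Letter.X] := by rintro rfl; simp at hu
      simp [aX, letter, this]

theorem yDxA_letter (l : Letter N) (hl : l ≠ Letter.X) : yDxA N (letter l) = 0 := by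
  have h : ∀ (v : List (Letter N)) (f : A N), (∀ u, Letter.X ∈ u → f u = 0) →
      yDxCoeff v f = 0 := by
    intro v
    induction v with
    | nil => intro f _; rfl
    | cons c v ih =>
      intro f hf
      cases c
      · exact ih _ fun u hu => hf _ (by simp)
      · simp only [yDxCoeff]
        rw [ih (tail Letter.Y f) fun u hu => hf (Letter.Y :: u) (by simp [hu]), hf _ (by simp),
            add_zero]
      · exact ih _ fun u hu => hf _ (by simp [hu])
  ext w
  rw [yDxA_apply, h]
  · rfl
  · intro u hu
    have : u ≠ [l] := by rintro rfl; simp at hu; exact hl hu.symm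
    simp [letter, this]

theorem yDxA_Y : yDxA N (aY N) = 0 := yDxA_letter N _ (by simp)

theorem yDxA_T (ζ : Mu N) : yDxA N (aT ζ) = 0 := by
  unfold aT
  split_ifs with h
  · rw [map_sub, yDxA_lie, yDxA_X, yDxA_Y, map_sum]
    simp [yDxA_letter]
  · exact yDxA_letter N _ (by simp)

theorem yDxA_mem {f : A N} (hf : f ∈ p N) : yDxA N f ∈ p N := by
  have hspan : ∀ g ∈ LieSubalgebra.lieSpan ℂ (A N) (gens N), yDxA N g ∈ p N := by
    intro g hg
    suffices h : g ∈ p N ∧ yDxA N g ∈ p N from h.2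
    induction hg using LieSubalgebra.lieSpan_induction with
    | mem x hx =>
      refine ⟨gens_mem N hx, ?_⟩
      rcases hx with (rfl | rfl) | ⟨ζ, rfl⟩
      · rw [yDxA_X]; exact (pY N).2
      · rw [yDxA_Y]; exact (p N).zero_mem
      · rw [yDxA_T]; exact (p N).zero_mem
    | zero => exact ⟨(p N).zero_mem, by rw [map_zero]; exact (p N).zero_mem⟩
    | add x y _ _ hx hy =>
      exact ⟨(p N).add_mem hx.1 hy.1, by rw [map_add]; exact (p N).add_mem hx.2 hy.2⟩
    | smul c x _ hx =>
      exact ⟨(p N).smul_mem c hx.1, by rw [map_smul]; exact (p N).smul_mem c hx.2⟩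
    | lie x y _ _ hx hy =>
      refine ⟨(p N).lie_mem hx.1 hy.1, ?_⟩
      rw [yDxA_lie]
      exact (p N).add_mem ((p N).lie_mem hx.2 hy.1) ((p N).lie_mem hx.1 hy.2)
  have hagree : ∀ (v : List (Letter N)) (f g : A N), (∀ u, u.length = v.length → f u = g u) →
      yDxCoeff v f = yDxCoeff v g := by
    intro v
    induction v with
    | nil => intro f g _; rfl
    | cons c v ih =>
      intro f g hf
      cases c
      · exact ih _ _ fun u hu => hf _ (by simp [hu])
      · simp only [yDxCoeff]
        rw [ih (tail Letter.Y f) (tail Letter.Y g) fun u hu => hf (Letter.Y :: u) (by simp [hu]),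
          hf _ (by simp)]
      · exact ih _ _ fun u hu => hf _ (by simp [hu])
  intro n
  obtain ⟨g, hg, h1⟩ := hf n
  obtain ⟨g', hg', h2⟩ := hspan g hg n
  refine ⟨g', hg', fun w hw => ?_⟩
  rw [← h2 w hw, yDxA_apply, yDxA_apply]
  exact hagree w f g fun u hu => h1 u (hu ▸ hw)

/-- The derivation `Y ∂/∂X` of `𝔭_N`: `X ↦ Y`, `Y ↦ 0`, `t_ζ ↦ 0`. -/
def yDx : LieDerivation ℂ (p N) (p N) where
  toFun x := ⟨yDxA N x, yDxA_mem N x.2⟩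
  map_add' x y := by ext1; exact map_add (yDxA N) _ _
  map_smul' c x := by ext1; exact map_smul (yDxA N) _ _
  leibniz' x y := by
    ext1
    have h := yDxA_lie N x y
    change yDxA N ⁅(x : A N), (y : A N)⁆ = ⁅(x : A N), yDxA N y⁆ - ⁅(y : A N), yDxA N x⁆
    rw [h, ← lie_skew (y : A N)]
    abel

/-- `δ ≡ δ' mod D^2 Der 𝔭_N`: the difference takes values in `D^2 𝔭_N`. -/
def DerCongr {N : ℕ} [NeZero N] (δ δ' : LieDerivation ℂ (p N) (p N)) : Prop :=
  ∀ x : p N, incl N (δ x - δ' x) ∈ D2 N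

/-- `ε` is a representative of the derivation `ε_{m+1,ζ}`, namely
`ε ≡ ad (X^{m-1} · (t_ζ + (-1)^{m+1} t_{ζ⁻¹})) mod D^2 Der 𝔭_N`. -/
def IsEps {N : ℕ} [NeZero N] (m : ℕ) (ζ : Mu N) (ε : LieDerivation ℂ (p N) (p N)) : Prop :=
  DerCongr ε (LieDerivation.ad ℂ (p N)
    (XYt (m - 1) 0 ζ + (-1 : ℂ) ^ (m + 1) • XYt (m - 1) 0 ζ⁻¹))

/-- `ε^op = (1 / (m-1)!) (Y ∂/∂X)^{m-1} · ε`, with the adjoint action of `Y ∂/∂X` on `Der 𝔭_N`. -/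
def epsOp {N : ℕ} [NeZero N] (m : ℕ) (ε : LieDerivation ℂ (p N) (p N)) :
    LieDerivation ℂ (p N) (p N) :=
  ((1 : ℂ) / ((m - 1).factorial : ℂ)) • (fun δ => ⁅yDx N, δ⁆)^[m - 1] ε

/-- The de Rham section `X ↦ X`, `Y ↦ Y` of `𝔭_N → H_u`. -/
def drLift : H N →ₗ[ℂ] p N := ofXY N (pX N) (pY N)

/-- The linear map `h ↦ h + c δ(h)` from `H_u = ℂX ⊕ ℂY` to `𝔭_N`, for a derivation `δ`. -/
def onePlus {N : ℕ} [NeZero N] (c : ℂ) (δ : LieDerivation ℂ (p N) (p N)) : H N →ₗ[ℂ] p N :=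
  drLift N + c • ((δ : p N →ₗ[ℂ] p N) ∘ₗ drLift N)

end EllPolylog

end


open EllPolylog

noncomputable section

namespace EllPolylog

namespace NCSeries

variable {σ τ : Type}

/-! Call depth the number of factors `t_ζ`. Modulo the closed ideal `D1A` the algebra is
commutative, and modulo `D2A` conjugation by `1 + φ` with `φ` in `D1A` is `z ↦ z + ⁅z, φ⁆`
(`conj_sub_mem_D2A`). The rational structure of `V_{m,ζ}` is therefore governed by the depth zero
and depth one parts of the generators `Θ`.

The analytic input is the associator in depth one. Its coefficient at `e_0 ^ a e_ξ e_0 ^ b` is a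
regularized integral of `log ^ (a + b) s / (s - ξ)`, equal to a signed binomial coefficient times
`kzCoeff (a + b) ξ`, which up to sign is `Li_{a+b+1}(ξ⁻¹)` if `a + b > 0` (`drinfeld_depthOne`).
Signs and binomials are those of an iterated commutator. Hence, modulo `D2A`, `Φ_{∞1}` is `1 +
phiInf` and `Φ_{01}` is `1 + ySeries kzCoeff`, where both series are combinations of the `Y^k ·
t_η`; in `phiInf` the coefficient for `k > 0` is `-Li_{k+1}(η)`.

The rational structure is a closed `ℚ`-algebra, so it contains the logarithm of an element whenever
that element has constant term `1`. The logarithm of `Θ(α)` is `2πi (-E_∞ + ⁅Y, phiInf⁆)` modulo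
`D2A`; in `V_{m,ζ}` this is `2πi (Y - Li_m(ζ) Y^m · t_ζ)` up to a rational multiple of `2πi X^m ·
t_ζ`, which comes from the Bernoulli numbers in `E_∞`. Transporting `Θ(γ_η)` back by a rational
exponential of this logarithm yields a rational element congruent to `2πi t_η` (`exists_tau`), so
that `(2πi)^(b+1) X^a Y^b · t_η` is rational (`monomial_mem_ratMod`). Finally `Θ(β)` is a conjugate
of `e^{-X}` by `Φ_{∞1}`, multiplied by an element `g` in `1 + D1A`. The inversion relation, by which
`Li_m(η) + (-1)^m Li_m(η⁻¹)` is a rational multiple of `(2πi)^m`, shows that `g` is rational modulo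
`D2A`. After division by `g`, the logarithm shows that `X + ⁅X, phiInf⁆` is rational modulo `D2A`
(`exists_logBeta`); in `V_{m,ζ}` it is `X - Li_m(ζ) X Y^{m-1} · t_ζ`.

The coefficient of a splitting may be changed by any rational multiple of `(2πi)^m`
(`isDeRhamSplitting_V`). With the inversion relation this gives the pull-back and the case `ζ =
ζ⁻¹`. As `ad (Y ∂/∂X)` takes `ad z` to the inner derivation of `Y ∂/∂X (z)`, `ε^op` is `ad (Y^{m-1}
· (t_ζ + (-1)^{m+1} t_{ζ⁻¹}))` modulo `D^2` (`epsOp_sub_mem`), which identifies the splittings with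
`1 + c ε^op`. -/

/-! ### Sums of small families -/

/-- The series `f` has order at least `n`. -/
def OrdGE (n : ℕ) (f : NCSeries σ) : Prop := ∀ w : List σ, w.length < n → f w = 0

theorem OrdGE.mono {m n : ℕ} {f : NCSeries σ} (hf : OrdGE n f) (h : m ≤ n) : OrdGE m f :=
  fun w hw => hf w (hw.trans_le h)

theorem OrdGE.zero (f : NCSeries σ) : OrdGE 0 f := fun w hw => absurd hw (by omega)

theorem ordGE_one {f : NCSeries σ} (hf : f [] = 0) : OrdGE 1 f := by
  intro w hw
  obtain rfl : w = [] := List.length_eq_zero_iff.1 (by omega)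
  exact hf

theorem OrdGE.add {n : ℕ} {f g : NCSeries σ} (hf : OrdGE n f) (hg : OrdGE n g) :
    OrdGE n (f + g) := fun w hw => by simp [hf w hw, hg w hw]

theorem OrdGE.sub {n : ℕ} {f g : NCSeries σ} (hf : OrdGE n f) (hg : OrdGE n g) :
    OrdGE n (f - g) := fun w hw => by simp [hf w hw, hg w hw]

theorem OrdGE.smul {n : ℕ} {f : NCSeries σ} (c : ℂ) (hf : OrdGE n f) : OrdGE n (c • f) :=
  fun w hw => by simp [hf w hw]

theorem OrdGE.sum {ι : Type} {n : ℕ} (s : Finset ι) {f : ι → NCSeries σ}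
    (hf : ∀ i ∈ s, OrdGE n (f i)) : OrdGE n (∑ i ∈ s, f i) := by
  classical
  induction s using Finset.induction_on with
  | empty => intro w _; simp
  | insert a s ha ih =>
    rw [Finset.sum_insert ha]
    exact (hf a (by simp)).add (ih fun i hi => hf i (by simp [hi]))

theorem OrdGE.mul {m n : ℕ} {f g : NCSeries σ} (hf : OrdGE m f) (hg : OrdGE n g) :
    OrdGE (m + n) (f * g) := by
  intro w hw
  rw [mul_apply]
  refine Finset.sum_eq_zero fun i hi => ?_
  have hi' := Finset.mem_range.1 hi
  by_cases h : i < m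
  · rw [hf _ (by simp; omega), zero_mul]
  · rw [hg _ (by simp; omega), mul_zero]

theorem OrdGE.pow {f : NCSeries σ} (hf : OrdGE 1 f) (k : ℕ) : OrdGE k (f ^ k) := by
  induction k with
  | zero => exact OrdGE.zero _
  | succ k ih => rw [pow_succ]; exact ih.mul hf

theorem OrdGE.lie {m n : ℕ} {f g : NCSeries σ} (hf : OrdGE m f) (hg : OrdGE n g) :
    OrdGE (m + n) ⁅f, g⁆ := by
  rw [lie_eq]
  exact (hf.mul hg).sub (add_comm n m ▸ hg.mul hf)

theorem OrdGE.lie_iterate {n : ℕ} {f g : NCSeries σ} (hf : OrdGE 1 f) (hg : OrdGE n g) (k : ℕ) :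
    OrdGE (n + k) ((fun z => ⁅f, z⁆)^[k] g) := by
  induction k with
  | zero => exact hg
  | succ k ih =>
    rw [Function.iterate_succ_apply']
    exact (hf.lie ih).mono (by omega)

theorem sum_apply {ι : Type} (s : Finset ι) (f : ι → NCSeries σ) (w : List σ) :
    (∑ i ∈ s, f i) w = ∑ i ∈ s, f i w := by
  classical
  induction s using Finset.induction_on with
  | empty => simp
  | insert a s ha ih => simp [Finset.sum_insert ha, ih]

/-- The sum of a family of series; it is meaningful if the `k`-th one has order at least `k`. -/
def ssum (f : ℕ → NCSeries σ) : NCSeries σ :=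
  ⟨fun w => ∑ k ∈ Finset.range (w.length + 1), f k w⟩

theorem ssum_apply (f : ℕ → NCSeries σ) (w : List σ) :
    ssum f w = ∑ k ∈ Finset.range (w.length + 1), f k w := rfl

theorem ssum_apply_of_le {f : ℕ → NCSeries σ} (hf : ∀ k, OrdGE k (f k)) {w : List σ} {n : ℕ}
    (hn : w.length < n) : ssum f w = ∑ k ∈ Finset.range n, f k w := by
  rw [ssum_apply]
  refine Finset.sum_subset (Finset.range_mono hn) fun k _ hk => hf k w ?_
  simpa using hk

theorem ssum_agree {f : ℕ → NCSeries σ} (hf : ∀ k, OrdGE k (f k)) (n : ℕ) :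
    AgreeBelow n (ssum f) (∑ k ∈ Finset.range n, f k) := by
  intro w hw
  rw [ssum_apply_of_le hf hw, sum_apply]

theorem ssum_add (f g : ℕ → NCSeries σ) : ssum (fun k => f k + g k) = ssum f + ssum g := by
  ext w; simp [ssum_apply, Finset.sum_add_distrib]

theorem ssum_sub (f g : ℕ → NCSeries σ) : ssum (fun k => f k - g k) = ssum f - ssum g := by
  ext w; simp [ssum_apply, Finset.sum_sub_distrib]

theorem ssum_smul (c : ℂ) (f : ℕ → NCSeries σ) : ssum (fun k => c • f k) = c • ssum f := by
  ext w; simp [ssum_apply, Finset.mul_sum]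

theorem mul_ssum (g : NCSeries σ) {f : ℕ → NCSeries σ} (hf : ∀ k, OrdGE k (f k)) :
    g * ssum f = ssum fun k => g * f k := by
  ext w
  rw [mul_apply, ssum_apply]
  simp only [mul_apply]
  rw [Finset.sum_comm]
  refine Finset.sum_congr rfl fun i _ => ?_
  rw [← Finset.mul_sum, ssum_apply_of_le hf (n := w.length + 1) (by rw [List.length_drop]; omega)]

theorem ssum_mul (g : NCSeries σ) {f : ℕ → NCSeries σ} (hf : ∀ k, OrdGE k (f k)) :
    ssum f * g = ssum fun k => f k * g := by
  ext w
  rw [mul_apply, ssum_apply]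
  simp only [mul_apply]
  rw [Finset.sum_comm]
  refine Finset.sum_congr rfl fun i hi => ?_
  have := Finset.mem_range.1 hi
  rw [← Finset.sum_mul, ssum_apply_of_le hf (n := w.length + 1) (by rw [List.length_take]; omega)]

theorem lie_ssum (g : NCSeries σ) {f : ℕ → NCSeries σ} (hf : ∀ k, OrdGE k (f k)) :
    ⁅g, ssum f⁆ = ssum fun k => ⁅g, f k⁆ := by
  simp only [lie_eq]
  rw [mul_ssum g hf, ssum_mul g hf, ssum_sub]

theorem ssum_mul_ssum {f g : ℕ → NCSeries σ} (hf : ∀ k, OrdGE k (f k))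
    (hg : ∀ k, OrdGE k (g k)) :
    ssum f * ssum g = ssum fun k => ∑ x ∈ Finset.HasAntidiagonal.antidiagonal k, f x.1 * g x.2 := by
  rw [ssum_mul _ hf]
  ext w
  rw [ssum_apply, ssum_apply]
  simp only [mul_ssum _ hg, ssum_apply, sum_apply]
  rw [← Finset.sum_product', Finset.sum_sigma']
  symm
  refine Finset.sum_of_injOn (fun x => x.2) ?_ ?_ ?_ ?_
  · rintro ⟨k, a⟩ h ⟨k', a'⟩ h' (rfl : a = a')
    simp only [Finset.coe_sigma, Set.mem_sigma_iff, Finset.mem_coe, Finset.HasAntidiagonal.mem_antidiagonal] at h h'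
    obtain rfl : k = k' := h.2.symm.trans h'.2
    rfl
  · rintro ⟨k, a⟩ h
    simp only [Finset.coe_sigma, Set.mem_sigma_iff, Finset.mem_coe, Finset.HasAntidiagonal.mem_antidiagonal,
      Finset.mem_range] at h
    simp only [Finset.coe_product, Set.mem_prod, Finset.mem_coe, Finset.mem_range]
    omega
  -- The pairs outside the triangle `i + j ≤ w.length` contribute nothing, because `f i * g j` has
  -- order at least `i + j`.
  · rintro ⟨i, j⟩ _ h2
    refine ((hf i).mul (hg j)) w ?_
    by_contra hlt
    refine h2 ⟨⟨i + j, (i, j)⟩, ?_, rfl⟩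
    simp
    omega
  · intro _ _; rfl

section Closed

variable {R : Type} [CommSemiring R] [Algebra R ℂ]

/-- A subspace is closed if it contains its closure. -/
def IsClosedSub (K : Submodule R (NCSeries σ)) : Prop := closure K ≤ K

theorem isClosedSub_closure (K : Submodule R (NCSeries σ)) : IsClosedSub (closure K) := by
  intro f hf n
  obtain ⟨g, hg, h1⟩ := hf n
  obtain ⟨g', hg', h2⟩ := hg n
  exact ⟨g', hg', fun w hw => (h1 w hw).trans (h2 w hw)⟩

theorem IsClosedSub.ssum_mem {K : Submodule R (NCSeries σ)} (hK : IsClosedSub K)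
    {f : ℕ → NCSeries σ} (hf : ∀ k, OrdGE k (f k)) (h : ∀ k, f k ∈ K) : ssum f ∈ K :=
  hK fun n => ⟨_, K.sum_mem fun k _ => h k, ssum_agree hf n⟩

theorem closure_mono {K L : Submodule R (NCSeries σ)} (h : K ≤ L) : closure K ≤ closure L := by
  intro f hf n
  obtain ⟨g, hg, h1⟩ := hf n
  exact ⟨g, h hg, h1⟩

theorem closure_le {K L : Submodule R (NCSeries σ)} (hL : IsClosedSub L) (h : K ≤ L) :
    closure K ≤ L := (closure_mono h).trans hL

theorem IsClosedSub.ssum_sub_mem {K : Submodule R (NCSeries σ)} (hK : IsClosedSub K)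
    {f g : ℕ → NCSeries σ} (hf : ∀ k, OrdGE k (f k)) (hg : ∀ k, OrdGE k (g k))
    (h : ∀ k, f k - g k ∈ K) : ssum f - ssum g ∈ K := by
  rw [← ssum_sub]
  exact hK.ssum_mem (fun k => (hf k).sub (hg k)) h

end Closed

/-! ### Evaluation of power series -/

/-- Evaluation of a power series in one variable at a series without constant term. -/
def ev (f : NCSeries σ) (p : PowerSeries ℂ) : NCSeries σ :=
  ssum fun k => PowerSeries.coeff k p • f ^ k

theorem ordGE_smul_pow {f : NCSeries σ} (hf : f [] = 0) (c : ℕ → ℂ) (k : ℕ) :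
    OrdGE k (c k • f ^ k) := ((ordGE_one hf).pow k).smul _

theorem psEval_eq_ssum (c : ℕ → ℂ) (f : NCSeries σ) : psEval c f = ssum fun k => c k • f ^ k := rfl

theorem psEval_eq_ev (c : ℕ → ℂ) (f : NCSeries σ) : psEval c f = ev f (PowerSeries.mk c) := by
  simp [psEval_eq_ssum, ev]

theorem exp_eq_ev (f : NCSeries σ) : exp f = ev f (PowerSeries.exp ℂ) := by
  rw [exp, psEval_eq_ev]
  congr 1
  ext k
  simp [PowerSeries.coeff_exp]

theorem ev_mul {f : NCSeries σ} (hf : f [] = 0) (p q : PowerSeries ℂ) :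
    ev f (p * q) = ev f p * ev f q := by
  rw [ev, ev, ev, ssum_mul_ssum (ordGE_smul_pow hf fun k => PowerSeries.coeff k p)
    (ordGE_smul_pow hf fun k => PowerSeries.coeff k q)]
  congr 1
  funext k
  rw [PowerSeries.coeff_mul, Finset.sum_smul]
  refine Finset.sum_congr rfl fun x hx => ?_
  rw [smul_mul_smul_comm, ← pow_add, Finset.HasAntidiagonal.mem_antidiagonal.1 hx]

/-- Evaluation at a series without constant term as a ring homomorphism. -/
def evHom {f : NCSeries σ} (hf : f [] = 0) : PowerSeries ℂ →+* NCSeries σ where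
  toFun := ev f
  map_one' := by
    ext w
    rw [ev, ssum_apply, Finset.sum_eq_single 0]
    · simp
    · intro k _ hk; simp [PowerSeries.coeff_one, hk]
    · simp
  map_mul' := ev_mul hf
  map_zero' := by ext w; simp [ev, ssum_apply]
  map_add' p q := by simp [ev, add_smul, ssum_add]

theorem evHom_apply {f : NCSeries σ} (hf : f [] = 0) (p : PowerSeries ℂ) :
    evHom hf p = ev f p := rfl

theorem ev_X {f : NCSeries σ} (hf : f [] = 0) : ev f PowerSeries.X = f := by
  have h : ∀ k, OrdGE k (PowerSeries.coeff k (PowerSeries.X : PowerSeries ℂ) • f ^ k) :=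
    ordGE_smul_pow hf _
  ext w
  rw [ev, ssum_apply_of_le h (n := w.length + 2) (by omega), Finset.sum_eq_single 1]
  · simp
  · intro k _ hk; simp [PowerSeries.coeff_X, hk]
  · simp

theorem ev_smul (f : NCSeries σ) (c : ℂ) (p : PowerSeries ℂ) : ev f (c • p) = c • ev f p := by
  rw [ev, ev, ← ssum_smul]
  congr 1; funext k
  simp [mul_smul]

theorem ev_C {f : NCSeries σ} (hf : f [] = 0) (c : ℂ) : ev f (PowerSeries.C c) = c • 1 := by
  have := ev_smul f c 1
  rw [← evHom_apply hf 1, map_one] at this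
  rw [← this, PowerSeries.smul_eq_C_mul, mul_one]

theorem exp_neg_mul_exp {f : NCSeries σ} (hf : f [] = 0) : exp (-f) * exp f = 1 := by
  have h : exp (-f) = ev f (PowerSeries.evalNegHom (PowerSeries.exp ℂ)) := by
    rw [exp_eq_ev, ev, ev]
    congr 1; funext k
    rw [neg_pow, PowerSeries.evalNegHom, PowerSeries.coeff_rescale]
    rcases neg_one_pow_eq_or (NCSeries σ) k with h | h <;>
      rcases neg_one_pow_eq_or ℂ k with h' | h' <;> rcases k.even_or_odd with h'' | h'' <;>
      simp [h''.neg_one_pow]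
  rw [h, exp_eq_ev, ← ev_mul hf, mul_comm, PowerSeries.exp_mul_exp_neg_eq_one,
    ← evHom_apply hf, map_one]

theorem exp_mul_exp_neg {f : NCSeries σ} (hf : f [] = 0) : exp f * exp (-f) = 1 := by
  have := exp_neg_mul_exp (f := -f) (by simp [hf])
  rwa [neg_neg] at this

theorem one_sub_nil {f : NCSeries σ} (hf : f [] = 1) : (1 - f) [] = 0 := by
  simp [one_apply, hf]

/-- With `f` as the value of `1 - X` at `1 - f`, the geometric series identity for power series
shows that `inv f` is a two-sided inverse. -/
theorem ev_inv_aux {f : NCSeries σ} (hf : f [] = 1) :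
    ev (1 - f) (1 - PowerSeries.X) = f := by
  rw [← evHom_apply (one_sub_nil hf), map_sub, map_one, evHom_apply, ev_X (one_sub_nil hf)]
  abel

theorem inv_eq_ev (f : NCSeries σ) : inv f = ev (1 - f) (PowerSeries.mk 1) :=
  psEval_eq_ev _ _

theorem mul_inv {f : NCSeries σ} (hf : f [] = 1) : f * inv f = 1 := by
  have h0 := one_sub_nil hf
  have h := ev_mul h0 (1 - PowerSeries.X) (PowerSeries.mk 1)
  rw [ev_inv_aux hf, mul_comm, PowerSeries.mk_one_mul_one_sub_eq_one, ← evHom_apply h0,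
    map_one] at h
  rw [inv_eq_ev, ← h]

theorem inv_mul {f : NCSeries σ} (hf : f [] = 1) : inv f * f = 1 := by
  have h0 := one_sub_nil hf
  have h := ev_mul h0 (PowerSeries.mk 1) (1 - PowerSeries.X)
  rw [ev_inv_aux hf, PowerSeries.mk_one_mul_one_sub_eq_one, ← evHom_apply h0, map_one] at h
  rw [inv_eq_ev, ← h]

theorem psEval_nil (c : ℕ → ℂ) (f : NCSeries σ) : psEval c f [] = c 0 := by
  simp [psEval, one_apply]

theorem exp_nil (f : NCSeries σ) : exp f [] = 1 := by simp [exp, psEval_nil]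

theorem inv_nil (f : NCSeries σ) : inv f [] = 1 := by simp [inv, psEval_nil]

/-- Conjugation is multiplicative and commutes with small sums. It serves to read off the logarithm
of a loop of the form path, circle, path back. -/
theorem psEval_conj {f g h : NCSeries σ} (hf : f [] = 0) (hgh : g * h = 1) (hhg : h * g = 1)
    (c : ℕ → ℂ) : psEval c (h * f * g) = h * psEval c f * g := by
  rw [psEval_eq_ssum, psEval_eq_ssum, mul_ssum h (ordGE_smul_pow hf c), ssum_mul g]
  · congr 1; funext k
    have : (h * f * g) ^ k = h * f ^ k * g := by
      induction k with
      | zero => simp [hhg]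
      | succ k ih =>
        calc (h * f * g) ^ (k + 1) = h * f ^ k * (g * h) * f * g := by
              rw [pow_succ, ih]; simp only [mul_assoc]
          _ = _ := by rw [hgh, mul_one, pow_succ, mul_assoc h]
    rw [this, mul_smul_comm, smul_mul_assoc]
  · intro k
    exact ((OrdGE.zero h).mul (ordGE_smul_pow hf c k)).mono (by omega)

/-- The coefficients of `log (1 + x)`. -/
def logCoeff (k : ℕ) : ℚ := (-1) ^ (k + 1) / k

/-- The derivative of the truncated logarithm at `E - 1` is a geometric sum in `-(E - 1)` times `E`,
hence `1 - (-(E - 1)) ^ n`. So the difference from `X` has vanishing constant term and a derivative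
divisible by `X ^ n`, and is itself divisible by `X ^ (n + 1)`. -/
theorem logCoeff_poly (n : ℕ) : ∃ r : PowerSeries ℂ,
    ∑ k ∈ Finset.range (n + 1), PowerSeries.C (logCoeff k : ℂ) * (PowerSeries.exp ℂ - 1) ^ k =
      PowerSeries.X + PowerSeries.X ^ (n + 1) * r := by
  set E := PowerSeries.exp ℂ with hE
  set L := ∑ k ∈ Finset.range (n + 1), PowerSeries.C (logCoeff k : ℂ) * (E - 1) ^ k with hL
  suffices h : PowerSeries.X ^ (n + 1) ∣ L - PowerSeries.X by
    obtain ⟨r, hr⟩ := h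
    exact ⟨r, by rw [← hr]; ring⟩
  have hE0 : PowerSeries.constantCoeff (E - 1) = 0 := by simp [hE]
  have hd : PowerSeries.derivative ℂ (L - PowerSeries.X) = -(-(E - 1)) ^ n := by
    have h1 : PowerSeries.derivative ℂ L = ∑ j ∈ Finset.range n, (-(E - 1)) ^ j * E := by
      rw [hL, map_sum, Finset.sum_range_succ']
      simp only [pow_zero, mul_one, PowerSeries.derivative_C, add_zero]
      refine Finset.sum_congr rfl fun j _ => ?_
      rw [Derivation.leibniz, PowerSeries.derivative_C, smul_zero, add_zero, Derivation.leibniz_pow,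
        map_sub, hE, PowerSeries.derivative_exp, Derivation.map_one_eq_zero, sub_zero, ← hE]
      have hc : (logCoeff (j + 1) : ℂ) * ((j + 1 : ℕ) : ℂ) = (-1) ^ j := by
        have : ((j : ℂ) + 1) ≠ 0 := by exact_mod_cast Nat.succ_ne_zero j
        simp only [logCoeff]
        push_cast
        field_simp
        ring
      rw [neg_pow, show (-1 : PowerSeries ℂ) ^ j = PowerSeries.C ((-1 : ℂ) ^ j) by simp, ← hc]
      simp only [Nat.add_sub_cancel, smul_eq_mul, nsmul_eq_mul, map_mul, map_natCast]
      ring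
    rw [map_sub, h1, PowerSeries.derivative_X, ← Finset.sum_mul]
    have := geom_sum_mul (-(E - 1)) n
    linear_combination (-1 : PowerSeries ℂ) * this
  rw [PowerSeries.X_pow_dvd_iff]
  intro k hk
  rcases k with _ | k
  · rw [PowerSeries.coeff_zero_eq_constantCoeff_apply, map_sub, hL, map_sum]
    simp only [map_mul, map_pow, hE0, PowerSeries.constantCoeff_X, sub_zero]
    refine Finset.sum_eq_zero fun j _ => ?_
    rcases j with _ | j <;> simp [logCoeff]
  · have h2 := PowerSeries.coeff_derivative (L - PowerSeries.X) k
    have h3 : PowerSeries.X ^ n ∣ PowerSeries.derivative ℂ (L - PowerSeries.X) := by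
      rw [hd, dvd_neg]
      exact pow_dvd_pow_of_dvd (PowerSeries.X_dvd_iff.2 (by rw [map_neg, hE0, neg_zero])) n
    rw [PowerSeries.X_pow_dvd_iff.1 h3 k (by omega)] at h2
    have : ((k : ℂ) + 1) ≠ 0 := by exact_mod_cast Nat.succ_ne_zero k
    exact (mul_eq_zero.1 h2.symm).resolve_right this

/-- At a word of length `n` only the truncated logarithm enters, and the remainder from
`logCoeff_poly` has order `n + 1` after evaluation at `f`. -/
theorem log_exp {f : NCSeries σ} (hf : f [] = 0) :
    psEval (fun k => (logCoeff k : ℂ)) (exp f - 1) = f := by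
  have h0 : (exp f - 1) [] = 0 := by simp [exp_nil, one_apply]
  ext w
  obtain ⟨r, hr⟩ := logCoeff_poly w.length
  have h1 := congrArg (evHom hf) hr
  simp only [map_sum, map_mul, map_add, map_pow, map_sub, map_one, evHom_apply, ev_X hf, ev_C hf,
    ← exp_eq_ev, smul_one_mul] at h1
  have h2 := congrArg (fun g : NCSeries σ => g w) h1
  simp only [sum_apply, add_apply] at h2
  rw [(((ordGE_one hf).pow _).mul (OrdGE.zero (ev f r))) w (by omega), add_zero] at h2
  exact h2

end NCSeries

end EllPolylog

end

noncomputable section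

namespace EllPolylog

open NCSeries

namespace NCSeries

variable {σ τ : Type}

/-! ### Density of polynomials, substitution by degree, iterated adjoint action. -/

theorem ssum_succ {f : ℕ → NCSeries σ} (hf : ∀ k, OrdGE k (f k)) :
    ssum f = f 0 + ssum fun k => f (k + 1) := by
  ext w
  rw [ssum_apply_of_le hf (n := w.length + 2) (by omega), Finset.sum_range_succ', add_apply,
    ssum_apply, add_comm]

theorem closure_mul_left_mem {S : Submodule ℂ (NCSeries σ)} (a : NCSeries σ)
    (h : ∀ x ∈ S, a * x ∈ S) {x : NCSeries σ} (hx : x ∈ closure S) : a * x ∈ closure S := by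
  intro n
  obtain ⟨g, hg, h1⟩ := hx n
  exact ⟨a * g, h g hg, AgreeBelow.mul (fun _ _ => rfl) h1⟩

theorem closure_mul_right_mem {S : Submodule ℂ (NCSeries σ)} (a : NCSeries σ)
    (h : ∀ x ∈ S, x * a ∈ S) {x : NCSeries σ} (hx : x ∈ closure S) : x * a ∈ closure S := by
  intro n
  obtain ⟨g, hg, h1⟩ := hx n
  exact ⟨g * a, h g hg, AgreeBelow.mul h1 (fun _ _ => rfl)⟩

theorem letter_mul_apply_cons [DecidableEq σ] (a b : σ) (f : NCSeries σ) (w : List σ) :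
    (letter a * f) (b :: w) = if b = a then f w else 0 := by
  have h1 : (letter a : NCSeries σ) [] = 0 := by simp [letter]
  have h2 : tail b (letter a : NCSeries σ) = if b = a then 1 else 0 := by
    ext u
    by_cases h : b = a
    · simp [letter, h, one_apply]
    · simp [letter, h]
  rw [mul_cons, h1, h2]
  split_ifs <;> simp

/-- Polynomials in the letters are dense. -/
theorem exists_adjoin_agree [Finite σ] (n : ℕ) (f : NCSeries σ) :
    ∃ g ∈ Algebra.adjoin ℂ (Set.range (letter : σ → NCSeries σ)), AgreeBelow n f g := by
  classical
  have := Fintype.ofFinite σ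
  induction n generalizing f with
  | zero => exact ⟨0, zero_mem _, fun w hw => absurd hw (by omega)⟩
  | succ n ih =>
    choose g hg h using fun a => ih (tail a f)
    refine ⟨f [] • 1 + ∑ a, letter a * g a, add_mem (Subalgebra.smul_mem _ (one_mem _) _)
      (sum_mem fun a _ => mul_mem (Algebra.subset_adjoin ⟨a, rfl⟩) (hg a)), ?_⟩
    intro w hw
    rw [add_apply, sum_apply]
    rcases w with _ | ⟨b, w⟩
    · simp [one_apply, letter]
    · simp only [letter_mul_apply_cons]
      have := h b w (by simpa using hw)
      simp only [tail_apply] at this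
      simp [one_apply, this]

/-- The part of degree `k` in the letters of a substitution. -/
def substPart [Fintype σ] (u : σ → NCSeries τ) (k : ℕ) (f : NCSeries σ) : NCSeries τ :=
  ∑ v : Fin k → σ, f (List.ofFn v) • (List.ofFn fun i => u (v i)).prod

theorem subst_eq_ssum [Fintype σ] (u : σ → NCSeries τ) (f : NCSeries σ) :
    subst u f = ssum fun k => substPart u k f := by
  ext w
  simp [subst, ssum_apply, substPart, sum_apply]

theorem substPart_zero [Fintype σ] (u : σ → NCSeries τ) (f : NCSeries σ) :
    substPart u 0 f = f [] • 1 := by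
  simp [substPart]

/-- Splitting off the first letter gives the recursion for the inductions on degree modulo `D1A` and
`D2A`. -/
theorem substPart_succ [Fintype σ] (u : σ → NCSeries τ) (k : ℕ) (f : NCSeries σ) :
    substPart u (k + 1) f = ∑ a, u a * substPart u k (tail a f) := by
  simp only [substPart, Finset.mul_sum]
  rw [← (Fin.consEquiv fun _ => σ).sum_comp, Fintype.sum_prod_type]
  refine Finset.sum_congr rfl fun a _ => Finset.sum_congr rfl fun v _ => ?_
  simp [Fin.consEquiv, List.ofFn_succ]

theorem substPart_ord [Fintype σ] {u : σ → NCSeries τ} (hu : ∀ a, u a [] = 0) (k : ℕ)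
    (f : NCSeries σ) : OrdGE k (substPart u k f) := by
  induction k generalizing f with
  | zero => exact OrdGE.zero _
  | succ k ih =>
    rw [substPart_succ]
    exact OrdGE.sum _ fun a _ => ((ordGE_one (hu a)).mul (ih _)).mono (by omega)

theorem subst_nil [Fintype σ] (u : σ → NCSeries τ) (f : NCSeries σ) : subst u f [] = f [] := by
  simp [subst_eq_ssum, ssum_apply, substPart_zero, one_apply]

/-- `ad_x ^ k (z)`. -/
def adIter (x : NCSeries σ) (k : ℕ) (z : NCSeries σ) : NCSeries σ := (fun z => ⁅x, z⁆)^[k] z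

@[simp] theorem adIter_zero (x z : NCSeries σ) : adIter x 0 z = z := rfl

theorem adIter_succ (x : NCSeries σ) (k : ℕ) (z : NCSeries σ) :
    adIter x (k + 1) z = ⁅x, adIter x k z⁆ := Function.iterate_succ_apply' _ _ _

/-- Left and right multiplication by `x` commute and `ad x` is their difference, so the binomial
theorem applies. The same signed binomials occur in the depth one coefficients of the associator. -/
theorem adIter_eq_sum (x z : NCSeries σ) (k : ℕ) :
    adIter x k z = ∑ i ∈ Finset.range (k + 1),
      ((-1) ^ (k - i) * (k.choose i : ℂ)) • (x ^ i * z * x ^ (k - i)) := by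
  have h1 : adIter x k z = ((LinearMap.mulLeft ℂ x + -LinearMap.mulRight ℂ x) ^ k) z := by
    induction k with
    | zero => simp
    | succ k ih =>
      rw [adIter_succ, pow_succ', Module.End.mul_apply, ← ih, lie_eq]
      simp [sub_eq_add_neg]
  have hc : Commute (LinearMap.mulLeft ℂ x) (-LinearMap.mulRight ℂ x) :=
    Commute.neg_right (LinearMap.commute_mulLeft_right (R := ℂ) x x)
  rw [h1, hc.add_pow, LinearMap.sum_apply]
  refine Finset.sum_congr rfl fun i _ => ?_
  have h2 : ∀ (j : ℕ) (y : NCSeries σ),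
      ((-LinearMap.mulRight ℂ x) ^ j) y = (-1 : ℂ) ^ j • (y * x ^ j) := by
    intro j y
    induction j generalizing y with
    | zero => simp
    | succ j ih =>
      rw [pow_succ, Module.End.mul_apply, ih]
      simp [pow_succ', mul_assoc]
  rw [Module.End.mul_apply, Module.End.mul_apply, Module.End.natCast_apply, map_nsmul, map_nsmul,
    h2, map_smul, LinearMap.pow_mulLeft, LinearMap.mulLeft_apply, ← mul_assoc,
    ← Nat.cast_smul_eq_nsmul ℂ, smul_smul, mul_comm]

theorem adIter_smul_left (c : ℂ) (x z : NCSeries σ) (k : ℕ) :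
    adIter (c • x) k z = c ^ k • adIter x k z := by
  induction k with
  | zero => simp
  | succ k ih => rw [adIter_succ, adIter_succ, ih, smul_lie, lie_smul, smul_smul, pow_succ']

theorem adIter_smul_right (c : ℂ) (x z : NCSeries σ) (k : ℕ) :
    adIter x k (c • z) = c • adIter x k z := by
  induction k with
  | zero => simp
  | succ k ih => rw [adIter_succ, adIter_succ, ih, lie_smul]

theorem adIter_ord {x z : NCSeries σ} {n : ℕ} (hx : x [] = 0) (hz : OrdGE n z) (k : ℕ) :
    OrdGE (n + k) (adIter x k z) := (ordGE_one hx).lie_iterate hz k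

theorem adEval_eq_ssum (c : ℕ → ℂ) (x y : NCSeries σ) :
    adEval c x y = ssum fun k => c k • adIter x k y := rfl

end NCSeries

variable (N : ℕ) [NeZero N]

instance : Finite (Letter N) := by
  let f : Letter N → Option (Option (Mu N)) := fun
    | Letter.X => none
    | Letter.Y => some none
    | Letter.t ζ _ => some (some ζ)
  refine Finite.of_injective f fun a b h => ?_
  cases a <;> cases b <;> simp_all [f]

/-! ### The ideals `D^1 A` and `D^2 A` -/

theorem isClosedSub_D1A : IsClosedSub (D1A N) := isClosedSub_closure _

theorem isClosedSub_D2A : IsClosedSub (D2A N) := isClosedSub_closure _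

variable {N}

theorem mul_mem_D2A {x y : A N} (hx : x ∈ D1A N) (hy : y ∈ D1A N) : x * y ∈ D2A N :=
  le_closure _ (Submodule.subset_span ⟨x, hx, y, hy, rfl⟩)

theorem aT_mem_D1A (ζ : Mu N) : aT ζ ∈ D1A N :=
  le_closure _ (Submodule.subset_span ⟨1, ζ, 1, by simp⟩)

theorem D1A_mul_left (a : A N) {x : A N} (hx : x ∈ D1A N) : a * x ∈ D1A N := by
  refine closure_mul_left_mem a (fun x hx => ?_) hx
  induction hx using Submodule.span_induction with
  | mem x h =>
    obtain ⟨y, ζ, z, rfl⟩ := h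
    exact Submodule.subset_span ⟨a * y, ζ, z, by simp only [mul_assoc]⟩
  | zero => simp
  | add x y _ _ hx hy => rw [mul_add]; exact add_mem hx hy
  | smul c x _ hx => rw [mul_smul_comm]; exact Submodule.smul_mem _ c hx

theorem D1A_mul_right (a : A N) {x : A N} (hx : x ∈ D1A N) : x * a ∈ D1A N := by
  refine closure_mul_right_mem a (fun x hx => ?_) hx
  induction hx using Submodule.span_induction with
  | mem x h =>
    obtain ⟨y, ζ, z, rfl⟩ := h
    exact Submodule.subset_span ⟨y, ζ, z * a, by simp only [mul_assoc]⟩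
  | zero => simp
  | add x y _ _ hx hy => rw [add_mul]; exact add_mem hx hy
  | smul c x _ hx => rw [smul_mul_assoc]; exact Submodule.smul_mem _ c hx

theorem D2A_mul_left (a : A N) {x : A N} (hx : x ∈ D2A N) : a * x ∈ D2A N := by
  refine closure_mul_left_mem a (fun x hx => ?_) hx
  induction hx using Submodule.span_induction with
  | mem x h =>
    obtain ⟨y, hy, z, hz, rfl⟩ := h
    exact Submodule.subset_span ⟨a * y, D1A_mul_left a hy, z, hz, by simp only [mul_assoc]⟩
  | zero => simp
  | add x y _ _ hx hy => rw [mul_add]; exact add_mem hx hy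
  | smul c x _ hx => rw [mul_smul_comm]; exact Submodule.smul_mem _ c hx

theorem D2A_mul_right (a : A N) {x : A N} (hx : x ∈ D2A N) : x * a ∈ D2A N := by
  refine closure_mul_right_mem a (fun x hx => ?_) hx
  induction hx using Submodule.span_induction with
  | mem x h =>
    obtain ⟨y, hy, z, hz, rfl⟩ := h
    exact Submodule.subset_span ⟨y, hy, z * a, D1A_mul_right a hz, by simp only [mul_assoc]⟩
  | zero => simp
  | add x y _ _ hx hy => rw [add_mul]; exact add_mem hx hy
  | smul c x _ hx => rw [smul_mul_assoc]; exact Submodule.smul_mem _ c hx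

theorem D2A_le_D1A : D2A N ≤ D1A N := by
  refine closure_le (isClosedSub_D1A N) (Submodule.span_le.2 ?_)
  rintro _ ⟨x, hx, y, _, rfl⟩
  exact D1A_mul_right y hx

theorem D1A_lie (a : A N) {x : A N} (hx : x ∈ D1A N) : ⁅a, x⁆ ∈ D1A N := by
  rw [lie_eq]; exact sub_mem (D1A_mul_left a hx) (D1A_mul_right a hx)

theorem D2A_lie (a : A N) {x : A N} (hx : x ∈ D2A N) : ⁅a, x⁆ ∈ D2A N := by
  rw [lie_eq]; exact sub_mem (D2A_mul_left a hx) (D2A_mul_right a hx)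

theorem lie_mem_D2A {x y : A N} (hx : x ∈ D1A N) (hy : y ∈ D1A N) : ⁅x, y⁆ ∈ D2A N := by
  rw [lie_eq]; exact sub_mem (mul_mem_D2A hx hy) (mul_mem_D2A hy hx)

theorem adIter_mem_D1A (x : A N) {z : A N} (hz : z ∈ D1A N) (k : ℕ) : adIter x k z ∈ D1A N := by
  induction k with
  | zero => exact hz
  | succ k ih => rw [adIter_succ]; exact D1A_lie _ ih

theorem lie_letter_mem_D1A (a b : Letter N) : ⁅(letter a : A N), letter b⁆ ∈ D1A N := by
  have ht : ∀ ζ h, (letter (Letter.t ζ h) : A N) ∈ D1A N := fun ζ h => by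
    have := aT_mem_D1A ζ
    rwa [aT, dif_neg h] at this
  have hXY : ⁅(letter Letter.X : A N), letter Letter.Y⁆ ∈ D1A N := by
    have := sum_aT N
    rw [aX, aY] at this
    rw [← this]
    exact sum_mem fun ζ _ => aT_mem_D1A ζ
  cases a <;> cases b
  · simp
  · exact hXY
  · exact D1A_lie _ (ht _ _)
  · rw [← lie_skew]; exact neg_mem hXY
  · simp
  · exact D1A_lie _ (ht _ _)
  all_goals
    rw [← lie_skew]
    exact neg_mem (D1A_lie _ (ht _ _))

/-- `A / D^1 A` is commutative. -/
theorem lie_mem_D1A (f g : A N) : ⁅f, g⁆ ∈ D1A N := by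
  -- Polynomials in the letters are dense and the bracket is a derivation in each argument, so the
  -- brackets of two letters suffice.
  have key : ∀ f ∈ Algebra.adjoin ℂ (Set.range (letter : Letter N → A N)),
      ∀ g ∈ Algebra.adjoin ℂ (Set.range (letter : Letter N → A N)), ⁅f, g⁆ ∈ D1A N := by
    have step : ∀ f : A N, (∀ b : Letter N, ⁅f, (letter b : A N)⁆ ∈ D1A N) →
        ∀ g ∈ Algebra.adjoin ℂ (Set.range (letter : Letter N → A N)), ⁅f, g⁆ ∈ D1A N := by
      intro f hf g hg
      induction hg using Algebra.adjoin_induction with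
      | mem x h => obtain ⟨b, rfl⟩ := h; exact hf b
      | algebraMap r =>
        rw [lie_eq, Algebra.commutes, sub_self]; exact zero_mem _
      | add x y _ _ hx hy => rw [lie_add]; exact add_mem hx hy
      | mul x y _ _ hx hy =>
        have : ⁅f, x * y⁆ = ⁅f, x⁆ * y + x * ⁅f, y⁆ := by simp only [lie_eq]; noncomm_ring
        rw [this]
        exact add_mem (D1A_mul_right y hx) (D1A_mul_left x hy)
    intro f hf
    refine step f fun b => ?_
    rw [← lie_skew]
    exact neg_mem (step _ (fun a => lie_letter_mem_D1A b a) f hf)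
  refine isClosedSub_D1A N fun n => ?_
  obtain ⟨f', hf, h1⟩ := exists_adjoin_agree n f
  obtain ⟨g', hg, h2⟩ := exists_adjoin_agree n g
  exact ⟨⁅f', g'⁆, key f' hf g' hg, h1.lie h2⟩

/-- An element of depth one has a bracket modulo `D2A` that depends on the other argument only
modulo `D1A`. This is what allows `X` and `Y` to be replaced by rational elements inside `ad`. -/
theorem lie_cong {x x' u u' : A N} (hx : x - x' ∈ D1A N) (hu : u' ∈ D1A N)
    (h : u - u' ∈ D2A N) : ⁅x, u⁆ - ⁅x', u'⁆ ∈ D2A N := by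
  have : ⁅x, u⁆ - ⁅x', u'⁆ = ⁅x, u - u'⁆ + ⁅x - x', u'⁆ := by
    rw [lie_sub, sub_lie]; abel
  rw [this]
  exact add_mem (D2A_lie _ h) (lie_mem_D2A hx hu)

theorem adIter_cong {x x' u u' : A N} (hx : x - x' ∈ D1A N) (hu : u' ∈ D1A N)
    (h : u - u' ∈ D2A N) (k : ℕ) : adIter x k u - adIter x' k u' ∈ D2A N := by
  induction k with
  | zero => exact h
  | succ k ih =>
    rw [adIter_succ, adIter_succ]
    exact lie_cong hx (adIter_mem_D1A _ hu k) ih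

/-- The low order coefficients vanish on `D^1 A`. -/
theorem D1A_coeff {f : A N} (hf : f ∈ D1A N) :
    f [] = 0 ∧ f [Letter.X] = 0 ∧ f [Letter.Y] = 0 := by
  have h0 : ∀ ζ : Mu N, (aT ζ) [] = 0 := by
    intro ζ
    unfold aT
    split_ifs <;> simp [letter, lie_eq, sum_apply, mul_comm]
  have hT := fun ζ : Mu N => (aT_mem_D1 (N := N) ζ).2
  have key : ∀ g ∈ Submodule.span ℂ {z | ∃ (x : A N) (ζ : Mu N) (y : A N), z = x * aT ζ * y},
      g [] = 0 ∧ g [Letter.X] = 0 ∧ g [Letter.Y] = 0 := by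
    intro g hg
    induction hg using Submodule.span_induction with
    | mem x h =>
      obtain ⟨y, ζ, z, rfl⟩ := h
      obtain ⟨h1, h2⟩ := hT ζ
      change (aT ζ) [Letter.X] = 0 at h1
      change (aT ζ) [Letter.Y] = 0 at h2
      simp [mul_cons, h0, h1, h2]
    | zero => simp
    | add x y _ _ hx hy => simp [hx, hy]
    | smul c x _ hx => simp [hx]
  obtain ⟨g, hg, h⟩ := hf 2
  obtain ⟨h1, h2, h3⟩ := key g hg
  exact ⟨by rw [h _ (by simp), h1], by rw [h _ (by simp), h2], by rw [h _ (by simp), h3]⟩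

omit [NeZero N] in
theorem aX_nil : (aX N) [] = 0 := by simp [aX, letter]

omit [NeZero N] in
theorem aY_nil : (aY N) [] = 0 := by simp [aY, letter]

theorem aT_nil (ζ : Mu N) : (aT ζ) [] = 0 := (D1A_coeff (aT_mem_D1A ζ)).1

theorem incl_XYt (a b : ℕ) (ζ : Mu N) :
    incl N (XYt a b ζ) = adIter (aX N) a (adIter (aY N) b (aT ζ)) := by
  have h : ∀ (x : p N) (k : ℕ) (z : p N),
      incl N ((fun z => ⁅x, z⁆)^[k] z) = adIter (incl N x) k (incl N z) := by
    intro x k z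
    induction k with
    | zero => rfl
    | succ k ih =>
      rw [Function.iterate_succ_apply', adIter_succ, ← ih]; rfl
  rw [XYt, h, h]; rfl

/-! ### Substitution modulo `D^1 A` and `D^2 A` -/

section Subst

variable {ι : Type} [Fintype ι] {u : Option ι → A N}

/-- Every word with a letter `some i` is sent into the ideal, so only the power of `none` survives.
-/
theorem substPart_sub_mem_D1A (hu : ∀ i, u (some i) ∈ D1A N) (k : ℕ) (f : NCSeries (Option ι)) :
    substPart u k f - f (List.replicate k none) • u none ^ k ∈ D1A N := by
  induction k generalizing f with
  | zero => simp [substPart_zero]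
  | succ k ih =>
    rw [substPart_succ, Fintype.sum_option, add_sub_right_comm]
    refine add_mem ?_ (sum_mem fun i _ => D1A_mul_right _ (hu i))
    have := D1A_mul_left (u none) (ih (tail none f))
    rwa [mul_sub, mul_smul_comm, ← pow_succ', tail_apply, ← List.replicate_succ] at this

/-- Induction on the first letter: after `none` the induction hypothesis applies, whereas after
`some i` the rest of the word matters only modulo `D1A`. -/
theorem substPart_succ_sub_mem_D2A (hu : ∀ i, u (some i) ∈ D1A N) (k : ℕ)
    (f : NCSeries (Option ι)) :
    substPart u (k + 1) f - (f (List.replicate (k + 1) none) • u none ^ (k + 1) +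
      ∑ i, ∑ j ∈ Finset.range (k + 1), f (List.replicate j none ++ some i ::
        List.replicate (k - j) none) • (u none ^ j * u (some i) * u none ^ (k - j))) ∈ D2A N := by
  induction k generalizing f with
  | zero => simp [substPart_succ, substPart_zero, Fintype.sum_option]
  | succ k ih =>
    rw [substPart_succ, Fintype.sum_option]
    have h1 := D2A_mul_left (u none) (ih (tail none f))
    have h2 : ∀ i, u (some i) * substPart u (k + 1) (tail (some i) f) -
        f (some i :: List.replicate (k + 1) none) • (u (some i) * u none ^ (k + 1)) ∈ D2A N := by
      intro i
      have := mul_mem_D2A (hu i) (substPart_sub_mem_D1A hu (k + 1) (tail (some i) f))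
      rwa [mul_sub, mul_smul_comm] at this
    have h3 := add_mem h1 (sum_mem fun i (_ : i ∈ Finset.univ) => h2 i)
    convert h3 using 1
    simp only [Finset.sum_sub_distrib, mul_sub, mul_add, Finset.mul_sum, mul_smul_comm,
      ← pow_succ', tail_apply, ← List.replicate_succ, ← mul_assoc]
    simp only [Finset.sum_range_succ' _ (k + 1), Finset.sum_add_distrib]
    simp [List.replicate_succ]
    abel

/-- The depth one part of a substitution in a series that is primitive in depth one. -/
theorem subst_sub_mem_D2A (hu : ∀ i, u (some i) ∈ D1A N) (h0 : u none [] = 0) {s : ℂ}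
    (hs : u none - s • aY N ∈ D1A N) {f : NCSeries (Option ι)} (hf : f [] = 1)
    (hf0 : ∀ k, f (List.replicate (k + 1) none) = 0) (c : ℕ → ι → ℂ)
    (hf1 : ∀ k i, ∀ j ≤ k, f (List.replicate j none ++ some i :: List.replicate (k - j) none) =
      (-1) ^ (k - j) * (k.choose j : ℂ) * c k i) :
    subst u f - (1 + ssum fun k => ∑ i, (s ^ k * c k i) • adIter (aY N) k (u (some i)))
      ∈ D2A N := by
  have hu0 : ∀ a, u a [] = 0 := by
    rintro (_ | i)
    · exact h0
    · exact (D1A_coeff (hu i)).1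
  have ho := fun k => substPart_ord hu0 k f
  rw [subst_eq_ssum, ssum_succ ho, substPart_zero, hf, one_smul, add_sub_add_left_eq_sub]
  refine (isClosedSub_D2A N).ssum_sub_mem (fun k => (ho _).mono (by omega)) (fun k =>
    OrdGE.sum _ fun i _ => ((adIter_ord aY_nil (OrdGE.zero _) k).smul _).mono (by omega))
    fun k => ?_
  have h1 := substPart_succ_sub_mem_D2A hu k f
  have h2 : ∑ i, ∑ j ∈ Finset.range (k + 1), f (List.replicate j none ++ some i ::
        List.replicate (k - j) none) • (u none ^ j * u (some i) * u none ^ (k - j)) =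
      ∑ i, c k i • adIter (u none) k (u (some i)) := by
    refine Finset.sum_congr rfl fun i _ => ?_
    rw [adIter_eq_sum, Finset.smul_sum]
    refine Finset.sum_congr rfl fun j hj => ?_
    rw [hf1 k i j (by simpa [Nat.lt_succ_iff] using hj), smul_smul, mul_comm (c k i)]
  rw [hf0, zero_smul, zero_add, h2] at h1
  -- Replacing `u none` by `s • aY N` changes these brackets only in depth two, and the scalar comes
  -- out as `s ^ k`.
  have h3 : ∑ i, c k i • adIter (u none) k (u (some i)) -
      ∑ i, (s ^ k * c k i) • adIter (aY N) k (u (some i)) ∈ D2A N := by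
    rw [← Finset.sum_sub_distrib]
    refine sum_mem fun i _ => ?_
    rw [mul_comm, mul_smul, ← smul_sub, ← adIter_smul_left]
    exact Submodule.smul_mem _ _ (adIter_cong hs (hu i) (by simp) k)
  have := add_mem h1 h3
  rwa [sub_add_sub_cancel] at this

end Subst

end EllPolylog

end

noncomputable section

namespace EllPolylog

open NCSeries

namespace NCSeries

variable {σ : Type}

/-! ### Powers and exponentials of a single letter. -/

theorem letter_pow_apply (l : σ) (k : ℕ) (w : List σ) [Decidable (w = List.replicate k l)] :
    ((letter l : NCSeries σ) ^ k) w = if w = List.replicate k l then 1 else 0 := by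
  classical
  induction k generalizing w with
  | zero => rcases w with _ | ⟨a, w⟩ <;> simp [one_apply]
  | succ k ih =>
    rw [pow_succ']
    rcases w with _ | ⟨a, w⟩
    · simp [letter]
    · rw [letter_mul_apply_cons, ih]
      simp [List.replicate_succ, ite_and]

theorem exp_smul_letter_apply (c : ℂ) (l : σ) (w : List σ) :
    exp (c • letter l) w =
      ∑ k ∈ Finset.range (w.length + 1), c ^ k / (k.factorial : ℂ) * ((letter l : NCSeries σ) ^ k) w := by
  simp only [exp, psEval]
  refine Finset.sum_congr rfl fun k _ => ?_
  rw [smul_pow, smul_apply, smul_eq_mul]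
  ring

theorem exp_smul_letter_replicate (c : ℂ) (l : σ) (k : ℕ) :
    exp (c • letter l) (List.replicate k l) = c ^ k / (k.factorial : ℂ) := by
  classical
  rw [exp_smul_letter_apply, Finset.sum_eq_single k]
  · rw [letter_pow_apply, if_pos rfl, mul_one]
  · intro j _ hj
    rw [letter_pow_apply, if_neg, mul_zero]
    intro h
    exact hj (by simpa using (congrArg List.length h).symm)
  · simp

theorem exp_smul_letter_of_mem (c : ℂ) {l a : σ} {w : List σ} (ha : a ∈ w) (hal : a ≠ l) :
    exp (c • letter l) w = 0 := by
  classical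
  rw [exp_smul_letter_apply]
  refine Finset.sum_eq_zero fun k _ => ?_
  rw [letter_pow_apply, if_neg, mul_zero]
  rintro rfl
  exact hal (List.eq_of_mem_replicate ha)

end NCSeries

/-! ### Words of depth at most one -/

section Words

variable {ι : Type}

/-- The word `e_0 ^ a e_i e_0 ^ b`. -/
def depthOne (a : ℕ) (i : ι) (b : ℕ) : List (Option ι) :=
  List.replicate a none ++ some i :: List.replicate b none

theorem depthOne_succ (a : ℕ) (i : ι) (b : ℕ) :
    depthOne (a + 1) i b = none :: depthOne a i b := rfl

theorem depthOne_zero (i : ι) (b : ℕ) : depthOne 0 i b = some i :: List.replicate b none := rfl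

theorem mul_left_replicate (E G : NCSeries (Option ι)) (a : ℕ) :
    (E * G) (List.replicate a none) = ∑ j ∈ Finset.range (a + 1),
      E (List.replicate j none) * G (List.replicate (a - j) none) := by
  induction a generalizing E with
  | zero => simp
  | succ a ih =>
    rw [List.replicate_succ, mul_cons, ih, Finset.sum_range_succ' _ (a + 1), add_comm]
    simp [List.replicate_succ]

/-- A cut behind the letter `some i` contributes nothing, so the cut runs through the initial block
of `none` only. -/
theorem mul_left_depthOne {E : NCSeries (Option ι)} (G : NCSeries (Option ι))
    (hE : ∀ i w, some i ∈ w → E w = 0) (a : ℕ) (i : ι) (b : ℕ) :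
    (E * G) (depthOne a i b) = ∑ j ∈ Finset.range (a + 1),
      E (List.replicate j none) * G (depthOne (a - j) i b) := by
  induction a generalizing E with
  | zero =>
    rw [depthOne_zero, mul_cons]
    have : tail (some i) E = 0 := by ext u; simp [hE i]
    simp [this, depthOne_zero]
  | succ a ih =>
    rw [depthOne_succ, mul_cons, ih (E := tail none E) (fun i w h => hE i _ (by simp [h])),
      Finset.sum_range_succ' _ (a + 1), add_comm]
    simp [List.replicate_succ, depthOne_succ]

theorem mul_right_replicate (F : NCSeries (Option ι)) {E : NCSeries (Option ι)}
    (hE1 : E [] = 1) (hE : ∀ w, none ∈ w → E w = 0) (a : ℕ) :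
    (F * E) (List.replicate a none) = F (List.replicate a none) := by
  induction a generalizing F with
  | zero => simp [hE1]
  | succ a ih =>
    rw [List.replicate_succ, mul_cons, ih, hE _ (by simp)]
    simp

/-- As `E` vanishes on words that contain `none`, the word can be cut only at its end or directly
before `some i`; the latter cut counts only if `b = 0`. -/
theorem mul_right_depthOne (F : NCSeries (Option ι)) {E : NCSeries (Option ι)}
    (hE1 : E [] = 1) (hE : ∀ w, none ∈ w → E w = 0) (a : ℕ) (i : ι) (b : ℕ) :
    (F * E) (depthOne a i b) = F (depthOne a i b) +
      F (List.replicate a none) * E (some i :: List.replicate b none) := by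
  induction a generalizing F with
  | zero =>
    rw [depthOne_zero, mul_cons, mul_right_replicate _ hE1 hE]
    simp [add_comm]
  | succ a ih =>
    rw [depthOne_succ, mul_cons, ih, hE _ (by simp)]
    simp [List.replicate_succ]

end Words

/-! ### Iterated integrals of depth at most one -/

open MeasureTheory Set intervalIntegral Filter Topology

theorem hasDerivAt_integral_left {f : ℝ → ℂ} (hf : ContinuousOn f (Ioo 0 1)) {a b : ℝ}
    (ha : a ∈ Ioo (0 : ℝ) 1) (hb : b ∈ Ioo (0 : ℝ) 1) :
    HasDerivAt (fun x => ∫ s in x..b, f s) (-f a) a := by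
  have hsub : uIcc a b ⊆ Ioo 0 1 := (convex_Ioo (0 : ℝ) 1).ordConnected.uIcc_subset ha hb
  exact integral_hasDerivAt_left ((hf.mono hsub).intervalIntegrable)
    (hf.stronglyMeasurableAtFilter isOpen_Ioo a ha) (hf.continuousAt (isOpen_Ioo.mem_nhds ha))

theorem integral_eq_sub_of_hasDerivAt_Ioo {F f : ℝ → ℂ} (hf : ContinuousOn f (Ioo 0 1))
    (hF : ∀ x ∈ Ioo (0 : ℝ) 1, HasDerivAt F (f x) x) {a b : ℝ}
    (ha : a ∈ Ioo (0 : ℝ) 1) (hb : b ∈ Ioo (0 : ℝ) 1) : ∫ s in a..b, f s = F b - F a := by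
  have hsub : uIcc a b ⊆ Ioo 0 1 := (convex_Ioo (0 : ℝ) 1).ordConnected.uIcc_subset ha hb
  exact integral_eq_sub_of_hasDerivAt (fun x hx => hF x (hsub hx))
    (hf.mono hsub).intervalIntegrable

/-- The real logarithm with complex values. -/
def clog (s : ℝ) : ℂ := (Real.log s : ℂ)

theorem hasDerivAt_clog {s : ℝ} (hs : s ∈ Ioo (0 : ℝ) 1) : HasDerivAt clog (1 / (s : ℂ)) s := by
  have := (Real.hasDerivAt_log hs.1.ne').ofReal_comp
  rw [Complex.ofReal_inv, ← one_div] at this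
  exact this

theorem hasDerivAt_pow_div_factorial {g : ℝ → ℂ} {g' : ℂ} {s : ℝ} (hg : HasDerivAt g g' s)
    (k : ℕ) : HasDerivAt (fun s => g s ^ (k + 1) / ((k + 1).factorial : ℂ))
      (g s ^ k / (k.factorial : ℂ) * g') s := by
  refine ((hg.pow (k + 1)).div_const ((k + 1).factorial : ℂ)).congr_deriv ?_
  rw [Nat.factorial_succ]
  have h1 : (k.factorial : ℂ) ≠ 0 := by exact_mod_cast k.factorial_ne_zero
  have h2 : ((k : ℂ) + 1) ≠ 0 := by exact_mod_cast Nat.succ_ne_zero k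
  push_cast
  field_simp
  try simp

theorem continuousOn_clog : ContinuousOn clog (Ioo 0 1) := fun _ hs =>
  (hasDerivAt_clog hs).continuousAt.continuousWithinAt

theorem continuousOn_inv_ofReal : ContinuousOn (fun s : ℝ => 1 / (s : ℂ)) (Ioo 0 1) := by
  refine ContinuousOn.div continuousOn_const Complex.continuous_ofReal.continuousOn fun s hs => ?_
  exact_mod_cast hs.1.ne'

variable {N : ℕ} [NeZero N]

theorem Mu.norm_val (ξ : Mu N) : ‖ξ.val‖ = 1 :=
  Complex.norm_eq_one_of_mem_rootsOfUnity ξ.2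

theorem ofReal_sub_val_ne_zero (ξ : Mu N) {s : ℝ} (hs : s ∈ Ioo (0 : ℝ) 1) :
    (s : ℂ) - ξ.val ≠ 0 := by
  intro h
  have h1 := congrArg norm (sub_eq_zero.1 h)
  rw [ξ.norm_val, Complex.norm_real, Real.norm_of_nonneg hs.1.le] at h1
  exact hs.2.ne h1

theorem continuousOn_kzForm (l : Option (Mu N)) : ContinuousOn (kzForm l) (Ioo 0 1) := by
  cases l with
  | none => exact continuousOn_inv_ofReal
  | some ξ =>
    exact ContinuousOn.div continuousOn_const
      (Complex.continuous_ofReal.sub continuous_const).continuousOn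
      fun s hs => ofReal_sub_val_ne_zero ξ hs

theorem iterInt_replicate {b : ℝ} (hb : b ∈ Ioo (0 : ℝ) 1) (k : ℕ) {a : ℝ}
    (ha : a ∈ Ioo (0 : ℝ) 1) : iterInt (N := N) b (List.replicate k none) a =
      (clog b - clog a) ^ k / (k.factorial : ℂ) := by
  induction k generalizing a with
  | zero => simp [iterInt]
  | succ k ih =>
    rw [List.replicate_succ, iterInt]
    have hsub : uIcc a b ⊆ Ioo 0 1 := (convex_Ioo (0 : ℝ) 1).ordConnected.uIcc_subset ha hb
    rw [integral_congr (g := fun s => -((clog b - clog s) ^ k / (k.factorial : ℂ) * -(1 / (s : ℂ))))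
      fun s hs => by simp only [kzForm]; rw [ih (hsub hs)]; ring]
    rw [intervalIntegral.integral_neg, integral_eq_sub_of_hasDerivAt_Ioo (F := fun s => (clog b - clog s) ^ (k + 1) /
      ((k + 1).factorial : ℂ)) _ _ ha hb]
    · simp
    · exact (((continuousOn_const.sub continuousOn_clog).pow k).div_const _).mul
        continuousOn_inv_ofReal.neg
    · intro x hx
      exact hasDerivAt_pow_div_factorial ((hasDerivAt_clog hx).const_sub (clog b)) k

theorem hasDerivAt_iterInt_depthOne {b : ℝ} (hb : b ∈ Ioo (0 : ℝ) 1) (n : ℕ) (ξ : Mu N) (k : ℕ) :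
    (∀ a ∈ Ioo (0 : ℝ) 1, HasDerivAt (iterInt b (depthOne 0 ξ k))
      (-(kzForm (some ξ) a * ((clog b - clog a) ^ k / (k.factorial : ℂ)))) a) ∧
    ∀ a ∈ Ioo (0 : ℝ) 1, HasDerivAt (iterInt b (depthOne (n + 1) ξ k))
      (-(1 / (a : ℂ) * iterInt b (depthOne n ξ k) a)) a := by
  have h0 : ∀ a ∈ Ioo (0 : ℝ) 1, HasDerivAt (iterInt b (depthOne 0 ξ k))
      (-(kzForm (some ξ) a * ((clog b - clog a) ^ k / (k.factorial : ℂ)))) a := by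
    intro a ha
    have hc : ContinuousOn (fun s => kzForm (some ξ) s * iterInt (N := N) b (List.replicate k none) s)
        (Ioo 0 1) := by
      refine (continuousOn_kzForm _).mul (ContinuousOn.congr (f := fun s => (clog b - clog s) ^ k / (k.factorial : ℂ))
        (((continuousOn_const.sub continuousOn_clog).pow k).div_const _) fun s hs => iterInt_replicate hb k hs)
    have := hasDerivAt_integral_left hc ha hb
    rwa [iterInt_replicate hb k ha] at this
  refine ⟨h0, ?_⟩
  have hstep : ∀ n, ContinuousOn (iterInt b (depthOne n ξ k)) (Ioo 0 1) →
      ∀ a ∈ Ioo (0 : ℝ) 1, HasDerivAt (iterInt b (depthOne (n + 1) ξ k))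
      (-(1 / (a : ℂ) * iterInt b (depthOne n ξ k) a)) a := fun n hn a ha =>
    hasDerivAt_integral_left ((continuousOn_kzForm none).mul hn) ha hb
  induction n with
  | zero => exact hstep 0 fun a ha => (h0 a ha).continuousAt.continuousWithinAt
  | succ n ih => exact hstep _ fun a ha => (ih a ha).continuousAt.continuousWithinAt

/-- The integrand that describes the regularized depth one iterated integrals. -/
def kzIntegrand (b : ℝ) (n : ℕ) (ξ : Mu N) (k : ℕ) (s : ℝ) : ℂ :=
  clog s ^ n / (n.factorial : ℂ) * (kzForm (some ξ) s * ((clog b - clog s) ^ k / (k.factorial : ℂ)))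

/-- The sum is a coefficient of the exponential of `log a` times `e_0`, multiplied by the transport.
Its derivative in `a` telescopes: every `1 / a` cancels and only minus the integrand remains. Both
sides vanish at `a = b`. -/
theorem sum_iterInt_depthOne {a b : ℝ} (ha : a ∈ Ioo (0 : ℝ) 1) (hb : b ∈ Ioo (0 : ℝ) 1)
    (n : ℕ) (ξ : Mu N) (k : ℕ) :
    ∑ j ∈ Finset.range (n + 1),
      clog a ^ j / (j.factorial : ℂ) * iterInt b (depthOne (n - j) ξ k) a =
    ∫ s in a..b, kzIntegrand b n ξ k s := by
  have hd : ∀ x ∈ Ioo (0 : ℝ) 1, HasDerivAt (fun a => ∑ j ∈ Finset.range (n + 1),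
      clog a ^ j / (j.factorial : ℂ) * iterInt b (depthOne (n - j) ξ k) a)
      (-kzIntegrand b n ξ k x) x := by
    intro x hx
    have hK := fun n => (hasDerivAt_iterInt_depthOne hb n ξ k).2 x hx
    have hK0 := (hasDerivAt_iterInt_depthOne hb 0 ξ k).1 x hx
    induction n with
    | zero => simpa [kzIntegrand] using hK0
    | succ n _ =>
      let dA : ℕ → ℂ := fun j => j.casesOn 0 fun j => clog x ^ j / (j.factorial : ℂ) * (1 / (x : ℂ))
      let dK : ℕ → ℂ := fun j => j.casesOn
        (-(kzForm (some ξ) x * ((clog b - clog x) ^ k / (k.factorial : ℂ))))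
        fun j => -(1 / (x : ℂ) * iterInt b (depthOne j ξ k) x)
      have hA : ∀ j, HasDerivAt (fun a => clog a ^ j / (j.factorial : ℂ)) (dA j) x := by
        rintro (_ | j)
        · simpa [dA] using hasDerivAt_const x (1 : ℂ)
        · exact hasDerivAt_pow_div_factorial (hasDerivAt_clog hx) j
      have hK' : ∀ j, HasDerivAt (iterInt b (depthOne j ξ k)) (dK j) x := by
        rintro (_ | j)
        · exact hK0
        · exact hK j
      refine (HasDerivAt.fun_sum fun j _ => (hA j).mul (hK' (n + 1 - j))).congr_deriv ?_
      rw [Finset.sum_add_distrib, Finset.sum_range_succ', Finset.sum_range_succ _ (n + 1)]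
      have h2 : ∑ j ∈ Finset.range (n + 1), clog x ^ j / (j.factorial : ℂ) * dK (n + 1 - j) =
          -∑ j ∈ Finset.range (n + 1), dA (j + 1) * iterInt b (depthOne (n + 1 - (j + 1)) ξ k) x := by
        rw [← Finset.sum_neg_distrib]
        refine Finset.sum_congr rfl fun j hj => ?_
        rw [Nat.succ_sub (by simpa [Nat.lt_succ_iff] using hj), Nat.add_sub_add_right]
        simp only [dA, dK]
        ring
      rw [h2]
      simp [dA, dK, kzIntegrand]
  have hc : ContinuousOn (fun s => -kzIntegrand b n ξ k s) (Ioo 0 1) :=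
    (((continuousOn_clog.pow n).div_const _).mul ((continuousOn_kzForm _).mul
      (((continuousOn_const.sub continuousOn_clog).pow k).div_const _))).neg
  have := integral_eq_sub_of_hasDerivAt_Ioo hc hd ha hb
  rw [intervalIntegral.integral_neg] at this
  have hb0 : ∀ n, iterInt b (depthOne n ξ k) b = 0 := by
    intro n
    cases n <;> simp [depthOne_zero, depthOne_succ, iterInt]
  simp only [hb0, mul_zero, Finset.sum_const_zero, zero_sub, neg_inj] at this
  exact this.symm

/-- The coefficients of the product whose limit is the Drinfeld associator. -/
theorem regularized_replicate {ε : ℝ} (h0 : 0 < ε) (h1 : ε < 1) (k : ℕ) :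
    (NCSeries.exp ((Real.log ε : ℂ) • letter none) * kzTransport N ε (1 - ε) *
        NCSeries.exp (-(Real.log ε : ℂ) • letter (some 1)) : NCSeries (Option (Mu N)))
      (List.replicate k none) = clog (1 - ε) ^ k / (k.factorial : ℂ) := by
  have hε : ε ∈ Ioo (0 : ℝ) 1 := ⟨h0, h1⟩
  have hε' : 1 - ε ∈ Ioo (0 : ℝ) 1 := ⟨by linarith, by linarith⟩
  rw [mul_right_replicate _ (exp_nil _) fun w hw => exp_smul_letter_of_mem _ hw (by simp),
    mul_left_replicate]
  -- By the binomial theorem the left exponential cancels the logarithmic divergence at `0`.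
  have : clog (1 - ε) = clog ε + (clog (1 - ε) - clog ε) := by ring
  rw [this, add_pow, Finset.sum_div]
  refine Finset.sum_congr rfl fun j hj => ?_
  have hj' : j ≤ k := by simpa [Nat.lt_succ_iff] using hj
  rw [exp_smul_letter_replicate]
  simp only [kzTransport]
  rw [iterInt_replicate hε' _ hε, Nat.cast_choose ℂ hj']
  have h2 : (k.factorial : ℂ) ≠ 0 := by exact_mod_cast k.factorial_ne_zero
  change clog ε ^ j / _ * _ = _
  field_simp

/-- The left exponential turns the iterated integrals into a single one. The right exponential acts
only on the words `e_0 ^ a e_1`, whose last letter is singular at the endpoint `1`. -/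
theorem regularized_depthOne {ε : ℝ} (h0 : 0 < ε) (h1 : ε < 1) (a : ℕ) (ξ : Mu N) (b : ℕ) :
    (NCSeries.exp ((Real.log ε : ℂ) • letter none) * kzTransport N ε (1 - ε) *
        NCSeries.exp (-(Real.log ε : ℂ) • letter (some 1)) : NCSeries (Option (Mu N)))
      (depthOne a ξ b) = (∫ s in ε..(1 - ε), kzIntegrand (1 - ε) a ξ b s) +
        clog (1 - ε) ^ a / (a.factorial : ℂ) * (open Classical in if ξ = 1 ∧ b = 0 then -clog ε else 0) := by
  have hε : ε ∈ Ioo (0 : ℝ) 1 := ⟨h0, h1⟩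
  have hε' : 1 - ε ∈ Ioo (0 : ℝ) 1 := ⟨by linarith, by linarith⟩
  rw [mul_right_depthOne _ (exp_nil _) fun w hw => exp_smul_letter_of_mem _ hw (by simp),
    ← mul_right_replicate _ (E := NCSeries.exp (-(Real.log ε : ℂ) • letter (some 1))) (exp_nil _)
      (fun w hw => exp_smul_letter_of_mem _ hw (by simp)),
    regularized_replicate h0 h1,
    mul_left_depthOne _ fun i w hw => exp_smul_letter_of_mem _ hw (by simp),
    ← sum_iterInt_depthOne hε hε']
  congr 1
  · refine Finset.sum_congr rfl fun j _ => ?_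
    rw [exp_smul_letter_replicate]
    rfl
  · congr 1
    split_ifs with h
    · obtain ⟨rfl, rfl⟩ := h
      have := exp_smul_letter_replicate (-(Real.log ε : ℂ)) (some (1 : Mu N)) 1
      simpa [clog] using this
    · rw [not_and_or] at h
      rcases h with h | h
      · exact exp_smul_letter_of_mem (a := some ξ) _ (by simp) (by simpa using h)
      · exact exp_smul_letter_of_mem (a := none) _ (by simp [h]) (by simp)

end EllPolylog

end

noncomputable section

namespace EllPolylog

open NCSeries MeasureTheory Set Filter Topology

/-! ### Polylogarithms as integrals -/

theorem image_exp_neg_Ioi : (fun t : ℝ => Real.exp (-t)) '' Ioi 0 = Ioo 0 1 := by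
  ext s
  constructor
  · rintro ⟨t, ht, rfl⟩
    exact ⟨Real.exp_pos _, by simpa using ht⟩
  · rintro ⟨h0, h1⟩
    exact ⟨-Real.log s, by simpa using Real.log_neg h0 h1, by simp [Real.exp_log h0]⟩

/-- The substitution `s = exp (-t)` turns this into a Gamma integral. -/
theorem integral_pow_mul_neg_log_pow (k n : ℕ) :
    ∫ s in Ioo (0 : ℝ) 1, s ^ k * (-Real.log s) ^ n = n.factorial / ((k : ℝ) + 1) ^ (n + 1) := by
  rw [← image_exp_neg_Ioi, integral_image_eq_integral_abs_deriv_smul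
    (f' := fun t => -Real.exp (-t)) measurableSet_Ioi]
  · have h := Real.integral_rpow_mul_exp_neg_mul_Ioi (a := n + 1) (r := k + 1) (by positivity)
      (by positivity)
    rw [Real.Gamma_nat_eq_factorial] at h
    have h' : (1 / ((k : ℝ) + 1)) ^ ((n : ℝ) + 1) * n.factorial = n.factorial / ((k : ℝ) + 1) ^ (n + 1) := by
      rw [show (n : ℝ) + 1 = ((n + 1 : ℕ) : ℝ) by push_cast; ring, Real.rpow_natCast]
      rw [one_div, inv_pow]; field_simp
    rw [← h', ← h]
    refine setIntegral_congr_fun measurableSet_Ioi fun t ht => ?_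
    have : (n : ℝ) + 1 - 1 = n := by ring
    simp only [this, Real.rpow_natCast, Real.log_exp, neg_neg, abs_neg, abs_of_pos (Real.exp_pos _),
      smul_eq_mul]
    rw [show -(((k : ℝ) + 1) * t) = -t + (k : ℝ) * (-t) by ring, Real.exp_add, Real.exp_nat_mul]
    ring
  · intro t _
    simpa using ((hasDerivAt_neg t).exp).hasDerivWithinAt
  · intro a _ b _ h
    simpa using h

theorem integrableOn_pow_mul_neg_log_pow (k n : ℕ) :
    IntegrableOn (fun s : ℝ => s ^ k * (-Real.log s) ^ n) (Ioo 0 1) := by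
  -- The integral of a non-integrable function is `0` by convention, so a non-zero value proves
  -- integrability.
  refine Integrable.of_integral_ne_zero ?_
  rw [integral_pow_mul_neg_log_pow]
  positivity

/-- For `s ≤ 1/2` the denominator is at least `1/2`. For `s ≥ 1/2` one has `-log s ≤ 2 (1 - s)`, and
one factor cancels the pole; this needs `n ≠ 0`. The bound is the integrable majorant for dominated
convergence. -/
theorem neg_log_pow_div_le {s : ℝ} (hs : s ∈ Ioo (0 : ℝ) 1) {n : ℕ} (hn : n ≠ 0) :
    (-Real.log s) ^ n / (1 - s) ≤ 2 * (-Real.log s) ^ n + 2 ^ n := by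
  have h0 : 0 < 1 - s := by linarith [hs.2]
  have hl : 0 ≤ -Real.log s := by linarith [Real.log_neg hs.1 hs.2]
  rcases le_total s (1 / 2) with h | h
  · have : (-Real.log s) ^ n / (1 - s) ≤ 2 * (-Real.log s) ^ n := by
      rw [div_le_iff₀ h0]
      nlinarith [pow_nonneg hl n]
    have : (0 : ℝ) ≤ 2 ^ n := by positivity
    linarith
  · have h1 : -Real.log s ≤ 2 * (1 - s) := by
      have h2 := Real.one_sub_inv_le_log_of_pos hs.1
      have h3 : s⁻¹ - 1 = (1 - s) * s⁻¹ := by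
        have := hs.1.ne'
        field_simp
      have h4 : s⁻¹ ≤ 2 := by
        rw [inv_le_comm₀ hs.1 (by norm_num)]; linarith
      nlinarith
    obtain ⟨n, rfl⟩ : ∃ m, n = m + 1 := ⟨n - 1, by omega⟩
    have h5 : (-Real.log s) ^ (n + 1) / (1 - s) ≤ 2 ^ (n + 1) := by
      rw [div_le_iff₀ h0]
      calc (-Real.log s) ^ (n + 1) ≤ (2 * (1 - s)) ^ (n + 1) := pow_le_pow_left₀ hl h1 _
        _ = 2 ^ (n + 1) * ((1 - s) ^ n * (1 - s)) := by rw [mul_pow, pow_succ (1 - s)]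
        _ ≤ 2 ^ (n + 1) * (1 * (1 - s)) := by
          gcongr
          exact pow_le_one₀ h0.le (by linarith [hs.1])
        _ = _ := by ring
    have : (0 : ℝ) ≤ 2 * (-Real.log s) ^ (n + 1) := by positivity
    linarith

theorem integrableOn_neg_log_pow_bound (n : ℕ) :
    IntegrableOn (fun s : ℝ => 2 * (-Real.log s) ^ n + 2 ^ n) (Ioo 0 1) := by
  have := integrableOn_pow_mul_neg_log_pow 0 n
  simp only [pow_zero, one_mul] at this
  exact (this.const_mul 2).add (integrableOn_const (by simp))

variable {N : ℕ} [NeZero N]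

theorem Mu.val_inv (ξ : Mu N) : (ξ⁻¹).val = ξ.val⁻¹ := by
  simp [Mu.val]

theorem Mu.val_ne_zero (ξ : Mu N) : ξ.val ≠ 0 := by simp [Mu.val]

theorem Mu.val_eq_one {ξ : Mu N} : ξ.val = 1 ↔ ξ = 1 := by
  simp [Mu.val]

theorem Mu.val_pow (ξ : Mu N) : ξ.val ^ N = 1 := by
  have := (mem_rootsOfUnity N (ξ : ℂˣ)).1 ξ.2
  simpa [Mu.val] using congrArg Units.val this

theorem norm_kzForm_le (ξ : Mu N) {s : ℝ} (hs : s ∈ Ioo (0 : ℝ) 1) :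
    ‖kzForm (some ξ) s‖ ≤ 1 / (1 - s) := by
  have h0 : 0 < 1 - s := by linarith [hs.2]
  rw [kzForm, norm_div, norm_one]
  refine one_div_le_one_div_of_le h0 ?_
  have := norm_sub_norm_le ξ.val (s : ℂ)
  rw [ξ.norm_val, Complex.norm_real, Real.norm_of_nonneg hs.1.le, norm_sub_rev] at this
  exact this

theorem summable_Li (n : ℕ) (hn : n ≠ 0) (ξ : Mu N) :
    Summable fun k : ℕ => ξ.val ^ (k + 1) / ((k : ℂ) + 1) ^ (n + 1) := by
  have h := (summable_nat_add_iff 1).2 (Real.summable_one_div_nat_pow.2 (show 1 < n + 1 by omega))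
  refine Summable.of_norm (h.congr fun k => ?_)
  rw [norm_div, norm_pow, norm_pow, ξ.norm_val, one_pow]
  congr 2
  rw [← Nat.cast_succ, Complex.norm_natCast]

/-- Expand `1 / (s - ξ) = -∑ ξ^{-(k+1)} s^k` and integrate term by term. The integrals of the
absolute values are `n! / (k + 1)^{n+1}`, which are summable for `n ≠ 0`. -/
theorem integral_clog_pow_mul_kzForm {n : ℕ} (hn : n ≠ 0) (ξ : Mu N) :
    ∫ s in Ioo (0 : ℝ) 1, clog s ^ n * kzForm (some ξ) s =
      (-1) ^ (n + 1) * n.factorial * Li (n + 1) ξ⁻¹ := by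
  let F : ℕ → ℝ → ℂ := fun k s =>
    (-(-1) ^ n * (ξ⁻¹).val ^ (k + 1)) * ((s ^ k * (-Real.log s) ^ n : ℝ) : ℂ)
  have hF : ∀ k, Integrable (F k) (volume.restrict (Ioo 0 1)) := fun k =>
    ((integrableOn_pow_mul_neg_log_pow k n).ofReal (𝕜 := ℂ)).const_mul _
  have hFi : ∀ k, ∫ s in Ioo (0 : ℝ) 1, F k s =
      (-1) ^ (n + 1) * n.factorial * ((ξ⁻¹).val ^ (k + 1) / ((k : ℂ) + 1) ^ (n + 1)) := by
    intro k
    simp only [F]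
    rw [integral_const_mul, integral_complex_ofReal, integral_pow_mul_neg_log_pow]
    push_cast
    ring
  have hFn : ∀ k, ∫ s in Ioo (0 : ℝ) 1, ‖F k s‖ = n.factorial / ((k : ℝ) + 1) ^ (n + 1) := by
    intro k
    rw [← integral_pow_mul_neg_log_pow]
    refine setIntegral_congr_fun measurableSet_Ioo fun s hs => ?_
    have hl : 0 ≤ -Real.log s := by linarith [Real.log_neg hs.1 hs.2]
    simp only [F]
    rw [norm_mul, norm_mul, norm_neg, norm_pow, norm_pow, norm_neg, norm_one, Mu.norm_val,
      Complex.norm_real, Real.norm_of_nonneg (mul_nonneg (pow_nonneg hs.1.le _) (pow_nonneg hl _))]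
    simp
  have hs : Summable fun k => ∫ s in Ioo (0 : ℝ) 1, ‖F k s‖ := by
    simp only [hFn]
    have h := (summable_nat_add_iff 1).2 (Real.summable_one_div_nat_pow.2 (show 1 < n + 1 by omega))
    refine (h.mul_left (n.factorial : ℝ)).congr fun k => ?_
    push_cast
    ring
  have key := (hasSum_integral_of_summable_integral_norm hF hs).tsum_eq
  simp only [hFi] at key
  rw [tsum_mul_left] at key
  rw [Li, key]
  refine setIntegral_congr_fun measurableSet_Ioo fun s hs => ?_
  simp only [F, Complex.ofReal_mul]
  have h1 : ∀ k : ℕ, -(-1 : ℂ) ^ n * (ξ⁻¹).val ^ (k + 1) * (((s ^ k : ℝ) : ℂ) * (((-Real.log s) ^ n : ℝ) : ℂ))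
      = (-clog s ^ n * (ξ⁻¹).val) * ((ξ⁻¹).val * s) ^ k := by
    intro k
    have : ((-1 : ℂ) ^ n) * (-1) ^ n = 1 := by rw [← mul_pow]; simp
    simp only [clog]
    push_cast
    rw [neg_pow (Real.log s : ℂ), mul_pow, pow_succ]
    linear_combination (-(Real.log s : ℂ) ^ n * (ξ⁻¹).val ^ k * (ξ⁻¹).val * s ^ k) * this
  simp only [h1]
  rw [tsum_mul_left, tsum_geometric_of_norm_lt_one]
  · rw [kzForm, Mu.val_inv]
    have h2 := ξ.val_ne_zero
    have h3 := ofReal_sub_val_ne_zero ξ hs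
    have h4 : 1 - ξ.val⁻¹ * s = -(ξ.val⁻¹ * (s - ξ.val)) := by field_simp; ring
    rw [h4]
    field_simp
  · rw [norm_mul, Mu.norm_val, one_mul, Complex.norm_real, Real.norm_of_nonneg hs.1.le]
    exact hs.2

/-! ### The Drinfeld associator in depth one -/

theorem clog_one_sub_tendsto : Tendsto (fun ε : ℝ => clog (1 - ε)) (𝓝[>] 0) (𝓝 0) := by
  have : ContinuousAt (fun ε : ℝ => ((Real.log (1 - ε) : ℝ) : ℂ)) 0 := by
    refine Complex.continuous_ofReal.continuousAt.comp ?_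
    exact ContinuousAt.log (by fun_prop) (by norm_num)
  simpa [ContinuousAt, clog] using this.tendsto.mono_left nhdsWithin_le_nhds

/-- From `|log (1 - ε)| ≤ 2 ε` and `ε log ε → 0`. The limit removes the regularizing term of the
words `e_0 ^ a e_1` with `a > 0`. -/
theorem clog_mul_clog_one_sub_tendsto :
    Tendsto (fun ε : ℝ => clog (1 - ε) * -clog ε) (𝓝[>] 0) (𝓝 0) := by
  have h1 : Tendsto (fun ε : ℝ => 2 * |Real.log ε * ε|) (𝓝[>] 0) (𝓝 0) := by
    have := tendsto_log_mul_rpow_nhdsGT_zero zero_lt_one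
    simp only [Real.rpow_one] at this
    simpa using this.abs.const_mul 2
  refine squeeze_zero_norm' ?_ h1
  filter_upwards [Ioo_mem_nhdsGT (show (0 : ℝ) < 1 / 2 by norm_num)] with ε hε
  have h2 := Real.one_sub_inv_le_log_of_pos (show 0 < 1 - ε by linarith [hε.2])
  have h3 : |Real.log (1 - ε)| ≤ 2 * ε := by
    have h4 : Real.log (1 - ε) ≤ 0 := Real.log_nonpos (by linarith [hε.2]) (by linarith [hε.1])
    rw [abs_of_nonpos h4]
    have h5 : (1 - ε)⁻¹ - 1 = ε * (1 - ε)⁻¹ := by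
      have : 1 - ε ≠ 0 := by linarith [hε.2]
      field_simp
      ring
    have h6 : (1 - ε)⁻¹ ≤ 2 := by
      rw [inv_le_comm₀ (by linarith [hε.2]) (by norm_num)]; linarith [hε.2]
    nlinarith [hε.1]
  simp only [clog]
  rw [norm_mul, norm_neg, Complex.norm_real, Complex.norm_real, Real.norm_eq_abs, Real.norm_eq_abs,
    abs_mul, abs_of_pos hε.1]
  nlinarith [abs_nonneg (Real.log ε)]

theorem drinfeld_replicate (k : ℕ) :
    drinfeld N (List.replicate k none) = if k = 0 then 1 else 0 := by
  have h : Tendsto (fun ε : ℝ => clog (1 - ε) ^ k / (k.factorial : ℂ)) (𝓝[>] 0)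
      (𝓝 (0 ^ k / (k.factorial : ℂ))) := (clog_one_sub_tendsto.pow k).div_const _
  have h' : drinfeld N (List.replicate k none) = 0 ^ k / (k.factorial : ℂ) := by
    refine Tendsto.limUnder_eq (h.congr' ?_)
    filter_upwards [Ioo_mem_nhdsGT (show (0 : ℝ) < 1 by norm_num)] with ε hε
    exact (regularized_replicate hε.1 hε.2 k).symm
  rw [h']
  split_ifs with hk <;> simp [hk]

/-- The coefficient of `e_0 ^ n e_ξ` in the Drinfeld associator. -/
def kzCoeff (n : ℕ) (ξ : Mu N) : ℂ := by
  classical exact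
    if n = 0 then (if ξ = 1 then 0 else Complex.log (1 - ξ.val⁻¹))
    else (-1) ^ (n + 1) * Li (n + 1) ξ⁻¹

theorem kzCoeff_of_ne_zero {n : ℕ} (hn : n ≠ 0) (ξ : Mu N) :
    kzCoeff n ξ = (-1) ^ (n + 1) * Li (n + 1) ξ⁻¹ := by simp [kzCoeff, hn]

/-- Dominated convergence. Since `log 1 = 0`, the limiting integrand is `(-1)^b / (a! b!)` times
`log ^ (a + b) s / (s - ξ)`, which explains the sign and the binomial coefficient. -/
theorem tendsto_integral_kzIntegrand {a b : ℕ} (hab : a + b ≠ 0) (ξ : Mu N) :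
    Tendsto (fun ε : ℝ => ∫ s in ε..(1 - ε), kzIntegrand (1 - ε) a ξ b s) (𝓝[>] 0)
      (𝓝 ((-1) ^ b * ((a + b).choose a : ℂ) * kzCoeff (a + b) ξ)) := by
  have hlim : (-1) ^ b * ((a + b).choose a : ℂ) * kzCoeff (a + b) ξ =
      ∫ s in Ioo (0 : ℝ) 1, kzIntegrand 1 a ξ b s := by
    have h1 : ∀ s, kzIntegrand 1 a ξ b s = ((-1) ^ b / ((a.factorial : ℂ) * b.factorial)) *
        (clog s ^ (a + b) * kzForm (some ξ) s) := by
      intro s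
      have : clog 1 = 0 := by simp [clog]
      rw [kzIntegrand, this, zero_sub, neg_pow, pow_add]
      ring
    simp only [h1]
    rw [integral_const_mul, integral_clog_pow_mul_kzForm hab, kzCoeff_of_ne_zero hab,
      Nat.cast_add_choose]
    field_simp
  rw [hlim]
  have h2 : ∀ᶠ ε : ℝ in 𝓝[>] 0, ∫ s in Ioo (0 : ℝ) 1, (Ioc ε (1 - ε)).indicator
      (kzIntegrand (1 - ε) a ξ b) s = ∫ s in ε..(1 - ε), kzIntegrand (1 - ε) a ξ b s := by
    filter_upwards [Ioo_mem_nhdsGT (show (0 : ℝ) < 1 / 2 by norm_num)] with ε hε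
    rw [intervalIntegral.integral_of_le (by linarith [hε.2]), setIntegral_indicator measurableSet_Ioc]
    congr 2
    refine inter_eq_right.2 fun s hs => ⟨hε.1.trans hs.1, by linarith [hs.2, hε.1]⟩
  refine Tendsto.congr' h2 ?_
  refine tendsto_integral_filter_of_dominated_convergence
    (fun s => 2 * (-Real.log s) ^ (a + b) + 2 ^ (a + b)) ?_ ?_
    (integrableOn_neg_log_pow_bound (a + b)) ?_
  · refine Eventually.of_forall fun ε => ?_
    refine AEStronglyMeasurable.indicator ?_ measurableSet_Ioc
    refine ContinuousOn.aestronglyMeasurable ?_ measurableSet_Ioo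
    exact ((continuousOn_clog.pow a).div_const _).mul ((continuousOn_kzForm _).mul
      (((continuousOn_const.sub continuousOn_clog).pow b).div_const _))
  · filter_upwards [Ioo_mem_nhdsGT (show (0 : ℝ) < 1 / 2 by norm_num)] with ε hε
    filter_upwards [ae_restrict_mem measurableSet_Ioo] with s hs
    have hl : 0 < -Real.log s := by linarith [Real.log_neg hs.1 hs.2]
    rw [indicator_apply]
    split_ifs with h
    · refine le_trans ?_ (neg_log_pow_div_le hs hab)
      have h3 : Real.log (1 - ε) ≤ 0 := Real.log_nonpos (by linarith [hε.2]) (by linarith [hε.1])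
      have h4 : Real.log s ≤ Real.log (1 - ε) := Real.log_le_log hs.1 h.2
      have h5 : ‖clog s‖ = -Real.log s := by
        rw [clog, Complex.norm_real, Real.norm_eq_abs, abs_of_neg (by linarith)]
      have h6 : ‖clog (1 - ε) - clog s‖ ≤ -Real.log s := by
        rw [clog, clog, ← Complex.ofReal_sub, Complex.norm_real, Real.norm_eq_abs,
          abs_of_nonneg (by linarith)]
        linarith
      have h7 : ∀ (z : ℂ) (k : ℕ), ‖z‖ ≤ -Real.log s →
          ‖z ^ k / (k.factorial : ℂ)‖ ≤ (-Real.log s) ^ k := by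
        intro z k hz
        rw [norm_div, norm_pow, Complex.norm_natCast]
        refine (div_le_self (by positivity) ?_).trans (pow_le_pow_left₀ (norm_nonneg z) hz k)
        exact_mod_cast k.factorial_pos
      rw [kzIntegrand, norm_mul, norm_mul]
      calc _ ≤ (-Real.log s) ^ a * (1 / (1 - s) * (-Real.log s) ^ b) := by
            have h8 : 0 < 1 - s := by linarith [hs.2]
            gcongr
            · exact h7 _ _ h5.le
            · exact norm_kzForm_le ξ hs
            · exact h7 _ _ h6
        _ = _ := by rw [pow_add]; ring
    · rw [norm_zero]; positivity
  · filter_upwards [ae_restrict_mem measurableSet_Ioo] with s hs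
    have h3 : Tendsto (fun ε : ℝ => kzIntegrand (1 - ε) a ξ b s) (𝓝[>] 0)
        (𝓝 (kzIntegrand 1 a ξ b s)) := by
      have h0 : clog 1 = 0 := by simp [clog]
      have := ((((clog_one_sub_tendsto.sub_const (clog s)).pow b).div_const
        (b.factorial : ℂ)).const_mul (kzForm (some ξ) s)).const_mul
        (clog s ^ a / (a.factorial : ℂ))
      simpa [kzIntegrand, h0] using this
    refine h3.congr' ?_
    have hm : 0 < min s (1 - s) := lt_min hs.1 (by linarith [hs.2])
    filter_upwards [Ioo_mem_nhdsGT hm] with ε hε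
    have h4 := lt_min_iff.1 hε.2
    rw [indicator_of_mem (show s ∈ Ioc ε (1 - ε) from ⟨h4.1, by linarith [h4.2]⟩)]

theorem re_val_inv_lt {ξ : Mu N} (hξ : ξ ≠ 1) : (ξ.val⁻¹).re < 1 := by
  have h1 : ‖ξ.val⁻¹‖ = 1 := by rw [norm_inv, ξ.norm_val, inv_one]
  refine lt_of_le_of_ne ((Complex.re_le_norm _).trans h1.le) fun h => hξ ?_
  rw [← Mu.val_eq_one, ← inv_eq_one]
  have h2 : (ξ.val⁻¹).im = 0 := by
    have h3 := Complex.sq_norm ξ.val⁻¹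
    rw [h1, Complex.normSq_apply, h] at h3
    nlinarith [mul_self_nonneg (ξ.val⁻¹).im]
  exact Complex.ext (by simpa using h) (by simpa using h2)

/-- The primitive is the principal branch of `log (1 - s ξ⁻¹)`; on `[0, 1]` the real part of its
argument stays positive because `Re ξ⁻¹ < 1`. -/
theorem tendsto_integral_kzForm {ξ : Mu N} (hξ : ξ ≠ 1) :
    Tendsto (fun ε : ℝ => ∫ s in ε..(1 - ε), kzForm (some ξ) s) (𝓝[>] 0)
      (𝓝 (Complex.log (1 - ξ.val⁻¹))) := by
  have hre := re_val_inv_lt hξ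
  have hslit : ∀ s : ℝ, 0 ≤ s → s ≤ 1 → 1 - (s : ℂ) * ξ.val⁻¹ ∈ Complex.slitPlane := by
    intro s h0 h1
    left
    rw [Complex.sub_re, Complex.one_re, Complex.re_ofReal_mul]
    rcases h0.eq_or_lt with rfl | h0
    · simp
    · nlinarith
  have hlin : ∀ s : ℝ, HasDerivAt (fun s : ℝ => 1 - (s : ℂ) * ξ.val⁻¹) (-ξ.val⁻¹) s := by
    intro s
    simpa using ((Complex.ofRealCLM.hasDerivAt (x := s)).mul_const ξ.val⁻¹).const_sub 1
  have hd : ∀ s ∈ Ioo (0 : ℝ) 1,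
      HasDerivAt (fun s : ℝ => Complex.log (1 - (s : ℂ) * ξ.val⁻¹)) (kzForm (some ξ) s) s := by
    intro s hs
    refine ((hlin s).clog_real (hslit s hs.1.le hs.2.le)).congr_deriv ?_
    have h2 := ξ.val_ne_zero
    have h3 := ofReal_sub_val_ne_zero ξ hs
    have h4 : 1 - (s : ℂ) * ξ.val⁻¹ = -(ξ.val⁻¹ * (s - ξ.val)) := by field_simp; ring
    rw [kzForm, h4]
    field_simp
  have hc : ∀ s : ℝ, 0 ≤ s → s ≤ 1 →
      ContinuousAt (fun s : ℝ => Complex.log (1 - (s : ℂ) * ξ.val⁻¹)) s := fun s h0 h1 =>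
    (hlin s).continuousAt.clog (hslit s h0 h1)
  have h1 : Tendsto (fun ε : ℝ => Complex.log (1 - ((1 - ε : ℝ) : ℂ) * ξ.val⁻¹)) (𝓝[>] 0)
      (𝓝 (Complex.log (1 - ξ.val⁻¹))) := by
    have h2 : Tendsto (fun ε : ℝ => 1 - ε) (𝓝[>] 0) (𝓝 1) := by
      have : ContinuousAt (fun ε : ℝ => 1 - ε) 0 := by fun_prop
      simpa [ContinuousAt] using this.tendsto.mono_left nhdsWithin_le_nhds
    have h4 := (hc 1 zero_le_one le_rfl).tendsto.comp h2
    rwa [Complex.ofReal_one, one_mul] at h4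
  have h2 : Tendsto (fun ε : ℝ => Complex.log (1 - (ε : ℂ) * ξ.val⁻¹)) (𝓝[>] 0) (𝓝 0) := by
    simpa using (hc 0 le_rfl zero_le_one).tendsto.mono_left nhdsWithin_le_nhds
  have h3 := h1.sub h2
  rw [sub_zero] at h3
  refine h3.congr' ?_
  filter_upwards [Ioo_mem_nhdsGT (show (0 : ℝ) < 1 by norm_num)] with ε hε
  exact (integral_eq_sub_of_hasDerivAt_Ioo (continuousOn_kzForm _) hd hε
    ⟨by linarith [hε.2], by linarith [hε.1]⟩).symm

theorem integral_kzForm_one {ε : ℝ} (h0 : 0 < ε) (h1 : ε < 1) :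
    ∫ s in ε..(1 - ε), kzForm (some (1 : Mu N)) s = clog ε - clog (1 - ε) := by
  have h := integral_eq_sub_of_hasDerivAt_Ioo (F := fun s => clog (1 - s))
    (continuousOn_kzForm (some (1 : Mu N))) (fun s hs => ?_) ⟨h0, h1⟩
    (b := 1 - ε) ⟨by linarith, by linarith⟩
  · rw [h, sub_sub_cancel]
  · have hs' : 1 - s ∈ Ioo (0 : ℝ) 1 := ⟨by linarith [hs.2], by linarith [hs.1]⟩
    refine (HasDerivAt.scomp s (hasDerivAt_clog hs') ((hasDerivAt_id s).const_sub 1)).congr_deriv ?_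
    have h2 := ofReal_sub_val_ne_zero (1 : Mu N) hs
    have h3 : (1 : Mu N).val = 1 := Mu.val_eq_one.2 rfl
    rw [h3] at h2
    have h4 : (1 : ℂ) - s ≠ 0 := fun h => h2 (by linear_combination -h)
    rw [kzForm, h3]
    push_cast
    rw [neg_one_smul]
    field_simp
    ring

/-- Only the single letter `e_1` is truly regularized: its integral is `log ε - log (1 - ε)`, and
the tangential factor supplies the missing `-log ε`. In all other cases the integral converges and
the correction is zero or tends to zero. -/
theorem drinfeld_depthOne (a b : ℕ) (ξ : Mu N) : drinfeld N (depthOne a ξ b) =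
    (-1) ^ b * ((a + b).choose a : ℂ) * kzCoeff (a + b) ξ := by
  classical
  refine Tendsto.limUnder_eq ?_
  suffices h : Tendsto (fun ε : ℝ => (∫ s in ε..(1 - ε), kzIntegrand (1 - ε) a ξ b s) +
      clog (1 - ε) ^ a / (a.factorial : ℂ) * (if ξ = 1 ∧ b = 0 then -clog ε else 0)) (𝓝[>] 0)
      (𝓝 ((-1) ^ b * ((a + b).choose a : ℂ) * kzCoeff (a + b) ξ)) by
    refine h.congr' ?_
    filter_upwards [Ioo_mem_nhdsGT (show (0 : ℝ) < 1 by norm_num)] with ε hε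
    rw [regularized_depthOne hε.1 hε.2]
  by_cases hab : a + b = 0
  · obtain ⟨rfl, rfl⟩ : a = 0 ∧ b = 0 := by omega
    by_cases hξ : ξ = 1
    · subst hξ
      simp only [kzIntegrand]
      have := clog_one_sub_tendsto.neg
      rw [neg_zero] at this
      simp only [kzCoeff, if_true, mul_zero]
      refine this.congr' ?_
      filter_upwards [Ioo_mem_nhdsGT (show (0 : ℝ) < 1 by norm_num)] with ε hε
      simp [integral_kzForm_one hε.1 hε.2]
      ring
    · simpa [kzIntegrand, kzCoeff, hξ] using tendsto_integral_kzForm hξ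
  · have h1 := tendsto_integral_kzIntegrand hab ξ
    rw [← add_zero ((-1) ^ b * ((a + b).choose a : ℂ) * kzCoeff (a + b) ξ)]
    refine h1.add ?_
    split_ifs with h
    · obtain ⟨n, rfl⟩ : ∃ n, a = n + 1 := ⟨a - 1, by omega⟩
      have h2 := ((clog_one_sub_tendsto.pow n).div_const ((n + 1).factorial : ℂ)).mul
        clog_mul_clog_one_sub_tendsto
      rw [mul_zero] at h2
      refine h2.congr fun ε => ?_
      rw [pow_succ]
      ring
    · simp

/-! ### Rationality of the even or odd part of the polylogarithm -/

theorem Mu.exists_val_eq (ξ : Mu N) : ∃ q : ℚ, 0 ≤ q ∧ q ≤ 1 ∧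
    ξ.val = Complex.exp (2 * Real.pi * Complex.I * q) := by
  obtain ⟨i, hi, h⟩ := (Complex.mem_rootsOfUnity N ξ).1 ξ.2
  have hN : (0 : ℚ) < N := by exact_mod_cast Nat.pos_of_ne_zero (NeZero.ne N)
  refine ⟨i / N, by positivity, (div_le_one hN).2 (by exact_mod_cast hi.le), ?_⟩
  rw [Mu.val, ← h]
  push_cast
  rfl

theorem eval_bernoulli_rat (k : ℕ) (q : ℚ) :
    ∃ r : ℚ, bernoulliFun k (q : ℝ) = r := by
  refine ⟨(Polynomial.bernoulli k).eval q, ?_⟩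
  rw [bernoulliFun, Polynomial.eval_map]
  exact (Polynomial.hom_eval₂ _ (RingHom.id ℚ) (algebraMap ℚ ℝ) q).symm.trans (by simp)

/-- For `ξ = exp (2πi x)` this is the Fourier expansion of the Bernoulli polynomial of degree `n +
1` at `x`. As `x` is rational, so is the value of the polynomial. -/
theorem Li_add_Li_inv (n : ℕ) (hn : n ≠ 0) (ξ : Mu N) : ∃ q : ℚ,
    Li (n + 1) ξ + (-1) ^ (n + 1) * Li (n + 1) ξ⁻¹ = q * (2 * Real.pi * Complex.I) ^ (n + 1) := by
  obtain ⟨x, hx0, hx1, hx⟩ := ξ.exists_val_eq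
  obtain ⟨r, hr⟩ := eval_bernoulli_rat (n + 1) x
  have h := hasSum_one_div_nat_pow_mul_fourier (k := n + 1) (by omega) (x := (x : ℝ))
    ⟨by exact_mod_cast hx0, by exact_mod_cast hx1⟩
  have h1 := (hasSum_nat_add_iff' 1).2 h
  have hf : ∀ k : ℕ, fourier (k : ℤ) ((x : ℝ) : UnitAddCircle) = ξ.val ^ k := by
    intro k
    rw [fourier_coe_apply, hx, ← Complex.exp_nat_mul]
    congr 1
    push_cast
    ring
  have hf' : ∀ k : ℕ, fourier (-(k : ℤ)) ((x : ℝ) : UnitAddCircle) = (ξ⁻¹).val ^ k := by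
    intro k
    rw [Mu.val_inv, fourier_coe_apply, hx, ← Complex.exp_neg, ← Complex.exp_nat_mul]
    congr 1
    push_cast
    ring
  refine ⟨-r / (n + 1).factorial, ?_⟩
  rw [Li, Li]
  -- The Fourier sum starts at `0`, where the term `1 / 0 ^ (n + 1)` is `0` by convention.
  rw [Finset.sum_range_one, Nat.cast_zero, zero_pow (Nat.succ_ne_zero n), div_zero, zero_mul,
    sub_zero] at h1
  rw [← tsum_mul_left, ← Summable.tsum_add (summable_Li n hn ξ) ((summable_Li n hn ξ⁻¹).mul_left _)]
  rw [show (fun k : ℕ => ξ.val ^ (k + 1) / ((k : ℂ) + 1) ^ (n + 1) +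
      (-1) ^ (n + 1) * ((ξ⁻¹).val ^ (k + 1) / ((k : ℂ) + 1) ^ (n + 1))) = _ from
    funext fun k => ?_, h1.tsum_eq, hr]
  · push_cast
    ring
  · rw [hf, hf']
    push_cast
    ring

/-- For `n > 0` this is the inversion relation. For `n = 0` and `ξ ≠ 1` the difference of logarithms
exponentiates to `-ξ`, a root of unity of order dividing `2N`. The left side is the coefficient of
`Y^n · t_ξ` in the difference of the depth one parts of `Φ_{∞1}` and `Φ_{01}`. -/
theorem kzCoeff_rational (n : ℕ) (ξ : Mu N) : ∃ q : ℚ,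
    (-1) ^ n * kzCoeff n ξ⁻¹ - kzCoeff n ξ = q * (2 * Real.pi * Complex.I) ^ (n + 1) := by
  rcases Nat.eq_zero_or_pos n with rfl | hn
  · by_cases hξ : ξ = 1
    · exact ⟨0, by simp [kzCoeff, hξ]⟩
    · have hξ' : ξ⁻¹ ≠ 1 := by simpa using hξ
      simp only [kzCoeff, if_true, if_neg hξ, if_neg hξ', Mu.val_inv, inv_inv, pow_zero, one_mul]
      set z := Complex.log (1 - ξ.val) - Complex.log (1 - ξ.val⁻¹) with hz
      have h0 : ξ.val ≠ 1 := fun h => hξ (Mu.val_eq_one.1 h)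
      have h1 : Complex.exp z = -ξ.val := by
        have h2 : 1 - ξ.val ≠ 0 := sub_ne_zero.2 h0.symm
        have h3 : 1 - ξ.val⁻¹ ≠ 0 := sub_ne_zero.2 fun h => h0 (inv_eq_one.1 h.symm)
        rw [hz, Complex.exp_sub, Complex.exp_log h2, Complex.exp_log h3, div_eq_iff h3]
        have := ξ.val_ne_zero
        field_simp
        ring
      have h2 : Complex.exp ((2 * N : ℕ) * z) = 1 := by
        rw [Complex.exp_nat_mul, h1, pow_mul, neg_sq, ← pow_mul, mul_comm, pow_mul, ξ.val_pow, one_pow]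
      obtain ⟨j, hj⟩ := Complex.exp_eq_one_iff.1 h2
      have hN : ((2 * N : ℕ) : ℂ) ≠ 0 := by
        exact_mod_cast Nat.mul_ne_zero two_ne_zero (NeZero.ne N)
      refine ⟨j / (2 * N : ℕ), ?_⟩
      rw [← mul_right_inj' hN, hj]
      push_cast at hN ⊢
      rw [pow_one, ← mul_assoc (2 * (N : ℂ)), mul_div_cancel₀ _ hN]
  · obtain ⟨q, hq⟩ := Li_add_Li_inv n hn.ne' ξ
    refine ⟨-q, ?_⟩
    rw [kzCoeff_of_ne_zero hn.ne', kzCoeff_of_ne_zero hn.ne', inv_inv]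
    have : ((-1 : ℂ) ^ n) * (-1) ^ n = 1 := by rw [← mul_pow]; simp
    push_cast
    rw [pow_succ (-1 : ℂ)] at hq ⊢
    linear_combination -hq - Li (n + 1) ξ * this

end EllPolylog

end

noncomputable section

namespace EllPolylog

open NCSeries

namespace NCSeries

variable {σ : Type}

/-! ### Small sums and congruences modulo closed subspaces and ideals. -/

theorem sub_one_mem {K : Submodule ℂ (NCSeries σ)} {f g : NCSeries σ} (hf : f - (1 + g) ∈ K)
    (hg : g ∈ K) : f - 1 ∈ K := by
  have := K.add_mem hf hg
  rwa [← sub_sub, sub_add_cancel] at this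

theorem ratCast_smul (q : ℚ) (f : NCSeries σ) : (q : ℂ) • f = q • f := by
  ext w; simp [Rat.smul_def]

theorem ssum_sub_single {f : ℕ → NCSeries σ} (hf : ∀ k, OrdGE k (f k)) (m : ℕ) :
    ssum f - f m = ssum fun k => if k = m then 0 else f k := by
  ext w
  have h : ∀ k, OrdGE k (if k = m then 0 else f k) := by
    intro k w hw
    split_ifs
    · rfl
    · exact hf k w hw
  rw [sub_apply, ssum_apply_of_le hf (n := w.length + m + 1) (by omega),
    ssum_apply_of_le h (n := w.length + m + 1) (by omega), sub_eq_iff_eq_add,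
    ← Finset.sum_erase_add _ _ (Finset.mem_range.2 (show m < w.length + m + 1 by omega)),
    ← Finset.sum_erase_add _ _ (Finset.mem_range.2 (show m < w.length + m + 1 by omega)), if_pos rfl,
    zero_apply, add_zero]
  congr 1
  refine Finset.sum_congr rfl fun k hk => ?_
  rw [if_neg (Finset.ne_of_mem_erase hk)]

/-- In a sum over a small family, all terms but one lie in a closed subspace. -/
theorem IsClosedSub.ssum_sub_single_mem {ι : Type} [Fintype ι] {K : Submodule ℂ (NCSeries σ)}
    (hK : IsClosedSub K) {G : ℕ → ι → NCSeries σ} (hG : ∀ k i, OrdGE k (G k i)) (d : ℕ → ι → ℂ)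
    {m : ℕ} {j : ι} (h : ∀ k i, (k, i) ≠ (m, j) → G k i ∈ K) :
    (ssum fun k => ∑ i, d k i • G k i) - d m j • G m j ∈ K := by
  classical
  have ho : ∀ k, OrdGE k (∑ i, d k i • G k i) := fun k => OrdGE.sum _ fun i _ => (hG k i).smul _
  have h1 : (ssum fun k => ∑ i, d k i • G k i) - ∑ i, d m i • G m i ∈ K := by
    rw [ssum_sub_single ho m]
    refine hK.ssum_mem (fun k w hw => ?_) fun k => ?_
    · split_ifs
      · rfl
      · exact ho k w hw
    · split_ifs with hk
      · exact K.zero_mem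
      · exact K.sum_mem fun i _ => K.smul_mem _ (h k i (by simp [hk]))
  have h2 : ∑ i, d m i • G m i - d m j • G m j ∈ K := by
    rw [← Finset.sum_erase_add _ _ (Finset.mem_univ j), add_sub_cancel_right]
    exact K.sum_mem fun i hi => K.smul_mem _ (h m i (by simp [Finset.ne_of_mem_erase hi]))
  have := K.add_mem h1 h2
  rwa [sub_add_sub_cancel] at this

theorem conj_nil {f g h : NCSeries σ} (hf : f [] = 0) : (h * f * g) [] = 0 := by simp [hf]

/-- A closed two-sided ideal. -/
structure IsClosedIdeal (K : Submodule ℂ (NCSeries σ)) : Prop where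
  closed : IsClosedSub K
  mul_left : ∀ (a : NCSeries σ) {x : NCSeries σ}, x ∈ K → a * x ∈ K
  mul_right : ∀ (a : NCSeries σ) {x : NCSeries σ}, x ∈ K → x * a ∈ K

namespace IsClosedIdeal

variable {K : Submodule ℂ (NCSeries σ)}

theorem mul_cong (hK : IsClosedIdeal K) {f f' g g' : NCSeries σ} (hf : f - f' ∈ K)
    (hg : g - g' ∈ K) : f * g - f' * g' ∈ K := by
  have : f * g - f' * g' = (f - f') * g + f' * (g - g') := by noncomm_ring
  rw [this]
  exact K.add_mem (hK.mul_right _ hf) (hK.mul_left _ hg)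

theorem pow_cong (hK : IsClosedIdeal K) {f f' : NCSeries σ} (hf : f - f' ∈ K) (k : ℕ) :
    f ^ k - f' ^ k ∈ K := by
  induction k with
  | zero => simp
  | succ k ih => rw [pow_succ, pow_succ]; exact hK.mul_cong ih hf

theorem psEval_cong (hK : IsClosedIdeal K) {f f' : NCSeries σ} (h0 : f [] = 0) (h0' : f' [] = 0)
    (hf : f - f' ∈ K) (c : ℕ → ℂ) : psEval c f - psEval c f' ∈ K := by
  rw [psEval_eq_ssum, psEval_eq_ssum]
  refine hK.closed.ssum_sub_mem (ordGE_smul_pow h0 c) (ordGE_smul_pow h0' c) fun k => ?_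
  rw [← smul_sub]
  exact K.smul_mem _ (hK.pow_cong hf k)

theorem inv_cong (hK : IsClosedIdeal K) {f g g' : NCSeries σ} (h1 : f [] = 1)
    (hf : f - g ∈ K) (hg : g * g' - 1 ∈ K) : inv f - g' ∈ K := by
  have : inv f - g' = (inv f * f - 1) * g' - inv f * ((f - g) * g') - inv f * (g * g' - 1) := by
    noncomm_ring
  rw [this, inv_mul h1, sub_self, zero_mul, zero_sub]
  exact K.sub_mem (K.neg_mem (hK.mul_left _ (hK.mul_right _ hf))) (hK.mul_left _ hg)

end IsClosedIdeal

end NCSeries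

variable {N : ℕ} [NeZero N]

theorem isClosedIdeal_D1A : IsClosedIdeal (D1A N) :=
  ⟨isClosedSub_D1A N, D1A_mul_left, D1A_mul_right⟩

theorem isClosedIdeal_D2A : IsClosedIdeal (D2A N) :=
  ⟨isClosedSub_D2A N, D2A_mul_left, D2A_mul_right⟩

/-- The period `2πi`. -/
def tpi : ℂ := 2 * Real.pi * Complex.I

/-! ### The rational structure of `A` -/

theorem isClosedSub_ratA : IsClosedSub (ratA N) := isClosedSub_closure _

theorem thetaAlpha_mem : thetaAlpha N ∈ ratA N :=
  le_closure _ (Algebra.subset_adjoin (by simp))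

theorem thetaBeta_mem : thetaBeta N ∈ ratA N :=
  le_closure _ (Algebra.subset_adjoin (by simp))

theorem thetaGamma_mem (η : Mu N) : thetaGamma η ∈ ratA N :=
  le_closure _ (Algebra.subset_adjoin (by simp))

theorem one_mem_ratA : (1 : A N) ∈ ratA N := le_closure _ (one_mem (Algebra.adjoin ℚ _))

theorem mul_mem_ratA {f g : A N} (hf : f ∈ ratA N) (hg : g ∈ ratA N) : f * g ∈ ratA N := by
  intro n
  obtain ⟨f', hf', h1⟩ := hf n
  obtain ⟨g', hg', h2⟩ := hg n
  exact ⟨f' * g', mul_mem (S := Subalgebra ℚ (A N)) hf' hg', h1.mul h2⟩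

theorem pow_mem_ratA {f : A N} (hf : f ∈ ratA N) (k : ℕ) : f ^ k ∈ ratA N := by
  induction k with
  | zero => exact one_mem_ratA
  | succ k ih => rw [pow_succ]; exact mul_mem_ratA ih hf

theorem lie_mem_ratA {f g : A N} (hf : f ∈ ratA N) (hg : g ∈ ratA N) : ⁅f, g⁆ ∈ ratA N := by
  rw [lie_eq]; exact sub_mem (mul_mem_ratA hf hg) (mul_mem_ratA hg hf)

theorem adIter_mem_ratA {f g : A N} (hf : f ∈ ratA N) (hg : g ∈ ratA N) (k : ℕ) :
    adIter f k g ∈ ratA N := by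
  induction k with
  | zero => exact hg
  | succ k ih => rw [adIter_succ]; exact lie_mem_ratA hf ih

theorem ratCast_smul_mem {f : A N} (q : ℚ) (hf : f ∈ ratA N) : (q : ℂ) • f ∈ ratA N := by
  rw [ratCast_smul]; exact (ratA N).smul_mem q hf

theorem psEval_mem_ratA {f : A N} (h0 : f [] = 0) (hf : f ∈ ratA N) (c : ℕ → ℚ) :
    psEval (fun k => (c k : ℂ)) f ∈ ratA N := by
  rw [psEval_eq_ssum]
  exact isClosedSub_ratA.ssum_mem (ordGE_smul_pow h0 _) fun k =>
    ratCast_smul_mem _ (pow_mem_ratA hf k)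

theorem exp_mem_ratA {f : A N} (h0 : f [] = 0) (hf : f ∈ ratA N) : NCSeries.exp f ∈ ratA N := by
  have := psEval_mem_ratA h0 hf fun k => 1 / (k.factorial : ℚ)
  simpa [NCSeries.exp] using this

/-- The logarithm series has rational coefficients and `ratA` is a closed algebra over `ℚ`. -/
theorem mem_ratA_of_exp {f : A N} (h0 : f [] = 0) (hf : NCSeries.exp f ∈ ratA N) : f ∈ ratA N := by
  rw [← log_exp h0]
  exact psEval_mem_ratA (by simp [exp_nil, one_apply]) (sub_mem hf one_mem_ratA) _

/-! ### The associators in depth one -/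

theorem adEval_sub_mem_D1A (c : ℕ → ℂ) : adEval c (aX N) (aY N) - c 0 • aY N ∈ D1A N := by
  have ho : ∀ k, OrdGE k (c k • adIter (aX N) k (aY N)) := fun k =>
    ((adIter_ord aX_nil (OrdGE.zero _) k).smul _).mono (by omega)
  rw [adEval_eq_ssum, ssum_succ ho, adIter_zero, add_sub_cancel_left]
  refine (isClosedSub_D1A N).ssum_mem (fun k => (ho _).mono (by omega)) fun k => ?_
  rw [adIter_succ]
  exact Submodule.smul_mem _ _ (lie_mem_D1A _ _)

theorem adEval_nil (c : ℕ → ℂ) : adEval c (aX N) (aY N) [] = 0 := by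
  have h := (D1A_coeff (adEval_sub_mem_D1A (N := N) c)).1
  simpa [aY_nil] using h

theorem e0_nil : (e0 N) [] = 0 := adEval_nil _

theorem eInf_nil : (eInf N) [] = 0 := adEval_nil _

theorem e0_sub_mem_D1A : e0 N - aY N ∈ D1A N := by
  have := adEval_sub_mem_D1A (N := N) fun k => (bernoulli k : ℂ) / (k.factorial : ℂ)
  simpa [e0] using this

theorem eInf_sub_mem_D1A : eInf N - (-1 : ℂ) • aY N ∈ D1A N := by
  have := adEval_sub_mem_D1A (N := N) fun k => -((-1) ^ k * (bernoulli k : ℂ) / (k.factorial : ℂ))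
  simpa [eInf] using this

theorem drinfeld_nil : drinfeld N [] = 1 := by
  simpa using drinfeld_replicate (N := N) 0

theorem Phi0_nil (η : Mu N) : (Phi0 η) [] = 1 := by rw [Phi0, subst_nil, drinfeld_nil]

theorem PhiInf_nil : (PhiInf N) [] = 1 := by rw [PhiInf, subst_nil, drinfeld_nil]

theorem subst_drinfeld_sub_mem {u : Option (Mu N) → A N} (hu : ∀ i, u (some i) ∈ D1A N)
    (h0 : u none [] = 0) {s : ℂ} (hs : u none - s • aY N ∈ D1A N) :
    subst u (drinfeld N) - (1 + ssum fun k => ∑ i, (s ^ k * kzCoeff k i) •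
      adIter (aY N) k (u (some i))) ∈ D2A N := by
  refine subst_sub_mem_D2A hu h0 hs drinfeld_nil (fun k => ?_) kzCoeff fun k i j hj => ?_
  · rw [drinfeld_replicate, if_neg (Nat.succ_ne_zero k)]
  · have := drinfeld_depthOne j (k - j) i
    rw [Nat.add_sub_cancel' hj] at this
    exact this

/-- A series `∑ d_{k,η} ad_Y ^ k (t_η)`. -/
def ySeries (d : ℕ → Mu N → ℂ) : A N := ssum fun k => ∑ η, d k η • adIter (aY N) k (aT η)

theorem ySeries_ord (d : ℕ → Mu N → ℂ) (k : ℕ) :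
    OrdGE k (∑ η, d k η • adIter (aY N) k (aT η)) :=
  OrdGE.sum _ fun _ _ => ((adIter_ord aY_nil (OrdGE.zero _) k).smul _).mono (by omega)

theorem ySeries_mem_D1A (d : ℕ → Mu N → ℂ) : ySeries d ∈ D1A N :=
  (isClosedSub_D1A N).ssum_mem (ySeries_ord d) fun k =>
    sum_mem fun _ _ => Submodule.smul_mem _ _ (adIter_mem_D1A _ (aT_mem_D1A _) k)

/-- The depth one part of `Φ_{∞1}`. -/
def phiInf (N : ℕ) [NeZero N] : A N := ySeries fun k η => (-1) ^ k * kzCoeff k η⁻¹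

/-- The sign `(-1)^k` in `phiInf` arises from `E_∞ ≡ -Y` modulo `D1A`, and the inverse from `e_ζ ↦
t_{ζ⁻¹}`. -/
theorem PhiInf_sub_mem : PhiInf N - (1 + phiInf N) ∈ D2A N := by
  have h := subst_drinfeld_sub_mem (N := N) (u := fun l => l.elim (eInf N) fun ζ => aT ζ⁻¹)
    (fun i => aT_mem_D1A _) eInf_nil eInf_sub_mem_D1A
  rw [PhiInf, phiInf, ySeries]
  convert h using 5 with k
  exact Fintype.sum_equiv (Equiv.inv _) _ _ fun η => by simp

theorem Phi0_one_sub_mem : Phi0 (1 : Mu N) - (1 + ySeries kzCoeff) ∈ D2A N := by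
  have h := subst_drinfeld_sub_mem (N := N) (u := fun l => l.elim (e0 N) fun ζ => aT (ζ * 1))
    (fun i => aT_mem_D1A _) e0_nil (s := 1) (by simpa using e0_sub_mem_D1A)
  simpa [ySeries, Phi0] using h

theorem Phi0_sub_one_mem (η : Mu N) : Phi0 η - 1 ∈ D1A N := by
  have h := subst_drinfeld_sub_mem (N := N) (u := fun l => l.elim (e0 N) fun ζ => aT (ζ * η))
    (fun i => aT_mem_D1A _) e0_nil (s := 1) (by simpa using e0_sub_mem_D1A)
  have h2 : (ssum fun k => ∑ ξ : Mu N, ((1 : ℂ) ^ k * kzCoeff k ξ) • adIter (aY N) k (aT (ξ * η)))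
      ∈ D1A N := by
    refine (isClosedSub_D1A N).ssum_mem (fun k => ?_) fun k =>
      sum_mem fun _ _ => Submodule.smul_mem _ _ (adIter_mem_D1A _ (aT_mem_D1A _) k)
    exact OrdGE.sum _ fun _ _ => ((adIter_ord aY_nil (OrdGE.zero _) k).smul _).mono (by omega)
  exact sub_one_mem (D2A_le_D1A h) h2

theorem PhiInf_sub_one_mem : PhiInf N - 1 ∈ D1A N := by
  exact sub_one_mem (D2A_le_D1A PhiInf_sub_mem) (ySeries_mem_D1A _)

theorem inv_sub_mem_D2A {f φ : A N} (h1 : f [] = 1) (hφ : φ ∈ D1A N) (hf : f - (1 + φ) ∈ D2A N) :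
    NCSeries.inv f - (1 - φ) ∈ D2A N := by
  refine isClosedIdeal_D2A.inv_cong h1 hf ?_
  have : (1 + φ) * (1 - φ) - 1 = -(φ * φ) := by noncomm_ring
  rw [this]
  exact neg_mem (mul_mem_D2A hφ hφ)

theorem inv_sub_one_mem_D1A {f : A N} (h1 : f [] = 1) (hf : f - 1 ∈ D1A N) :
    NCSeries.inv f - 1 ∈ D1A N :=
  isClosedIdeal_D1A.inv_cong h1 hf (by simp)

/-- The inverse of `f` is `1 - φ` in depth one, and the error `φ * z * φ` has depth two. -/
theorem conj_sub_mem_D2A {f φ : A N} (h1 : f [] = 1) (hφ : φ ∈ D1A N) (hf : f - (1 + φ) ∈ D2A N)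
    (z : A N) : NCSeries.inv f * z * f - (z + ⁅z, φ⁆) ∈ D2A N := by
  have h := isClosedIdeal_D2A.mul_cong (isClosedIdeal_D2A.mul_cong (inv_sub_mem_D2A h1 hφ hf)
    (show z - z ∈ D2A N by simp)) hf
  have h2 : (1 - φ) * z * (1 + φ) - (z + ⁅z, φ⁆) = -(φ * z * φ) := by
    rw [lie_eq]; noncomm_ring
  have := add_mem h (neg_mem (mul_mem_D2A (D1A_mul_right z hφ) hφ))
  rw [← h2] at this
  rwa [sub_add_sub_cancel] at this

theorem exp_sub_mem_D2A {f : A N} (hf : f ∈ D1A N) : NCSeries.exp f - (1 + f) ∈ D2A N := by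
  have h0 := (D1A_coeff hf).1
  have ho := ordGE_smul_pow h0 fun k => (1 : ℂ) / (k.factorial : ℂ)
  rw [NCSeries.exp, psEval_eq_ssum, ssum_succ ho, ssum_succ fun k => (ho (k + 1)).mono (by omega)]
  simp only [pow_zero, Nat.factorial_zero, Nat.cast_one, div_one, one_smul, zero_add, pow_one,
    Nat.factorial_one, ← add_assoc, add_sub_cancel_left]
  refine (isClosedSub_D2A N).ssum_mem (fun k => (ho (k + 1 + 1)).mono (by omega)) fun k => ?_
  rw [pow_succ, pow_succ]
  refine Submodule.smul_mem _ _ ?_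
  rw [mul_assoc]
  exact D2A_mul_left _ (mul_mem_D2A hf hf)

theorem exp_sub_one_mem_D1A {f : A N} (hf : f ∈ D1A N) : NCSeries.exp f - 1 ∈ D1A N := by
  exact sub_one_mem (D2A_le_D1A (exp_sub_mem_D2A hf)) hf

theorem halfTurn_nil : (halfTurn N) [] = 1 := exp_nil _

theorem halfTurn_sub_mem :
    halfTurn N - (1 + (-(Real.pi * Complex.I : ℂ)) • aT (1 : Mu N)) ∈ D2A N :=
  exp_sub_mem_D2A (Submodule.smul_mem _ _ (aT_mem_D1A _))

theorem halfTurn_sub_one_mem : halfTurn N - 1 ∈ D1A N :=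
  exp_sub_one_mem_D1A (Submodule.smul_mem _ _ (aT_mem_D1A _))

/-! ### Logarithms of the generators -/

/-- The logarithm of `Θ(α)`. -/
def logAlpha (N : ℕ) [NeZero N] : A N := NCSeries.inv (PhiInf N) * (-tpi • eInf N) * PhiInf N

theorem logAlpha_nil : (logAlpha N) [] = 0 := conj_nil (by simp [eInf_nil])

theorem exp_logAlpha : NCSeries.exp (logAlpha N) = thetaAlpha N :=
  psEval_conj (by simp [eInf_nil]) (mul_inv PhiInf_nil) (inv_mul PhiInf_nil) _

theorem logAlpha_mem : logAlpha N ∈ ratA N :=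
  mem_ratA_of_exp logAlpha_nil (by rw [exp_logAlpha]; exact thetaAlpha_mem)

/-- Inside the bracket with `phiInf` only `-2πi E_∞ ≡ 2πi Y` modulo `D1A` matters; outside it, `E_∞`
has to be kept exactly. -/
theorem logAlpha_sub_mem_D2A :
    logAlpha N - (-tpi • eInf N + tpi • ⁅aY N, phiInf N⁆) ∈ D2A N := by
  have h1 := conj_sub_mem_D2A PhiInf_nil (ySeries_mem_D1A _) PhiInf_sub_mem (-tpi • eInf N)
  have h2 : ⁅-tpi • eInf N, phiInf N⁆ - ⁅tpi • aY N, phiInf N⁆ ∈ D2A N := by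
    refine lie_cong ?_ (ySeries_mem_D1A _) (by simp)
    have := Submodule.smul_mem _ (-tpi) (eInf_sub_mem_D1A (N := N))
    rwa [smul_sub, smul_smul, mul_neg_one, neg_neg] at this
  have := add_mem h1 h2
  rw [smul_lie tpi] at this
  convert this using 1
  rw [logAlpha, phiInf]
  abel

theorem logAlpha_sub_mem_D1A : logAlpha N - tpi • aY N ∈ D1A N := by
  have h1 := D2A_le_D1A (logAlpha_sub_mem_D2A (N := N))
  have h2 := Submodule.smul_mem _ tpi (D1A_lie (aY N) (ySeries_mem_D1A (N := N) fun k η => (-1) ^ k * kzCoeff k η⁻¹))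
  have h3 := Submodule.smul_mem _ (-tpi) (eInf_sub_mem_D1A (N := N))
  rw [smul_sub, smul_smul, mul_neg_one, neg_neg] at h3
  have := add_mem (add_mem h1 h2) h3
  convert this using 1
  rw [phiInf]
  abel

/-- The exponential of the left side is `η`, whose `N`-th power is `1`. Thus the arc from the
direction of `1` to that of `η` is a rational fraction of a full turn. -/
theorem angle_eq (η : Mu N) : ∃ q : ℚ, (angle η : ℂ) * Complex.I = q * tpi := by
  have hexp : Complex.exp ((N : ℕ) * ((angle η : ℂ) * Complex.I)) = 1 := by
    have h1 : Complex.exp ((angle η : ℂ) * Complex.I) = η.val := by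
      have h2 : (angle η : ℂ) = Complex.arg η.val -
          (toIcoDiv Real.two_pi_pos 0 (Complex.arg η.val) : ℤ) * (2 * Real.pi) := by
        rw [angle, toIcoMod]
        push_cast
        simp
      have h3 : (angle η : ℂ) * Complex.I = Complex.arg η.val * Complex.I -
          (toIcoDiv Real.two_pi_pos 0 (Complex.arg η.val) : ℤ) * (2 * Real.pi * Complex.I) := by
        rw [h2]; ring
      rw [h3, Complex.exp_sub, Complex.exp_int_mul_two_pi_mul_I, div_one]
      have := Complex.norm_mul_exp_arg_mul_I η.val
      rwa [η.norm_val, Complex.ofReal_one, one_mul] at this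
    rw [Complex.exp_nat_mul, h1, η.val_pow]
  obtain ⟨j, hj⟩ := Complex.exp_eq_one_iff.1 hexp
  have hN : (N : ℂ) ≠ 0 := by exact_mod_cast NeZero.ne N
  refine ⟨j / N, ?_⟩
  rw [← mul_right_inj' hN, hj, tpi]
  push_cast
  field_simp

/-- Modulo `D1A` the path to `η` is `e^{iθ E_0}`, which agrees with a rational power of `Θ(α)`,
namely `exp (q • logAlpha)`. Conjugation of `Θ(γ_η)` by the latter undoes the path up to `1 + D1A`,
and such a conjugation is invisible on `t_η` modulo `D2A`. -/
theorem exists_tau (η : Mu N) : ∃ τ ∈ ratA N, τ - tpi • aT η ∈ D2A N := by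
  obtain ⟨q, hq⟩ := angle_eq η
  set a := (q : ℂ) • logAlpha N with ha
  have ha0 : a [] = 0 := by simp [ha, logAlpha_nil]
  have haR : a ∈ ratA N := ratCast_smul_mem q logAlpha_mem
  set u := NCSeries.exp (-a)
  set v := NCSeries.exp a
  have huv : u * v = 1 := exp_neg_mul_exp ha0
  have hP1 : (toRoot η) [] = 1 := by
    simp [toRoot, halfTurn_nil, inv_nil, exp_nil, Phi0_nil]
  have he : NCSeries.exp ((angle η * Complex.I : ℂ) • e0 N) - v ∈ D1A N := by
    refine isClosedIdeal_D1A.psEval_cong (by simp [e0_nil]) ha0 ?_ _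
    have h1 := Submodule.smul_mem _ (q * tpi) (e0_sub_mem_D1A (N := N))
    have h2 := Submodule.smul_mem _ (q : ℂ) (logAlpha_sub_mem_D1A (N := N))
    have := sub_mem h1 h2
    rw [smul_sub, smul_sub, smul_smul, ← ha, sub_sub_sub_cancel_right] at this
    rwa [hq]
  have hP : toRoot η - v ∈ D1A N := by
    have := isClosedIdeal_D1A.mul_cong (isClosedIdeal_D1A.mul_cong (isClosedIdeal_D1A.mul_cong
      halfTurn_sub_one_mem (inv_sub_one_mem_D1A (Phi0_nil (1 : Mu N)) (Phi0_sub_one_mem 1))) he)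
      (Phi0_sub_one_mem η)
    simpa [toRoot] using this
  have hP' : u * toRoot η - 1 ∈ D1A N := by
    rw [← huv, ← mul_sub]; exact D1A_mul_left _ hP
  have hvu : v * u = 1 := exp_mul_exp_neg ha0
  have hQ' : NCSeries.inv (toRoot η) * v - 1 ∈ D1A N := by
    have := D1A_mul_right v (isClosedIdeal_D1A.inv_cong hP1 hP (g' := u) (by simp [hvu]))
    rwa [sub_mul, huv] at this
  have hPQ : u * toRoot η * (NCSeries.inv (toRoot η) * v) = 1 := by
    rw [mul_assoc, ← mul_assoc (toRoot η), mul_inv hP1, one_mul, huv]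
  refine ⟨u * thetaGamma η * v - 1, sub_mem (mul_mem_ratA (mul_mem_ratA
    (exp_mem_ratA (by simp [ha0]) (neg_mem haR)) (thetaGamma_mem η)) (exp_mem_ratA ha0 haR))
    one_mem_ratA, ?_⟩
  have ht : tpi • aT η ∈ D1A N := Submodule.smul_mem _ _ (aT_mem_D1A η)
  have hE := exp_sub_mem_D2A ht
  set E := NCSeries.exp (tpi • aT η)
  set P := u * toRoot η
  set Q := NCSeries.inv (toRoot η) * v
  have h1 : u * thetaGamma η * v = P * E * Q := by
    simp only [thetaGamma, P, Q, E, tpi, mul_assoc]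
  -- Each term contains `E - (1 + y)`, which lies in `D2A`, or `y` together with `P - 1` or `Q - 1`,
  -- all in `D1A`; the last one vanishes since `P * Q = 1`.
  have h2 : ∀ P E Q y : A N, P * E * Q - 1 - y = P * (E - (1 + y)) * Q +
      ((P - 1) * y * Q + y * (Q - 1)) + (P * Q - 1) := by intros; noncomm_ring
  rw [h1, h2, hPQ, sub_self, add_zero]
  exact add_mem (D2A_mul_right _ (D2A_mul_left _ hE))
    (add_mem (D2A_mul_right _ (mul_mem_D2A hP' ht)) (mul_mem_D2A ht hQ'))

end EllPolylog

end

noncomputable section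

namespace EllPolylog

open NCSeries

variable {N : ℕ} [NeZero N]

/-! ### The logarithm of `Θ(β)`, corrected in depth one. -/

theorem adIter_tau_sub_mem {a τ : A N} {η : Mu N} (ha : a - tpi • aY N ∈ D1A N)
    (hτ : τ - tpi • aT η ∈ D2A N) (k : ℕ) :
    adIter a k τ - tpi ^ (k + 1) • adIter (aY N) k (aT η) ∈ D2A N := by
  have := adIter_cong ha (Submodule.smul_mem _ tpi (aT_mem_D1A η)) hτ k
  rwa [adIter_smul_left, adIter_smul_right, smul_smul, ← pow_succ] at this

/-- An element of the rational structure that compares `Θ(β)` with a conjugate of `e^{-X}`. -/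
theorem exists_correction : ∃ R ∈ ratA N,
    R - ((-(Real.pi * Complex.I : ℂ)) • aT (1 : Mu N) - ySeries kzCoeff + phiInf N) ∈ D2A N := by
  choose τ hτR hτ using exists_tau (N := N)
  choose q hq using fun k (η : Mu N) => kzCoeff_rational k η
  have hτ0 : ∀ η, τ η [] = 0 := by
    intro η
    have := (D1A_coeff (D2A_le_D1A (hτ η))).1
    simpa [aT_nil] using this
  have hord : ∀ k, OrdGE k (∑ η, (q k η : ℂ) • adIter (logAlpha N) k (τ η)) := fun k =>
    OrdGE.sum _ fun η _ => ((adIter_ord logAlpha_nil (OrdGE.zero _) k).smul _).mono (by omega)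
  -- The factor `-1/2` turns `2πi` into the `-πi` of the half turn. By the choice of `q`, the number
  -- `q k η * tpi ^ (k + 1)` is the coefficient of `Y^k · t_η` in `phiInf N - ySeries kzCoeff`.
  refine ⟨((-1 / 2 : ℚ) : ℂ) • τ 1 + ssum fun k => ∑ η, (q k η : ℂ) • adIter (logAlpha N) k (τ η),
    add_mem (ratCast_smul_mem _ (hτR 1)) (isClosedSub_ratA.ssum_mem hord fun k =>
      sum_mem fun η _ => ratCast_smul_mem _ (adIter_mem_ratA logAlpha_mem (hτR η) k)), ?_⟩
  have h1 := Submodule.smul_mem _ ((-1 / 2 : ℚ) : ℂ) (hτ 1)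
  rw [smul_sub, smul_smul, show ((-1 / 2 : ℚ) : ℂ) * tpi = -(Real.pi * Complex.I : ℂ) by
    rw [tpi]; push_cast; ring] at h1
  have h2 : (ssum fun k => ∑ η, (q k η : ℂ) • adIter (logAlpha N) k (τ η)) -
      (phiInf N - ySeries kzCoeff) ∈ D2A N := by
    have hY : phiInf N - ySeries kzCoeff = ssum fun k => ∑ η : Mu N,
        ((-1) ^ k * kzCoeff k η⁻¹ - kzCoeff k η) • adIter (aY N) k (aT η) := by
      rw [phiInf, ySeries, ySeries, ← ssum_sub]
      congr 1; funext k
      rw [← Finset.sum_sub_distrib]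
      simp only [sub_smul]
    rw [hY]
    refine (isClosedSub_D2A N).ssum_sub_mem hord
      (ySeries_ord fun k η => (-1) ^ k * kzCoeff k η⁻¹ - kzCoeff k η) fun k => ?_
    rw [← Finset.sum_sub_distrib]
    refine sum_mem fun η _ => ?_
    rw [hq k η, ← tpi, mul_smul, ← smul_sub]
    exact Submodule.smul_mem _ _ (adIter_tau_sub_mem logAlpha_sub_mem_D1A (hτ η) k)
  have := add_mem h1 h2
  convert this using 1
  abel

/-- The conjugate of `X` by `Φ_{∞1}`, up to `D^2`, is rational. -/
theorem exists_logBeta : ∃ b ∈ ratA N, b - (aX N + ⁅aX N, phiInf N⁆) ∈ D2A N := by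
  obtain ⟨R, hR, h⟩ := exists_correction (N := N)
  set x' := NCSeries.inv (PhiInf N) * -aX N * PhiInf N with hx'
  have hx0 : x' [] = 0 := conj_nil (by simp [aX_nil])
  have hexp : NCSeries.exp x' = NCSeries.inv (PhiInf N) * NCSeries.exp (-aX N) * PhiInf N :=
    psEval_conj (by simp [aX_nil]) (mul_inv PhiInf_nil) (inv_mul PhiInf_nil) _
  set φ := phiInf N
  set ψ : A N := ySeries kzCoeff
  set t : A N := (-(Real.pi * Complex.I : ℂ)) • aT (1 : Mu N)
  have hφ : φ ∈ D1A N := ySeries_mem_D1A _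
  have hψ : ψ ∈ D1A N := ySeries_mem_D1A _
  have ht : t ∈ D1A N := Submodule.smul_mem _ _ (aT_mem_D1A _)
  have hRI : R ∈ D1A N := by
    have := add_mem (D2A_le_D1A h) (add_mem (sub_mem ht hψ) hφ)
    rwa [sub_add_cancel] at this
  set g := halfTurn N * NCSeries.inv (Phi0 (1 : Mu N)) * PhiInf N with hg
  have hg1 : g - (1 + R) ∈ D2A N := by
    have h1 := isClosedIdeal_D2A.mul_cong (isClosedIdeal_D2A.mul_cong halfTurn_sub_mem
      (inv_sub_mem_D2A (Phi0_nil (1 : Mu N)) hψ Phi0_one_sub_mem)) PhiInf_sub_mem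
    have h2 : ∀ t ψ φ : A N, (1 + t) * (1 - ψ) * (1 + φ) - (1 + (t - ψ + φ)) =
        -(t * ψ) + t * φ - ψ * φ - t * (ψ * φ) := by intros; noncomm_ring
    have h3 : (1 + t) * (1 - ψ) * (1 + φ) - (1 + (t - ψ + φ)) ∈ D2A N := by
      rw [h2]
      exact sub_mem (sub_mem (add_mem (neg_mem (mul_mem_D2A ht hψ)) (mul_mem_D2A ht hφ))
        (mul_mem_D2A hψ hφ)) (D2A_mul_left _ (mul_mem_D2A hψ hφ))
    have := sub_mem (add_mem h1 h3) h
    convert this using 1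
    rw [hg]
    abel
  -- Insert `Φ_{∞1} Φ_{∞1}⁻¹` in front of `e^{-X}`.
  have hβ : thetaBeta N = g * NCSeries.exp x' := by
    have h1 : ∀ a b c d e : A N, b * c = 1 → a * d * e = a * b * (c * d * e) := by
      intro a b c d e hbc
      rw [mul_assoc c, ← mul_assoc (a * b), mul_assoc a b c, hbc, mul_one, mul_assoc]
    rw [hexp, hg, thetaBeta]
    exact h1 _ _ _ _ _ (mul_inv PhiInf_nil)
  -- The rational element `1 - R` is inverse to `g` modulo `D2A`, since `R * R` has depth two.
  have hdiff : (1 - R) * thetaBeta N - NCSeries.exp x' ∈ D2A N := by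
    have h1 : ∀ g e : A N, (1 - R) * (g * e) - e = (1 - R) * (g - (1 + R)) * e - R * R * e := by
      intros; noncomm_ring
    rw [hβ, h1]
    exact sub_mem (D2A_mul_right _ (D2A_mul_left _ hg1)) (D2A_mul_right _ (mul_mem_D2A hRI hRI))
  have hβ0 : ((1 - R) * thetaBeta N - 1) [] = 0 := by
    have := (D1A_coeff (D2A_le_D1A hdiff)).1
    simpa [exp_nil, one_apply] using this
  -- This logarithm is rational and congruent to `x'`, the conjugate of `-X`; hence `-L` is the
  -- element sought.
  set L := psEval (fun k => (logCoeff k : ℂ)) ((1 - R) * thetaBeta N - 1)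
  have hL : L - x' ∈ D2A N := by
    rw [← log_exp hx0]
    refine isClosedIdeal_D2A.psEval_cong hβ0 (by simp [exp_nil, one_apply]) ?_ _
    rwa [sub_sub_sub_cancel_right]
  refine ⟨-L, neg_mem (psEval_mem_ratA hβ0 (sub_mem (mul_mem_ratA (sub_mem one_mem_ratA hR)
    thetaBeta_mem) one_mem_ratA) _), ?_⟩
  have := neg_mem (add_mem hL (conj_sub_mem_D2A PhiInf_nil hφ PhiInf_sub_mem (-aX N)))
  rw [neg_lie] at this
  convert this using 1
  rw [hx']
  abel

/-! ### The rational structure modulo the kernel of `V_{m,ζ}` -/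

theorem isClosedSub_kerV (m : ℕ) (ζ : Mu N) : IsClosedSub (kerV m ζ) := isClosedSub_closure _

theorem XYt_mem_kerV {m a b : ℕ} {ζ η : Mu N} (h : (a + b, η) ≠ (m, ζ)) :
    incl N (XYt a b η) ∈ kerV m ζ :=
  le_closure _ (le_sup_right (a := D2 N) (Submodule.subset_span ⟨a, b, η, h, rfl⟩))

theorem incl_XYt_ord (a b : ℕ) (η : Mu N) : OrdGE (a + b) (incl N (XYt a b η)) := by
  rw [incl_XYt]
  exact (adIter_ord aX_nil (adIter_ord aY_nil (OrdGE.zero _) b) a).mono (by omega)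

/-- The bracket takes `Y^k · t_η` to `Y^{k+1} · t_η`, so only the term with `k = m - 1` and `η = ζ`
survives in `V_{m,ζ}`. -/
theorem lie_Y_phiInf_mem {m : ℕ} (hm : m ≠ 0) (ζ : Mu N) :
    ⁅aY N, phiInf N⁆ - ((-1) ^ (m - 1) * kzCoeff (m - 1) ζ⁻¹) • incl N (XYt 0 m ζ) ∈ kerV m ζ := by
  obtain ⟨n, rfl⟩ := Nat.exists_eq_succ_of_ne_zero hm
  have h : ⁅aY N, phiInf N⁆ = ssum fun k => ∑ η : Mu N, ((-1) ^ k * kzCoeff k η⁻¹) •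
      incl N (XYt 0 (k + 1) η) := by
    rw [phiInf, ySeries, lie_ssum _ (ySeries_ord _)]
    congr 1; funext k
    rw [lie_sum]
    refine Finset.sum_congr rfl fun η _ => ?_
    rw [lie_smul, incl_XYt, adIter_zero, adIter_succ]
  rw [h]
  refine (isClosedSub_kerV _ _).ssum_sub_single_mem (G := fun k η => incl N (XYt 0 (k + 1) η))
    (fun k η => (incl_XYt_ord _ _ _).mono (by omega)) (fun k η => (-1) ^ k * kzCoeff k η⁻¹)
    (m := n) fun k η hk => XYt_mem_kerV fun h => hk ?_
  simp only [Prod.mk.injEq] at h ⊢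
  exact ⟨by omega, h.2⟩

theorem lie_X_phiInf_mem {m : ℕ} (hm : m ≠ 0) (ζ : Mu N) :
    ⁅aX N, phiInf N⁆ - ((-1) ^ (m - 1) * kzCoeff (m - 1) ζ⁻¹) • incl N (XYt 1 (m - 1) ζ)
      ∈ kerV m ζ := by
  obtain ⟨n, rfl⟩ := Nat.exists_eq_succ_of_ne_zero hm
  have h : ⁅aX N, phiInf N⁆ = ssum fun k => ∑ η : Mu N, ((-1) ^ k * kzCoeff k η⁻¹) •
      incl N (XYt 1 k η) := by
    rw [phiInf, ySeries, lie_ssum _ (ySeries_ord _)]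
    congr 1; funext k
    rw [lie_sum]
    refine Finset.sum_congr rfl fun η _ => ?_
    rw [lie_smul, incl_XYt, adIter_succ, adIter_zero]
  rw [h]
  refine (isClosedSub_kerV _ _).ssum_sub_single_mem (G := fun k η => incl N (XYt 1 k η))
    (fun k η => (incl_XYt_ord _ _ _).mono (by omega)) (fun k η => (-1) ^ k * kzCoeff k η⁻¹)
    (m := n) fun k η hk => XYt_mem_kerV fun h => hk ?_
  simp only [Prod.mk.injEq] at h ⊢
  exact ⟨by omega, h.2⟩

/-- By the defining relation `X^{k+1} · Y = ∑ X^k · t_η`, so the terms of `E_∞` beyond `-Y` are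
monomials in depth one. Their coefficients are rational because Bernoulli numbers are. -/
theorem eInf_add_mem_kerV (m : ℕ) (ζ : Mu N) :
    ∃ q : ℚ, eInf N + aY N - (q : ℂ) • incl N (XYt m 0 ζ) ∈ kerV m ζ := by
  set c : ℕ → ℚ := fun k => -((-1) ^ k * bernoulli k / (k.factorial : ℚ)) with hc
  have ho : ∀ k, OrdGE k ((c k : ℂ) • adIter (aX N) k (aY N)) := fun k =>
    ((adIter_ord aX_nil (OrdGE.zero _) k).smul _).mono (by omega)
  have h : eInf N + aY N = ssum fun k => ∑ η : Mu N, (c (k + 1) : ℂ) • incl N (XYt k 0 η) := by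
    have h1 : eInf N = ssum fun k => (c k : ℂ) • adIter (aX N) k (aY N) := by
      rw [eInf, adEval_eq_ssum]
      congr 1; funext k
      simp [hc]
    rw [h1, ssum_succ ho]
    have h2 : (c 0 : ℂ) = -1 := by simp [hc]
    rw [h2, adIter_zero, neg_one_smul, neg_add_cancel_comm]
    congr 1; funext k
    have h3 : ∀ k, adIter (aX N) (k + 1) (aY N) = ∑ η : Mu N, adIter (aX N) k (aT η) := by
      intro k
      induction k with
      | zero => rw [adIter_succ, adIter_zero, ← sum_aT]; simp
      | succ k ih =>
        rw [adIter_succ, ih, lie_sum]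
        simp only [adIter_succ]
    rw [h3, Finset.smul_sum]
    simp only [incl_XYt, adIter_zero]
  refine ⟨c (m + 1), ?_⟩
  rw [h]
  exact (isClosedSub_kerV _ _).ssum_sub_single_mem (G := fun k η => incl N (XYt k 0 η))
    (fun k η => incl_XYt_ord k 0 η) (fun k _ => (c (k + 1) : ℂ))
    (m := m) fun k η hk => XYt_mem_kerV fun h => hk (by simpa using h)

/-- The elements of `A` that are rational modulo a subspace. -/
def ratMod (K : Submodule ℂ (A N)) : Submodule ℚ (A N) := ratA N ⊔ K.restrictScalars ℚ

theorem mem_ratMod {K : Submodule ℂ (A N)} {f : A N} :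
    f ∈ ratMod K ↔ ∃ r ∈ ratA N, f - r ∈ K := by
  rw [ratMod, Submodule.mem_sup]
  constructor
  · rintro ⟨r, hr, z, hz, rfl⟩
    exact ⟨r, hr, by simpa using hz⟩
  · rintro ⟨r, hr, h⟩
    exact ⟨r, hr, f - r, h, by abel⟩

theorem ratMod_congr {K : Submodule ℂ (A N)} {f g : A N} (h : f - g ∈ K) (hg : g ∈ ratMod K) :
    f ∈ ratMod K := by
  have := (ratMod K).add_mem (Submodule.mem_sup_right (S := ratA N)
    (show f - g ∈ K.restrictScalars ℚ from h)) hg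
  rwa [sub_add_cancel] at this

theorem ratCast_smul_mem_ratMod {K : Submodule ℂ (A N)} (q : ℚ) {f : A N} (hf : f ∈ ratMod K) :
    (q : ℂ) • f ∈ ratMod K := by
  rw [ratCast_smul]; exact Submodule.smul_mem _ q hf

/-- The rational elements at hand reduce to `X`, `2πi Y` and `2πi t_ζ` in lowest depth, hence one
period for every `Y` and one for `t_ζ`. -/
theorem monomial_mem_ratMod (a b : ℕ) (ζ : Mu N) (K : Submodule ℂ (A N)) :
    tpi ^ (b + 1) • incl N (XYt a b ζ) ∈ ratMod (D2A N ⊔ K) := by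
  obtain ⟨x, hxR, hx⟩ := exists_logBeta (N := N)
  obtain ⟨τ, hτR, hτ⟩ := exists_tau ζ
  have h1 := adIter_tau_sub_mem logAlpha_sub_mem_D1A hτ b
  have hx1 : x - aX N ∈ D1A N := by
    have := add_mem (D2A_le_D1A hx) (lie_mem_D1A (aX N) (phiInf N))
    rwa [← sub_sub, sub_add_cancel] at this
  have h2 := adIter_cong hx1 (Submodule.smul_mem _ _ (adIter_mem_D1A _ (aT_mem_D1A ζ) b)) h1 a
  rw [adIter_smul_right, ← incl_XYt] at h2
  refine mem_ratMod.2 ⟨_, adIter_mem_ratA hxR (adIter_mem_ratA logAlpha_mem hτR b) a,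
    Submodule.mem_sup_left ?_⟩
  rw [← neg_mem_iff, neg_sub]
  exact h2

theorem neg_Li_eq {m : ℕ} (hm : 2 ≤ m) (ζ : Mu N) :
    (-1) ^ (m - 1) * kzCoeff (m - 1) ζ⁻¹ = -Li m ζ := by
  rw [kzCoeff_of_ne_zero (by omega), inv_inv, Nat.sub_add_cancel (by omega)]
  obtain ⟨n, rfl⟩ : ∃ n, m = n + 1 := ⟨m - 1, by omega⟩
  have : ((-1 : ℂ) ^ n) * (-1) ^ n = 1 := by rw [← mul_pow]; simp
  rw [Nat.add_sub_cancel, pow_succ]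
  linear_combination (-Li (n + 1) ζ) * this

theorem X_mem_ratMod {m : ℕ} (hm : 2 ≤ m) (ζ : Mu N) :
    incl N (pX N - Li m ζ • XYt 1 (m - 1) ζ) ∈ ratMod (D2A N ⊔ kerV m ζ) := by
  obtain ⟨x, hxR, hx⟩ := exists_logBeta (N := N)
  have h := lie_X_phiInf_mem (show m ≠ 0 by omega) ζ
  rw [neg_Li_eq hm] at h
  refine mem_ratMod.2 ⟨x, hxR, ?_⟩
  rw [← neg_mem_iff, neg_sub]
  have := add_mem (Submodule.mem_sup_left (T := kerV m ζ) hx)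
    (Submodule.mem_sup_right (S := D2A N) h)
  convert this using 1
  rw [map_sub, map_smul, show incl N (pX N) = aX N from rfl, neg_smul]
  abel

/-- The element is `logAlpha` once the `X^m · t_ζ` term of `E_∞` has been removed; that term is a
rational multiple of the rational element `2πi X^m · t_ζ`. -/
theorem Y_mem_ratMod {m : ℕ} (hm : 2 ≤ m) (ζ : Mu N) :
    tpi • incl N (pY N - Li m ζ • XYt 0 m ζ) ∈ ratMod (D2A N ⊔ kerV m ζ) := by
  have h := lie_Y_phiInf_mem (show m ≠ 0 by omega) ζ
  rw [neg_Li_eq hm] at h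
  obtain ⟨q, hq⟩ := eInf_add_mem_kerV m ζ
  have h1 := ratCast_smul_mem_ratMod q (monomial_mem_ratMod m 0 ζ (kerV m ζ))
  have h2 : logAlpha N ∈ ratMod (D2A N ⊔ kerV m ζ) :=
    mem_ratMod.2 ⟨_, logAlpha_mem, by simp⟩
  refine ratMod_congr ?_ (add_mem h2 h1)
  rw [← neg_mem_iff, neg_sub]
  have := add_mem (Submodule.mem_sup_left (T := kerV m ζ) (logAlpha_sub_mem_D2A (N := N)))
    (Submodule.mem_sup_right (S := D2A N) (sub_mem (Submodule.smul_mem _ tpi h)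
      (Submodule.smul_mem _ tpi hq)))
  convert this using 1
  rw [map_sub, map_smul, show incl N (pY N) = aY N from rfl]
  simp only [smul_sub, smul_add, smul_smul, zero_add, pow_one]
  module

end EllPolylog

end

noncomputable section

namespace EllPolylog

open NCSeries

variable {N : ℕ} [NeZero N]

/-! ### Low order coefficients of rational elements -/

theorem exp_apply_singleton {σ : Type} (f : NCSeries σ) (l : σ) :
    NCSeries.exp f [l] = f [l] := by
  simp [NCSeries.exp, psEval, Finset.sum_range_succ, one_apply]

theorem thetaGamma_sub_one_mem (η : Mu N) : thetaGamma η - 1 ∈ D1A N := by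
  have hP1 : (toRoot η) [] = 1 := by
    simp [toRoot, halfTurn_nil, inv_nil, exp_nil, Phi0_nil]
  have hE : NCSeries.exp (tpi • aT η) - 1 ∈ D1A N :=
    exp_sub_one_mem_D1A (Submodule.smul_mem _ _ (aT_mem_D1A η))
  have h := D1A_mul_right (NCSeries.inv (toRoot η)) (D1A_mul_left (toRoot η) hE)
  rwa [mul_sub, sub_mul, mul_one, mul_inv hP1] at h

theorem thetaBeta_sub_mem : thetaBeta N - NCSeries.exp (-aX N) ∈ D1A N := by
  have := isClosedIdeal_D1A.mul_cong (isClosedIdeal_D1A.mul_cong (isClosedIdeal_D1A.mul_cong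
    (halfTurn_sub_one_mem (N := N)) (inv_sub_one_mem_D1A (Phi0_nil (1 : Mu N)) (Phi0_sub_one_mem 1)))
    (show NCSeries.exp (-aX N) - NCSeries.exp (-aX N) ∈ D1A N by simp)) PhiInf_sub_one_mem
  simpa [thetaBeta] using this

/-- The rational structure in degrees zero and one. -/
theorem ratA_coeff {f : A N} (hf : f ∈ ratA N) :
    (∃ q : ℚ, f [] = q) ∧ (∃ q : ℚ, f [Letter.X] = q) ∧ ∃ q : ℚ, f [Letter.Y] = q * tpi := by
  have key : ∀ g ∈ Algebra.adjoin ℚ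
      ({thetaAlpha N, thetaBeta N} ∪ Set.range (thetaGamma : Mu N → A N)),
      (∃ q : ℚ, g [] = q) ∧ (∃ q : ℚ, g [Letter.X] = q) ∧ ∃ q : ℚ, g [Letter.Y] = q * tpi := by
    intro g hg
    induction hg using Algebra.adjoin_induction with
    | mem x hx =>
      rcases hx with (rfl | rfl) | ⟨η, rfl⟩
      · obtain ⟨-, h1, h2⟩ := D1A_coeff (logAlpha_sub_mem_D1A (N := N))
        rw [← exp_logAlpha, exp_nil, exp_apply_singleton, exp_apply_singleton]
        refine ⟨⟨1, by simp⟩, ⟨0, ?_⟩, ⟨1, ?_⟩⟩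
        · simpa [aY, letter] using h1
        · simpa [aY, letter, sub_eq_zero] using h2
      · obtain ⟨h0, h1, h2⟩ := D1A_coeff (thetaBeta_sub_mem (N := N))
        rw [sub_apply, sub_eq_zero] at h0 h1 h2
        rw [h0, h1, h2, exp_nil, exp_apply_singleton, exp_apply_singleton]
        exact ⟨⟨1, by simp⟩, ⟨-1, by simp [aX, letter]⟩, ⟨0, by simp [aX, letter]⟩⟩
      · obtain ⟨h0, h1, h2⟩ := D1A_coeff (thetaGamma_sub_one_mem η)
        rw [sub_apply, sub_eq_zero] at h0 h1 h2
        rw [h0, h1, h2]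
        exact ⟨⟨1, by simp [one_apply]⟩, ⟨0, by simp [one_apply]⟩, ⟨0, by simp [one_apply]⟩⟩
    | algebraMap r =>
      rw [Algebra.algebraMap_eq_smul_one]
      exact ⟨⟨r, by simp [one_apply, Rat.smul_def]⟩, ⟨0, by simp [one_apply]⟩,
        ⟨0, by simp [one_apply]⟩⟩
    | add x y _ _ hx hy =>
      obtain ⟨⟨a, ha⟩, ⟨b, hb⟩, c, hc⟩ := hx
      obtain ⟨⟨a', ha'⟩, ⟨b', hb'⟩, c', hc'⟩ := hy
      refine ⟨⟨a + a', ?_⟩, ⟨b + b', ?_⟩, ⟨c + c', ?_⟩⟩ <;> rw [add_apply] <;>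
        simp only [ha, ha', hb, hb', hc, hc'] <;> push_cast <;> ring
    | mul x y _ _ hx hy =>
      obtain ⟨⟨a, ha⟩, ⟨b, hb⟩, c, hc⟩ := hx
      obtain ⟨⟨a', ha'⟩, ⟨b', hb'⟩, c', hc'⟩ := hy
      refine ⟨⟨a * a', ?_⟩, ⟨a * b' + b * a', ?_⟩, ⟨a * c' + c * a', ?_⟩⟩
      · rw [mul_nil, ha, ha']; push_cast; ring
      · rw [mul_cons, mul_nil, tail_apply, ha, ha', hb, hb']; push_cast; ring
      · rw [mul_cons, mul_nil, tail_apply, ha, ha', hc, hc']; push_cast; ring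
  obtain ⟨g, hg, h⟩ := hf 2
  have := key g hg
  rwa [← h [] (by simp), ← h [Letter.X] (by simp), ← h [Letter.Y] (by simp)] at this

/-- The coefficients at `X` and `Y` vanish on `D1A + D1`, so the coordinates can be read off from a
rational representative in `A`. -/
theorem coord_rat {h : H N} (hh : h ∈ (HMHS N).rat) :
    (∃ q : ℚ, coordX N h = q) ∧ ∃ q : ℚ, coordY N h = q * tpi := by
  obtain ⟨x, rfl⟩ := Submodule.Quotient.mk_surjective _ h
  obtain ⟨r, hr, h1⟩ := hh
  have h2 : incl N x - r ∈ D1A N ⊔ D1 N := by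
    rw [← Submodule.Quotient.eq]
    exact h1.symm
  have h3 : ∀ z ∈ D1A N ⊔ D1 N, z [Letter.X] = 0 ∧ z [Letter.Y] = 0 := by
    intro z hz
    obtain ⟨a, ha, b, hb, rfl⟩ := Submodule.mem_sup.1 hz
    obtain ⟨-, ha1, ha2⟩ := D1A_coeff ha
    simp [ha1, ha2, hb.2.1, hb.2.2]
  obtain ⟨h4, h5⟩ := h3 _ h2
  obtain ⟨-, h6, h7⟩ := ratA_coeff hr
  rw [sub_apply, sub_eq_zero] at h4 h5
  rw [← h4] at h6
  rw [← h5] at h7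
  exact ⟨h6, h7⟩

theorem toV_mem_rat {m : ℕ} {ζ : Mu N} {x : p N}
    (hx : incl N x ∈ ratMod (D2A N ⊔ kerV m ζ)) : toV m ζ x ∈ (VMHS m ζ).rat := by
  obtain ⟨r, hr, h⟩ := mem_ratMod.1 hx
  refine ⟨r, hr, ?_⟩
  exact ((Submodule.Quotient.eq _).2 h).symm

/-! ### Linear maps on `H_u` -/

theorem proj_eq (x : p N) : proj N (D1 N) x =
    (x : A N) [Letter.X] • proj N (D1 N) (pX N) + (x : A N) [Letter.Y] • proj N (D1 N) (pY N) := by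
  rw [← map_smul, ← map_smul, ← map_add]
  refine (Submodule.Quotient.eq _).2 ?_
  refine ⟨(x - ((x : A N) [Letter.X] • pX N + (x : A N) [Letter.Y] • pY N)).2, ?_, ?_⟩
  · change (x : A N) [Letter.X] - ((x : A N) [Letter.X] • aX N [Letter.X] +
      (x : A N) [Letter.Y] • aY N [Letter.X]) = 0
    simp [aX, aY, letter]
  · change (x : A N) [Letter.Y] - ((x : A N) [Letter.X] • aX N [Letter.Y] +
      (x : A N) [Letter.Y] • aY N [Letter.Y]) = 0
    simp [aX, aY, letter]

section OfXY

variable {W W' : Type} [AddCommGroup W] [Module ℂ W] [AddCommGroup W'] [Module ℂ W']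

theorem ofXY_apply (v v' : W) (h : H N) : ofXY N v v' h = coordX N h • v + coordY N h • v' := rfl

theorem comp_ofXY (f : W →ₗ[ℂ] W') (v v' : W) : f ∘ₗ ofXY N v v' = ofXY N (f v) (f v') := by
  exact LinearMap.ext fun h => by simp [ofXY_apply]

theorem ofXY_add (v v' w w' : W) : ofXY N v v' + ofXY N w w' = ofXY N (v + w) (v' + w') := by
  exact LinearMap.ext fun h => by simp only [LinearMap.add_apply, ofXY_apply]; module

theorem smul_ofXY (c : ℂ) (v v' : W) : c • ofXY N v v' = ofXY N (c • v) (c • v') := by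
  exact LinearMap.ext fun h => by simp only [LinearMap.smul_apply, ofXY_apply]; module

end OfXY

theorem ofXY_proj : ofXY N (proj N (D1 N) (pX N)) (proj N (D1 N) (pY N)) = LinearMap.id := by
  ext x
  exact (proj_eq x).symm

theorem VtoH_toV (m : ℕ) (ζ : Mu N) (x : p N) : VtoH m ζ (toV m ζ x) = proj N (D1 N) x := rfl

theorem toV_eq {m : ℕ} {ζ : Mu N} {x y : p N} (h : incl N (x - y) ∈ kerV m ζ) :
    toV m ζ x = toV m ζ y := (Submodule.Quotient.eq _).2 h

theorem proj_XYt (a b : ℕ) (ζ : Mu N) : proj N (D1 N) (XYt a b ζ) = 0 :=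
  (Submodule.Quotient.mk_eq_zero _).2 (XYt_mem_D1 a b ζ)

/-! ### Filtrations -/

theorem degYt_eq_zero {w : List (Letter N)} (h : degYt w = 0) :
    w = List.replicate w.length Letter.X := by
  refine List.eq_replicate_iff.2 ⟨rfl, fun b hb => ?_⟩
  unfold degYt at h
  have := List.filter_eq_nil_iff.1 (List.length_eq_zero_iff.1 h) b hb
  simpa using this

theorem mem_weightA_of_nonneg {k : ℤ} (hk : 0 ≤ k) (f : A N) : f ∈ weightA N k :=
  fun w hw => absurd hw (by omega)

theorem degYt_X : degYt ([Letter.X] : List (Letter N)) = 0 := by simp [degYt]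

theorem degYt_Y : degYt ([Letter.Y] : List (Letter N)) = 1 := by simp [degYt]

/-- A word with some letter other than `X` already has weight at most `-2`. -/
theorem mem_weightA_of_replicate {k : ℤ} (hk : -2 ≤ k) {f : A N}
    (hf : ∀ n, f (List.replicate n Letter.X) = 0) : f ∈ weightA N k := by
  intro w hw
  by_contra h
  have h1 : degYt w ≠ 0 := fun h0 => h (by rw [degYt_eq_zero h0]; exact hf _)
  omega

theorem mul_replicate {σ : Type} (f g : NCSeries σ) (l : σ) (n : ℕ) :
    (f * g) (List.replicate n l) = ∑ i ∈ Finset.range (n + 1),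
      f (List.replicate i l) * g (List.replicate (n - i) l) := by
  rw [mul_apply, List.length_replicate]
  refine Finset.sum_congr rfl fun i hi => ?_
  rw [List.take_replicate, List.drop_replicate, min_eq_left (Finset.mem_range_succ_iff.1 hi)]

omit [NeZero N] in
theorem letter_replicate {l : Letter N} (hl : l ≠ Letter.X) (n : ℕ) :
    (letter l : A N) (List.replicate n Letter.X) = 0 := by
  have : List.replicate n Letter.X ≠ [l] := by
    intro h
    have h1 : l ∈ List.replicate n Letter.X := by rw [h]; simp
    exact hl (List.eq_of_mem_replicate h1)
  simp [letter, this]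

/-- Setting all letters but `X` to zero kills `⁅X, Y⁆` and hence every `t_ζ`, including the
eliminated `t_1`. -/
theorem D1A_replicate {f : A N} (hf : f ∈ D1A N) (n : ℕ) :
    f (List.replicate n Letter.X) = 0 := by
  have hY : ∀ n, (aY N) (List.replicate n Letter.X) = 0 := letter_replicate (by simp)
  have hT : ∀ (ζ : Mu N) (n : ℕ), (aT ζ) (List.replicate n Letter.X) = 0 := by
    intro ζ n
    unfold aT
    split_ifs
    · simp [lie_eq, mul_replicate, hY, sum_apply, letter_replicate]
    · exact letter_replicate (by simp) n
  obtain ⟨g, hg, h⟩ := hf (n + 1)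
  rw [h _ (by simp)]
  clear h
  induction hg using Submodule.span_induction with
  | mem x hx =>
    obtain ⟨y, ζ, z, rfl⟩ := hx
    simp [mul_replicate, hT]
  | zero => rfl
  | add x y _ _ hx hy => rw [add_apply, hx, hy, add_zero]
  | smul c x _ hx => rw [NCSeries.smul_apply, hx, smul_zero]

theorem incl_XYt_mem_D1A (a b : ℕ) (ζ : Mu N) : incl N (XYt a b ζ) ∈ D1A N := by
  rw [incl_XYt]; exact adIter_mem_D1A _ (adIter_mem_D1A _ (aT_mem_D1A ζ) b) a

theorem aX_mem_hodgeA {k : ℤ} (hk : k ≤ 0) : aX N ∈ hodgeA N k := by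
  intro w hw
  by_contra h
  have h1 : w = [Letter.X] := by
    by_contra h2
    exact h (by simp [aX, letter, h2])
  rw [h1, degYt_X] at hw
  omega

theorem aY_mem_hodgeA {k : ℤ} (hk : k ≤ -1) : aY N ∈ hodgeA N k := by
  intro w hw
  by_contra h
  have h1 : w = [Letter.Y] := by
    by_contra h2
    exact h (by simp [aY, letter, h2])
  rw [h1, degYt_Y] at hw
  omega

theorem coord_weight {k : ℤ} {h : H N} (hh : h ∈ (HMHS N).weight k) :
    (coordX N h = 0 ∨ 0 ≤ k) ∧ (coordY N h = 0 ∨ -2 ≤ k) := by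
  obtain ⟨x, hx, rfl⟩ := hh
  refine ⟨or_iff_not_imp_right.2 fun hk => hx [Letter.X] ?_,
    or_iff_not_imp_right.2 fun hk => hx [Letter.Y] ?_⟩
  · rw [degYt_X]; omega
  · rw [degYt_Y]; omega

theorem coord_hodge {k : ℤ} {h : H N} (hh : h ∈ (HMHS N).hodge k) :
    (coordX N h = 0 ∨ k ≤ 0) ∧ (coordY N h = 0 ∨ k ≤ -1) := by
  obtain ⟨x, hx, rfl⟩ := hh
  refine ⟨or_iff_not_imp_right.2 fun hk => hx [Letter.X] ?_,
    or_iff_not_imp_right.2 fun hk => hx [Letter.Y] ?_⟩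
  · rw [degYt_X]; omega
  · rw [degYt_Y]; omega

theorem ofXY_mem {W : Type} [AddCommGroup W] [Module ℂ W] {K : Submodule ℂ W} {v v' : W} {h : H N}
    (hX : coordX N h = 0 ∨ v ∈ K) (hY : coordY N h = 0 ∨ v' ∈ K) : ofXY N v v' h ∈ K := by
  rw [ofXY_apply]
  refine K.add_mem ?_ ?_
  · rcases hX with h0 | h0
    · rw [h0, zero_smul]; exact K.zero_mem
    · exact K.smul_mem _ h0
  · rcases hY with h0 | h0
    · rw [h0, zero_smul]; exact K.zero_mem
    · exact K.smul_mem _ h0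

/-! ### Splittings of `V_{m,ζ}` -/

theorem splitV_weight_le (m : ℕ) (ζ : Mu N) (c : ℂ) (k : ℤ) :
    ((HMHS N).weight k).map (splitV m ζ c) ≤ (VMHS m ζ).weight k := by
  rintro _ ⟨h, hh, rfl⟩
  obtain ⟨h1, h2⟩ := coord_weight hh
  refine ofXY_mem (h1.imp_right fun hk => ?_) (h2.imp_right fun hk => ?_)
  · exact ⟨_, mem_weightA_of_nonneg hk _, rfl⟩
  · refine ⟨_, mem_weightA_of_replicate hk fun n => ?_, rfl⟩
    rw [map_sub, map_smul, sub_apply, NCSeries.smul_apply, D1A_replicate (incl_XYt_mem_D1A _ _ _),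
      smul_zero, sub_zero]
    exact letter_replicate (by simp) n

theorem VtoH_comp_splitV (m : ℕ) (ζ : Mu N) (c : ℂ) :
    VtoH m ζ ∘ₗ splitV m ζ c = LinearMap.id := by
  rw [splitV, comp_ofXY, VtoH_toV, VtoH_toV, map_sub, map_sub, map_smul, map_smul, proj_XYt,
    proj_XYt, smul_zero, sub_zero, sub_zero, ofXY_proj]

theorem toV_comp_drLift (m : ℕ) (ζ : Mu N) : toV m ζ ∘ₗ drLift N = splitV m ζ 0 := by
  rw [drLift, comp_ofXY, splitV, zero_smul, zero_smul, sub_zero, sub_zero]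

theorem isHodgeSection_V (m : ℕ) (ζ : Mu N) :
    IsHodgeSection (HMHS N) (VMHS m ζ) (VtoH m ζ) (toV m ζ ∘ₗ drLift N) where
  comp_eq := by rw [toV_comp_drLift, VtoH_comp_splitV]
  hodge_le k := by
    rintro _ ⟨h, hh, rfl⟩
    obtain ⟨h1, h2⟩ := coord_hodge hh
    rw [drLift, comp_ofXY]
    exact ofXY_mem (h1.imp_right fun hk => ⟨pX N, aX_mem_hodgeA hk, rfl⟩)
      (h2.imp_right fun hk => ⟨pY N, aY_mem_hodgeA hk, rfl⟩)
  weight_le k := by rw [toV_comp_drLift]; exact splitV_weight_le m ζ 0 k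

/-- All splittings that differ from the polylogarithmic one by a rational multiple of `(2πi)^m`. -/
theorem isDeRhamSplitting_V {m : ℕ} (hm : 2 ≤ m) (ζ : Mu N) {c : ℂ} {q : ℚ}
    (hc : c - Li m ζ = q * tpi ^ m) :
    IsDeRhamSplitting (HMHS N) (VMHS m ζ) (VtoH m ζ) (splitV m ζ c) where
  comp_eq := VtoH_comp_splitV m ζ c
  weight_le := splitV_weight_le m ζ c
  rat_mem h hh := by
    obtain ⟨⟨a, ha⟩, b, hb⟩ := coord_rat hh
    have hX : incl N (pX N - c • XYt 1 (m - 1) ζ) ∈ ratMod (D2A N ⊔ kerV m ζ) := by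
      have h1 := sub_mem (X_mem_ratMod hm ζ)
        (ratCast_smul_mem_ratMod q (monomial_mem_ratMod 1 (m - 1) ζ (kerV m ζ)))
      rw [Nat.sub_add_cancel (by omega), smul_smul, ← hc, ← map_smul, ← map_sub] at h1
      convert h1 using 2
      module
    -- Rational classes in `H_u` have `Y`-coordinate in `ℚ tpi`. This supplies the one further
    -- period that `Y^m · t_ζ` needs compared with `X Y^{m-1} · t_ζ`.
    have hY : tpi • incl N (pY N - c • XYt 0 m ζ) ∈ ratMod (D2A N ⊔ kerV m ζ) := by
      have h1 := sub_mem (Y_mem_ratMod hm ζ)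
        (ratCast_smul_mem_ratMod q (monomial_mem_ratMod 0 m ζ (kerV m ζ)))
      rw [smul_smul, pow_succ, ← mul_assoc, ← hc, ← map_smul, ← map_smul, ← map_sub] at h1
      rw [← map_smul]
      convert h1 using 2
      module
    have h2 : splitV m ζ c h = toV m ζ ((a : ℂ) • (pX N - c • XYt 1 (m - 1) ζ) +
        (b : ℂ) • tpi • (pY N - c • XYt 0 m ζ)) := by
      rw [splitV, ofXY_apply, ha, hb, map_add, map_smul, map_smul, map_smul, smul_smul]
    rw [h2]
    refine toV_mem_rat ?_
    rw [map_add, map_smul, map_smul, map_smul]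
    exact add_mem (ratCast_smul_mem_ratMod a hX) (ratCast_smul_mem_ratMod b hY)

/-! ### Splittings of the pull-back -/

theorem isDeRhamSplitting_PV {m : ℕ} {ζ ζ' : Mu N} {s : H N →ₗ[ℂ] PV m ζ ζ'} {s₁ : H N →ₗ[ℂ] V m ζ}
    {s₂ : H N →ₗ[ℂ] V m ζ'} (h1 : IsDeRhamSplitting (HMHS N) (VMHS m ζ) (VtoH m ζ) s₁)
    (h2 : IsDeRhamSplitting (HMHS N) (VMHS m ζ') (VtoH m ζ') s₂)
    (hs : ∀ h, (s h : V m ζ × V m ζ') = (s₁ h, s₂ h)) :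
    IsDeRhamSplitting (HMHS N) (PVMHS m ζ ζ') (PVtoH m ζ ζ') s where
  comp_eq := by
    refine LinearMap.ext fun h => ?_
    have : PVtoH m ζ ζ' (s h) = VtoH m ζ (s h : V m ζ × V m ζ').1 := rfl
    rw [LinearMap.comp_apply, this, hs]
    exact LinearMap.congr_fun h1.comp_eq h
  rat_mem h hh := by
    change (s h : V m ζ × V m ζ') ∈ (VMHS m ζ).rat.prod (VMHS m ζ').rat
    rw [hs]
    exact ⟨h1.rat_mem h hh, h2.rat_mem h hh⟩
  weight_le k := by
    rintro _ ⟨h, hh, rfl⟩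
    change (s h : V m ζ × V m ζ') ∈ ((VMHS m ζ).weight k).prod ((VMHS m ζ').weight k)
    rw [hs]
    exact ⟨h1.weight_le k ⟨h, hh, rfl⟩, h2.weight_le k ⟨h, hh, rfl⟩⟩

theorem toPV_apply (m : ℕ) (ζ ζ' : Mu N) (x : p N) :
    (toPV m ζ ζ' x : V m ζ × V m ζ') = (toV m ζ x, toV m ζ' x) := rfl

theorem isHodgeSection_PV (m : ℕ) (ζ ζ' : Mu N) :
    IsHodgeSection (HMHS N) (PVMHS m ζ ζ') (PVtoH m ζ ζ') (toPV m ζ ζ' ∘ₗ drLift N) where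
  comp_eq := (isHodgeSection_V m ζ).comp_eq
  hodge_le k := by
    rintro _ ⟨h, hh, rfl⟩
    exact ⟨(isHodgeSection_V m ζ).hodge_le k ⟨h, hh, rfl⟩,
      (isHodgeSection_V m ζ').hodge_le k ⟨h, hh, rfl⟩⟩
  weight_le k := by
    rintro _ ⟨h, hh, rfl⟩
    exact ⟨(isHodgeSection_V m ζ).weight_le k ⟨h, hh, rfl⟩,
      (isHodgeSection_V m ζ').weight_le k ⟨h, hh, rfl⟩⟩

theorem toV_sub_add {m a b : ℕ} {ζ ζ' : Mu N} (hζ : ζ' ≠ ζ) (x : p N)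
    (c d e : ℂ) : toV m ζ (x - c • (d • XYt a b ζ + e • XYt a b ζ')) =
      toV m ζ (x - (c * d) • XYt a b ζ) := by
  refine toV_eq ?_
  have : x - c • (d • XYt a b ζ + e • XYt a b ζ') - (x - (c * d) • XYt a b ζ) =
      (-(c * e)) • XYt a b ζ' := by module
  rw [this, map_smul]
  exact Submodule.smul_mem _ _ (XYt_mem_kerV (by simp [hζ]))

/-- For distinct `ζ` and `ζ⁻¹`, the monomials in `t_{ζ⁻¹}` vanish in `V_{m,ζ}` and vice versa, so
one element of `𝔭_N` can prescribe both components. -/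
theorem toPV_polylog {m : ℕ} {ζ : Mu N} (hζ : ζ ≠ ζ⁻¹) (c d : ℂ) (h : H N) :
    ((ofXY N (toPV m ζ ζ⁻¹ (pX N - c • (XYt 1 (m - 1) ζ + d • XYt 1 (m - 1) ζ⁻¹)))
      (toPV m ζ ζ⁻¹ (pY N - c • (XYt 0 m ζ + d • XYt 0 m ζ⁻¹))) h : PV m ζ ζ⁻¹) :
        V m ζ × V m ζ⁻¹) = (splitV m ζ c h, splitV m ζ⁻¹ (d * c) h) := by
  have h1 : ∀ (a b : ℕ) (x : p N), toV m ζ (x - c • (XYt a b ζ + d • XYt a b ζ⁻¹)) =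
      toV m ζ (x - c • XYt a b ζ) := by
    intro a b x
    have := toV_sub_add (m := m) (a := a) (b := b) hζ.symm x c 1 d
    rwa [one_smul, mul_one] at this
  have h2 : ∀ (a b : ℕ) (x : p N), toV m ζ⁻¹ (x - c • (XYt a b ζ + d • XYt a b ζ⁻¹)) =
      toV m ζ⁻¹ (x - (d * c) • XYt a b ζ⁻¹) := by
    intro a b x
    have := toV_sub_add (m := m) (a := a) (b := b) hζ x c d 1
    rwa [one_smul, add_comm, mul_comm c] at this
  rw [ofXY_apply]
  simp only [Submodule.coe_add, Submodule.coe_smul, toPV_apply, Prod.smul_mk, Prod.mk_add_mk,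
    h1, h2]
  rfl

/-! ### Derivations -/

theorem yDxA_mem_D1 {f : A N} (hf : f ∈ D1 N) : yDxA N f ∈ D1 N := by
  refine ⟨yDxA_mem N hf.1, ?_, ?_⟩
  · simp [yDxA_apply, yDxCoeff]
  · simp [yDxA_apply, yDxCoeff, hf.2.1]

theorem yDxCoeff_congr (w : List (Letter N)) {f g : A N} (h : ∀ u, u.length = w.length → f u = g u) :
    yDxCoeff w f = yDxCoeff w g := by
  induction w generalizing f g with
  | nil => rfl
  | cons c w ih =>
    have h1 : ∀ l, yDxCoeff w (tail l f) = yDxCoeff w (tail l g) := fun l =>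
      ih fun u hu => h _ (by simp [hu])
    cases c <;> simp only [yDxCoeff, h1]
    rw [h _ (by simp)]

theorem yDxA_mem_D2 {f : A N} (hf : f ∈ D2 N) : yDxA N f ∈ D2 N := by
  intro n
  obtain ⟨g, hg, h⟩ := hf n
  refine ⟨yDxA N g, ?_, fun w hw => yDxCoeff_congr w fun u hu => h u (hu ▸ hw)⟩
  clear h
  induction hg using Submodule.span_induction with
  | mem x hx =>
    obtain ⟨y, hy, z, hz, rfl⟩ := hx
    rw [yDxA_lie]
    exact add_mem (Submodule.subset_span ⟨_, yDxA_mem_D1 hy, _, hz, rfl⟩)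
      (Submodule.subset_span ⟨_, hy, _, yDxA_mem_D1 hz, rfl⟩)
  | zero => simp
  | add x y _ _ hx hy => rw [map_add]; exact add_mem hx hy
  | smul c x _ hx => rw [map_smul]; exact Submodule.smul_mem _ c hx

/-- `Y ∂/∂X` preserves `D^1`, hence also the closure `D^2` of its brackets. This makes `ε^op`
independent of the choice of `ε` modulo `D^2`. -/
theorem DerCongr.yDx_lie {δ δ' : LieDerivation ℂ (p N) (p N)} (h : DerCongr δ δ') :
    DerCongr ⁅yDx N, δ⁆ ⁅yDx N, δ'⁆ := by
  intro x
  have : ⁅yDx N, δ⁆ x - ⁅yDx N, δ'⁆ x =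
      yDx N (δ x - δ' x) - (δ (yDx N x) - δ' (yDx N x)) := by
    rw [LieDerivation.commutator_apply, LieDerivation.commutator_apply, map_sub]
    abel
  rw [this, map_sub]
  exact sub_mem (yDxA_mem_D2 (h x)) (h _)

theorem yDx_lie_ad (z : p N) : ⁅yDx N, LieDerivation.ad ℂ (p N) z⁆ =
    LieDerivation.ad ℂ (p N) (yDx N z) := by
  ext1 x
  rw [LieDerivation.commutator_apply, LieDerivation.ad_apply_apply, LieDerivation.ad_apply_apply,
    LieDerivation.ad_apply_apply, LieDerivation.apply_lie_eq_add]
  abel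

/-- Higher Leibniz rule; only two terms remain because `Y ∂/∂X` applied twice annihilates `X`. -/
theorem yDx_iterate_lie_X (n : ℕ) (w : p N) :
    (yDx N)^[n + 1] ⁅pX N, w⁆ =
      ⁅pX N, (yDx N)^[n + 1] w⁆ + ((n : ℂ) + 1) • ⁅pY N, (yDx N)^[n] w⁆ := by
  have hX : yDx N (pX N) = pY N := Subtype.ext (yDxA_X N)
  have hY : yDx N (pY N) = 0 := Subtype.ext (yDxA_Y N)
  induction n with
  | zero =>
    simp only [zero_add, Function.iterate_one, Function.iterate_zero, id_eq, Nat.cast_zero,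
      one_smul, LieDerivation.apply_lie_eq_add, hX]
  | succ n ih =>
    rw [Function.iterate_succ_apply', ih, map_add, map_smul, LieDerivation.apply_lie_eq_add,
      LieDerivation.apply_lie_eq_add, hX, hY, ← Function.iterate_succ_apply' (f := yDx N),
      ← Function.iterate_succ_apply' (f := yDx N), zero_lie]
    push_cast
    module

theorem XYt_succ_left (a b : ℕ) (ζ : Mu N) : XYt (a + 1) b ζ = ⁅pX N, XYt a b ζ⁆ :=
  Function.iterate_succ_apply' _ _ _

theorem XYt_zero_succ (b : ℕ) (ζ : Mu N) : XYt 0 (b + 1) ζ = ⁅pY N, XYt 0 b ζ⁆ :=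
  Function.iterate_succ_apply' _ _ _

/-- Each application turns one `X` into `Y`, in `k!` possible orders altogether. The vanishing of
the next iterate is carried along because it removes the first term of `yDx_iterate_lie_X` in the
inductive step. -/
theorem yDx_iterate_XYt (k : ℕ) (ζ : Mu N) : (yDx N)^[k + 1] (XYt k 0 ζ) = 0 ∧
    (yDx N)^[k] (XYt k 0 ζ) = (k.factorial : ℂ) • XYt 0 k ζ := by
  induction k with
  | zero => exact ⟨Subtype.ext (yDxA_T N ζ), by simp⟩
  | succ k ih =>
    obtain ⟨h1, h2⟩ := ih
    rw [XYt_succ_left, yDx_iterate_lie_X, yDx_iterate_lie_X, h1, h2]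
    refine ⟨?_, ?_⟩
    · rw [Function.iterate_succ_apply', h1]; simp
    · rw [XYt_zero_succ, Nat.factorial_succ, lie_zero, zero_add, lie_smul, smul_smul]
      push_cast
      rfl

/-- Iterating `⁅Y ∂/∂X, ad z⁆ = ad (Y ∂/∂X (z))` moves the derivative onto the monomials, and the
resulting `(m - 1)!` cancels the normalization of `ε^op`. -/
theorem epsOp_sub_mem {m : ℕ} (ζ : Mu N) {ε : LieDerivation ℂ (p N) (p N)} (hε : IsEps m ζ ε)
    (x : p N) : incl N (epsOp m ε x -
      ⁅XYt 0 (m - 1) ζ + (-1 : ℂ) ^ (m + 1) • XYt 0 (m - 1) ζ⁻¹, x⁆) ∈ D2 N := by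
  have h1 : ∀ k, DerCongr ((fun δ => ⁅yDx N, δ⁆)^[k] ε) (LieDerivation.ad ℂ (p N)
      ((yDx N)^[k] (XYt (m - 1) 0 ζ + (-1 : ℂ) ^ (m + 1) • XYt (m - 1) 0 ζ⁻¹))) := by
    intro k
    induction k with
    | zero => exact hε
    | succ k ih =>
      rw [Function.iterate_succ_apply', Function.iterate_succ_apply', ← yDx_lie_ad]
      exact ih.yDx_lie
  have h2 : (yDx N)^[m - 1] (XYt (m - 1) 0 ζ + (-1 : ℂ) ^ (m + 1) • XYt (m - 1) 0 ζ⁻¹) =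
      ((m - 1).factorial : ℂ) • (XYt 0 (m - 1) ζ + (-1 : ℂ) ^ (m + 1) • XYt 0 (m - 1) ζ⁻¹) := by
    have h3 : ∀ k, (yDx N)^[k] = ⇑(((yDx N : p N →ₗ[ℂ] p N)) ^ k) := fun k =>
      (Module.End.coe_pow _ _).symm
    rw [h3, map_add, map_smul, ← h3, (yDx_iterate_XYt _ _).2, (yDx_iterate_XYt _ _).2, smul_add,
      smul_comm]
  have h3 := h1 (m - 1) x
  rw [h2, LieDerivation.ad_apply_apply] at h3
  have h4 := Submodule.smul_mem _ ((1 : ℂ) / ((m - 1).factorial : ℂ)) h3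
  have hf : ((m - 1).factorial : ℂ) ≠ 0 := by exact_mod_cast Nat.factorial_ne_zero _
  rw [← map_smul, smul_sub, smul_lie, smul_smul, one_div, inv_mul_cancel₀ hf, one_smul] at h4
  rw [epsOp, one_div]
  exact h4

theorem D2_le_kerV (m : ℕ) (ζ : Mu N) : D2 N ≤ kerV m ζ :=
  le_sup_left.trans (le_closure _)

/-- The section `1 + c ε^op` in every `V_{m,η}`. -/
theorem toV_comp_onePlus {m : ℕ} (hm : 2 ≤ m) (ζ η : Mu N) {ε : LieDerivation ℂ (p N) (p N)}
    (hε : IsEps m ζ ε) (c : ℂ) : toV m η ∘ₗ onePlus c (epsOp m ε) =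
      ofXY N (toV m η (pX N - c • (XYt 1 (m - 1) ζ + (-1 : ℂ) ^ (m + 1) • XYt 1 (m - 1) ζ⁻¹)))
        (toV m η (pY N - c • (XYt 0 m ζ + (-1 : ℂ) ^ (m + 1) • XYt 0 m ζ⁻¹))) := by
  have h1 : onePlus c (epsOp m ε) = ofXY N (pX N + c • epsOp m ε (pX N))
      (pY N + c • epsOp m ε (pY N)) := by
    rw [onePlus, drLift, comp_ofXY, smul_ofXY, ofXY_add]
    rfl
  -- The minus sign in the splittings is the antisymmetry of the bracket: `ad z (x) = -⁅x, z⁆`.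
  have h2 : ∀ x : p N, toV m η (x + c • epsOp m ε x) = toV m η (x - c • ⁅x,
      XYt 0 (m - 1) ζ + (-1 : ℂ) ^ (m + 1) • XYt 0 (m - 1) ζ⁻¹⁆) := by
    intro x
    refine toV_eq ?_
    have := Submodule.smul_mem _ c (D2_le_kerV m η (epsOp_sub_mem ζ hε x))
    rw [← map_smul] at this
    convert this using 2
    rw [← lie_skew x]
    module
  obtain ⟨n, rfl⟩ : ∃ n, m = n + 1 := ⟨m - 1, by omega⟩
  rw [h1, comp_ofXY, h2, h2, lie_add, lie_add, lie_smul, lie_smul]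
  simp only [Nat.add_sub_cancel, ← XYt_succ_left, ← XYt_zero_succ, zero_add]

theorem Li_parity {m : ℕ} (hm : 2 ≤ m) (ζ : Mu N) :
    ∃ q : ℚ, Li m ζ + (-1) ^ m * Li m ζ⁻¹ = q * tpi ^ m := by
  obtain ⟨n, rfl⟩ : ∃ n, m = n + 1 := ⟨m - 1, by omega⟩
  exact Li_add_Li_inv n (by omega) ζ

end EllPolylog

end


/-! ### The four statements. -/

theorem mainTheorem7 (N : ℕ) [NeZero N] (m : ℕ) (hm : 2 ≤ m) (ζ : Mu N) :
    (IsHodgeSection (HMHS N) (VMHS m ζ) (VtoH m ζ) (toV m ζ ∘ₗ drLift N) ∧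
      IsDeRhamSplitting (HMHS N) (VMHS m ζ) (VtoH m ζ)
        (ofXY N (toV m ζ (pX N - Li m ζ • XYt 1 (m - 1) ζ))
          (toV m ζ (pY N - Li m ζ • XYt 0 m ζ)))) ∧
    (IsHodgeSection (HMHS N) (PVMHS m ζ ζ⁻¹) (PVtoH m ζ ζ⁻¹) (toPV m ζ ζ⁻¹ ∘ₗ drLift N) ∧
      ∃ s : H N →ₗ[ℂ] PV m ζ ζ⁻¹,
        (∀ h, (s h : V m ζ × V m ζ⁻¹) =
          (splitV m ζ (Li m ζ) h, splitV m ζ⁻¹ ((-1) ^ (m + 1) * Li m ζ) h)) ∧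
        IsDeRhamSplitting (HMHS N) (PVMHS m ζ ζ⁻¹) (PVtoH m ζ ζ⁻¹) s) ∧
    (ζ ≠ ζ⁻¹ →
      IsDeRhamSplitting (HMHS N) (PVMHS m ζ ζ⁻¹) (PVtoH m ζ ζ⁻¹)
        (ofXY N
          (toPV m ζ ζ⁻¹ (pX N - Li m ζ •
            (XYt 1 (m - 1) ζ + (-1 : ℂ) ^ (m + 1) • XYt 1 (m - 1) ζ⁻¹)))
          (toPV m ζ ζ⁻¹ (pY N - Li m ζ • (XYt 0 m ζ + (-1 : ℂ) ^ (m + 1) • XYt 0 m ζ⁻¹)))) ∧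
      ∀ ε : LieDerivation ℂ (p N) (p N), IsEps m ζ ε →
        IsDeRhamSplitting (HMHS N) (PVMHS m ζ ζ⁻¹) (PVtoH m ζ ζ⁻¹)
          (toPV m ζ ζ⁻¹ ∘ₗ onePlus (Li m ζ) (epsOp m ε)) ∧
        toPV m ζ ζ⁻¹ ∘ₗ onePlus (Li m ζ) (epsOp m ε) =
          ofXY N
            (toPV m ζ ζ⁻¹ (pX N - Li m ζ •
              (XYt 1 (m - 1) ζ + (-1 : ℂ) ^ (m + 1) • XYt 1 (m - 1) ζ⁻¹)))
            (toPV m ζ ζ⁻¹ (pY N - Li m ζ •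
              (XYt 0 m ζ + (-1 : ℂ) ^ (m + 1) • XYt 0 m ζ⁻¹)))) ∧
    (ζ = ζ⁻¹ → ∀ ε : LieDerivation ℂ (p N) (p N), IsEps m ζ ε →
      IsDeRhamSplitting (HMHS N) (VMHS m ζ) (VtoH m ζ)
        (toV m ζ ∘ₗ onePlus (Li m ζ / 2) (epsOp m ε))) := by
  obtain ⟨q, hq⟩ := Li_parity hm ζ
  have hsq : ((-1 : ℂ) ^ m) * (-1) ^ m = 1 := by rw [← mul_pow]; simp
  have h0 : IsDeRhamSplitting (HMHS N) (VMHS m ζ) (VtoH m ζ) (splitV m ζ (Li m ζ)) :=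
    isDeRhamSplitting_V hm ζ (q := 0) (by simp)
  have h0' : IsDeRhamSplitting (HMHS N) (VMHS m ζ⁻¹) (VtoH m ζ⁻¹)
      (splitV m ζ⁻¹ ((-1) ^ (m + 1) * Li m ζ)) := by
    -- The inversion relation multiplied by `-(-1)^m` compares `(-1)^{m+1} Li_m(ζ)` with
    -- `Li_m(ζ⁻¹)`.
    refine isDeRhamSplitting_V hm ζ⁻¹ (q := -(-1) ^ m * q) ?_
    push_cast
    rw [pow_succ]
    linear_combination (-(-1) ^ m : ℂ) * hq + Li m ζ⁻¹ * hsq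
  refine ⟨⟨isHodgeSection_V m ζ, h0⟩, ⟨isHodgeSection_PV m ζ ζ⁻¹, ?_⟩, fun hζ => ?_, fun hζ ε hε => ?_⟩
  · have hcomp : VtoH m ζ ∘ₗ splitV m ζ (Li m ζ) =
        VtoH m ζ⁻¹ ∘ₗ splitV m ζ⁻¹ ((-1) ^ (m + 1) * Li m ζ) := by
      rw [VtoH_comp_splitV, VtoH_comp_splitV]
    exact ⟨pullLift _ _ _ _ hcomp, fun _ => rfl, isDeRhamSplitting_PV h0 h0' fun _ => rfl⟩
  · have hs := isDeRhamSplitting_PV h0 h0' (toPV_polylog hζ (Li m ζ) ((-1) ^ (m + 1)))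
    refine ⟨hs, fun ε hε => ?_⟩
    have he : toPV m ζ ζ⁻¹ ∘ₗ onePlus (Li m ζ) (epsOp m ε) =
          ofXY N
            (toPV m ζ ζ⁻¹ (pX N - Li m ζ •
              (XYt 1 (m - 1) ζ + (-1 : ℂ) ^ (m + 1) • XYt 1 (m - 1) ζ⁻¹)))
            (toPV m ζ ζ⁻¹ (pY N - Li m ζ •
              (XYt 0 m ζ + (-1 : ℂ) ^ (m + 1) • XYt 0 m ζ⁻¹))) := by
      refine LinearMap.ext fun h => Subtype.ext (Prod.ext ?_ ?_)
      · exact LinearMap.congr_fun (toV_comp_onePlus hm ζ ζ hε (Li m ζ)) h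
      · exact LinearMap.congr_fun (toV_comp_onePlus hm ζ ζ⁻¹ hε (Li m ζ)) h
    exact ⟨he ▸ hs, he⟩
  · have he : toV m ζ ∘ₗ onePlus (Li m ζ / 2) (epsOp m ε) =
        splitV m ζ (Li m ζ / 2 * (1 + (-1) ^ (m + 1))) := by
      rw [toV_comp_onePlus hm ζ ζ hε, ← hζ, splitV]
      congr 2 <;> module
    rw [he]
    -- Here the two monomials coincide, and the coefficient is `Li_m(ζ)` for odd `m` and `0` for
    -- even `m`. In the even case the inversion relation makes `Li_m(ζ)` itself a rational multiple
    -- of `(2πi)^m`; its half covers both parities.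
    refine isDeRhamSplitting_V hm ζ (q := -q / 2) ?_
    rw [← hζ] at hq
    push_cast
    rw [pow_succ]
    linear_combination (-1 / 2 : ℂ) * hq
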